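/- Let $q\ge 2$ be an integer and let $G$ be a topological group. Let $F_n$ be the free group on $n$ generators and $\Gamma_n^q$ the $q$-th term of its descending central series, with $\Gamma_n^1=F_n$. Evaluation on the generators identifies $B_n(q,G):=\operatorname{Hom}(F_n/\Gamma_n^q,G)$ with a subset of $G^n$ (the set of $n$-tuples generating a subgroup of nilpotence class less than $q$), and $B_n(q,G)$ carries the subspace topology. With the face and degeneracy maps of the bar construction the spaces $B_n(q,G)$, $n\ge 0$, form a simplicial space; let $B(q,G)$ be its geometric realization. Lemma. Let $G$ be a topological group that admits the structure of a (Hausdorff) CW-complex. Assume that $\pi_0(G)$ is abelian and that the natural homomorphism $G\to\pi_0(G)$ splits, that is, it has a right inverse $\pi_0(G)\to G$ that is a group homomorphism. Then, for every $q\ge 2$, the space $B(q,G)$ is path connected and, for every base point, there is an isomorphism of groups $$\pi_1(B(q,G))\cong \pi_0(G).$$ -/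

import Mathlib

/-! ### The group of path components of a topological group -/

/-- `π₀(G)`, the set of path components of a topological group `G`, with the group structure for
which `G → π₀(G)` is a homomorphism. -/
instance zerothHomotopyGroup (G : Type*) [Group G] [TopologicalSpace G] [IsTopologicalGroup G] :
    Group (ZerothHomotopy G) where
  mul := Quotient.map₂ (· * ·) fun _ _ h₁ _ _ h₂ => Joined.mul h₁ h₂
  one := ZerothHomotopy.mk 1
  inv := Quotient.map (·⁻¹) fun _ _ h => Joined.inv h
  mul_assoc := by
    rintro ⟨a⟩ ⟨b⟩ ⟨c⟩
    exact congrArg ZerothHomotopy.mk (mul_assoc a b c)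
  one_mul := by
    rintro ⟨a⟩
    exact congrArg ZerothHomotopy.mk (one_mul a)
  mul_one := by
    rintro ⟨a⟩
    exact congrArg ZerothHomotopy.mk (mul_one a)
  inv_mul_cancel := by
    rintro ⟨a⟩
    exact congrArg ZerothHomotopy.mk (inv_mul_cancel a)

/-- The natural homomorphism `G → π₀(G)`. -/
def toPiZero (G : Type*) [Group G] [TopologicalSpace G] [IsTopologicalGroup G] :
    G →* ZerothHomotopy G where
  toFun := ZerothHomotopy.mk
  map_one' := rfl
  map_mul' _ _ := rfl

/-! ### The simplicial structure of the bar construction -/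

/-- The map `θ^* : Gⁿ → Gᵐ` of the bar construction induced by a monotone map `θ : [m] → [n]`.
The `j`-th entry of `θ^*(g₁, …, gₙ)` is the product of the `gᵢ` with `θ (j - 1) < i ≤ θ j`. -/
def barMap {G : Type*} [Group G] {m n : ℕ} (θ : Fin (m + 1) →o Fin (n + 1))
    (g : Fin n → G) (j : Fin m) : G :=
  (Fin.partialProd g (θ j.castSucc))⁻¹ * Fin.partialProd g (θ j.succ)

theorem map_partialProd {G H : Type*} [Group G] [Group H] (f : G →* H) {n : ℕ} (g : Fin n → G)
    (i : Fin (n + 1)) : f (Fin.partialProd g i) = Fin.partialProd (fun k => f (g k)) i := by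
  induction i using Fin.induction with
  | zero => simp
  | succ i ih => simp [Fin.partialProd_succ, ih]

theorem map_barMap {G H : Type*} [Group G] [Group H] (f : G →* H) {m n : ℕ}
    (θ : Fin (m + 1) →o Fin (n + 1)) (g : Fin n → G) (j : Fin m) :
    f (barMap θ g j) = barMap θ (fun k => f (g k)) j := by
  simp [barMap, map_partialProd]

theorem partialProd_barMap {G : Type*} [Group G] {m n : ℕ} (θ : Fin (m + 1) →o Fin (n + 1))
    (g : Fin n → G) (i : Fin (m + 1)) :
    Fin.partialProd (barMap θ g) i
      = (Fin.partialProd g (θ 0))⁻¹ * Fin.partialProd g (θ i) := by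
  induction i using Fin.induction with
  | zero => simp
  | succ i ih => simp [Fin.partialProd_succ, ih, barMap]

/-- The maps `θ^*` respect identities. -/
theorem barMap_id {G : Type*} [Group G] {n : ℕ} (g : Fin n → G) :
    barMap OrderHom.id g = g :=
  funext fun j => Fin.partialProd_right_inv g j

/-- The maps `θ^*` respect composition. -/
theorem barMap_comp {G : Type*} [Group G] {l m n : ℕ} (θ : Fin (m + 1) →o Fin (n + 1))
    (η : Fin (l + 1) →o Fin (m + 1)) (g : Fin n → G) :
    barMap (θ.comp η) g = barMap η (barMap θ g) := by
  funext j
  simp [barMap, partialProd_barMap, mul_assoc]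

/-! ### The spaces `Bₙ(q, G)` and `B(q, G)` -/

/-- `Bₙ(q, G) = Hom(Fₙ / Γ^q, G)`, as the set of the `g ∈ Gⁿ` for which the homomorphism `Fₙ → G`
sending the generators to the entries of `g` kills `Γ^q`, the `q`-th term of the descending central
series of the free group `Fₙ` with `Γ¹ = Fₙ` (Mathlib numbers this series from `0`). -/
def nilTuples (q : ℕ) (G : Type*) [Group G] (n : ℕ) : Set (Fin n → G) :=
  {g | (⊤ : Subgroup (FreeGroup (Fin n))).lowerCentralSeries (q - 1) ≤ (FreeGroup.lift g).ker}

theorem map_lowerCentralSeries_le {G H : Type*} [Group G] [Group H] (f : G →* H) (k : ℕ) :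
    ((⊤ : Subgroup G).lowerCentralSeries k).map f ≤ (⊤ : Subgroup H).lowerCentralSeries k := by
  induction k with
  | zero => exact le_top
  | succ k ih =>
    rw [Subgroup.lowerCentralSeries_succ, Subgroup.lowerCentralSeries_succ,
      Subgroup.map_commutator]
    exact Subgroup.commutator_mono ih le_top

/-- The maps `θ^*` of the bar construction preserve the subspaces `Bₙ(q, G) ⊆ Gⁿ`. -/
theorem barMap_mem_nilTuples {q : ℕ} {G : Type*} [Group G] {m n : ℕ}
    (θ : Fin (m + 1) →o Fin (n + 1)) {g : Fin n → G} (hg : g ∈ nilTuples q G n) :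
    barMap θ g ∈ nilTuples q G m := by
  have key : FreeGroup.lift (barMap θ g)
      = (FreeGroup.lift g).comp (FreeGroup.lift (barMap θ fun k => FreeGroup.of k)) := by
    ext j
    simp [map_barMap]
  intro x hx
  rw [MonoidHom.mem_ker, key, MonoidHom.comp_apply]
  exact hg (map_lowerCentralSeries_le _ _ (Subgroup.mem_map_of_mem _ hx))

/-- The simplicial structure map `θ^* : Bₙ(q, G) → Bₘ(q, G)`. -/
def nilMap {q : ℕ} {G : Type*} [Group G] {m n : ℕ} (θ : Fin (m + 1) →o Fin (n + 1))
    (g : nilTuples q G n) : nilTuples q G m :=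
  ⟨barMap θ g.1, barMap_mem_nilTuples θ g.2⟩

/-- The identifications `(θ^* g, t) ∼ (g, θ_* t)` in `∐ₙ Bₙ(q, G) × Δⁿ`, for `θ : [m] → [n]`
monotone, `g ∈ Bₙ(q, G)` and `t ∈ Δᵐ`. -/
inductive NilGlue (q : ℕ) (G : Type*) [Group G] :
    (Σ n : ℕ, nilTuples q G n × stdSimplex ℝ (Fin (n + 1))) →
    (Σ n : ℕ, nilTuples q G n × stdSimplex ℝ (Fin (n + 1))) → Prop
  | glue {m n : ℕ} (θ : Fin (m + 1) →o Fin (n + 1)) (g : nilTuples q G n)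
      (t : stdSimplex ℝ (Fin (m + 1))) :
      NilGlue q G ⟨m, nilMap θ g, t⟩ ⟨n, g, stdSimplex.map θ t⟩

/-- `B(q, G)`, the geometric realization of the simplicial space `n ↦ Bₙ(q, G)`. -/
def NilClassifying (q : ℕ) (G : Type*) [Group G] : Type _ :=
  Quot (NilGlue q G)

/-- The quotient topology on `B(q, G)`; here `Bₙ(q, G) ⊆ Gⁿ` has the subspace topology. -/
instance (q : ℕ) (G : Type*) [Group G] [TopologicalSpace G] :
    TopologicalSpace (NilClassifying q G) :=
  inferInstanceAs (TopologicalSpace (Quot (NilGlue q G)))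

/-! Up to homotopy, the loop along the 1-simplex labelled g depends only on the component of g, and
for commuting g and h the 2-simplex (g, h) shows that the loops of g and h compose to the loop of
gh. Since π₀(G) is abelian, a homomorphic section s of G → π₀(G) has commuting values, so sending a
to the loop labelled s(a) defines a homomorphism from π₀(G) to the fundamental group at the vertex
(`edgeHom`). The condition q ≥ 2 serves to put commuting tuples into Bₙ(q, G). The claim is that
`edgeHom` is bijective.

Injectivity comes from a covering with fibre π₀(G). The vertices 1, g₁, g₁g₂, … of a simplex are
well defined up to a common left translation, so the differences of their components are invariants;
they are the transition functions of `componentBundle`. The lift of the loop labelled g moves the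
sheet 1 to the sheet of the component of g (`edgeHom_injective`).

Surjectivity is the long part, because no cofibration property of the degeneracies is used. A point
of a simplex is viewed as a subdivision of [0, 1] whose intervals are marked by the vertices.
Monotone reparametrizations of [0, 1] then act on the realization (`act`), and straight lines join
this action to the identity (`track`). A window inside one interval sends the given point to the
base vertex and nearby points close to it. Closing up a short piece of a loop in this way gives a
small loop followed by an edge loop (`exists_edge_of_track`). Edge loops lie in the image, so by
connectedness of the interval (`mem_of_eventually_mem`) the whole loop does, as soon as small loops
contract.

To contract small loops, note that a loop is compact: it lies in finitely many dimensions
(`exists_subset_fil`) and its labels lie in a finite union of cells (`exists_scale`). Such a union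
is compact, first countable and locally path connected, even if G is not first countable, and this
yields a decreasing sequence of sets `small` that forms a neighbourhood basis of the vertex within
the bounded part (`exists_small_subset`). Then one inducts on the filtration degree
(`loopsContract`). Away from the vertex, a suitable window lowers the degree, so the induction
hypothesis makes pieces of the loop homotopic to straight detours through the vertex
(`exists_homotopic_of_ne_pt`). The loop may return to the vertex infinitely often, so the homotopies
are chosen over a Whitney decomposition of the remaining times, with sizes tending to zero near the
returns, and glued (`exists_nullHomotopy_of_fillers`). -/

section

open Set Topology unitInterval CategoryTheory

/-! ### Reparametrizations of simplices -/

section Simplex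

/-- A point of the standard simplex `Δⁿ`. -/
abbrev Simp (n : ℕ) : Type := stdSimplex ℝ (Fin (n + 1))

/-- Change of variables for the push-forward of weights. It transports every weighted count of
vertices along the gluing relation. -/
theorem Simp.sum_map {m n : ℕ} (θ : Fin (m + 1) → Fin (n + 1)) (t : Simp m)
    (w : Fin (n + 1) → ℝ) :
    ∑ k, w k * stdSimplex.map θ t k = ∑ j, w (θ j) * t j := by
  classical
  simp only [stdSimplex.map_coe, FunOnFinite.linearMap_apply_apply, Finset.mul_sum]
  rw [← Finset.sum_fiberwise (s := Finset.univ) (g := θ)]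
  refine Finset.sum_congr rfl fun k _ => Finset.sum_congr rfl fun j hj => ?_
  rw [(Finset.mem_filter.1 hj).2]

theorem Simp.map_pos_iff {m n : ℕ} (θ : Fin (m + 1) → Fin (n + 1)) (t : Simp m)
    (k : Fin (n + 1)) : 0 < stdSimplex.map θ t k ↔ ∃ j, θ j = k ∧ 0 < t j := by
  classical
  simp only [stdSimplex.map_coe, FunOnFinite.linearMap_apply_apply]
  rw [Finset.sum_pos_iff_of_nonneg (f := fun j => t j) fun j _ => t.2.1 j]
  simp

theorem Simp.continuous_coord {n : ℕ} (i : Fin (n + 1)) : Continuous fun t : Simp n => t i :=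
  (continuous_apply i).comp continuous_subtype_val

/-- The point `(1 - s) t + s t'` of the segment from `t` to `t'`. -/
def Simp.mix {n : ℕ} (s : I) (t t' : Simp n) : Simp n :=
  ⟨fun i => (1 - (s : ℝ)) * t i + s * t' i,
    fun i => add_nonneg (mul_nonneg (sub_nonneg.2 s.2.2) (t.2.1 i)) (mul_nonneg s.2.1 (t'.2.1 i)),
    by
      have h1 := t.2.2
      have h2 := t'.2.2
      change ∑ i, t i = 1 at h1
      change ∑ i, t' i = 1 at h2
      rw [Finset.sum_add_distrib, ← Finset.mul_sum, ← Finset.mul_sum, h1, h2]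
      ring⟩

theorem Simp.mix_apply {n : ℕ} (s : I) (t t' : Simp n) (i : Fin (n + 1)) :
    Simp.mix s t t' i = (1 - (s : ℝ)) * t i + s * t' i := rfl

@[simp] theorem Simp.mix_zero {n : ℕ} (t t' : Simp n) : Simp.mix 0 t t' = t := by
  ext i; simp [Simp.mix_apply]

@[simp] theorem Simp.mix_one {n : ℕ} (t t' : Simp n) : Simp.mix 1 t t' = t' := by
  ext i; simp [Simp.mix_apply]

theorem Simp.continuous_mix {n : ℕ} :
    Continuous fun p : I × Simp n × Simp n => Simp.mix p.1 p.2.1 p.2.2 := by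
  refine Continuous.subtype_mk (continuous_pi fun i => ?_) _
  have h1 : Continuous fun p : I × Simp n × Simp n => p.2.1 i :=
    (Simp.continuous_coord i).comp (by fun_prop)
  have h2 : Continuous fun p : I × Simp n × Simp n => p.2.2 i :=
    (Simp.continuous_coord i).comp (by fun_prop)
  fun_prop

theorem Simp.map_mix {m n : ℕ} (θ : Fin (m + 1) → Fin (n + 1)) (s : I) (t t' : Simp m) :
    stdSimplex.map θ (Simp.mix s t t') = Simp.mix s (stdSimplex.map θ t) (stdSimplex.map θ t') := by
  classical
  ext k
  simp only [Simp.mix_apply, stdSimplex.map_coe, FunOnFinite.linearMap_apply_apply,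
    Finset.mul_sum, ← Finset.sum_add_distrib]
  rfl

/-- The total mass of the coordinates with index less than `k`. -/
def Simp.cum {n : ℕ} (t : Simp n) (k : ℕ) : ℝ := ∑ j : Fin (n + 1), if (j : ℕ) < k then t j else 0

theorem Simp.cum_zero {n : ℕ} (t : Simp n) : t.cum 0 = 0 := by simp [Simp.cum]

theorem Simp.cum_of_le {n : ℕ} (t : Simp n) {k : ℕ} (h : n + 1 ≤ k) : t.cum k = 1 := by
  rw [Simp.cum, ← stdSimplex.sum_eq_one t]
  refine Finset.sum_congr rfl fun j _ => if_pos (by omega)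

theorem Simp.cum_succ {n : ℕ} (t : Simp n) (i : Fin (n + 1)) :
    t.cum (i + 1) = t.cum i + t i := by
  have h : t i = ∑ j : Fin (n + 1), if j = i then t j else 0 := by simp
  rw [h, Simp.cum, Simp.cum, ← Finset.sum_add_distrib]
  refine Finset.sum_congr rfl fun j _ => ?_
  rcases lt_trichotomy (j : ℕ) (i : ℕ) with hj | hj | hj
  · rw [if_pos (by omega), if_pos hj, if_neg (by rintro rfl; omega), add_zero]
  · rw [if_pos (by omega), if_neg (by omega), if_pos (Fin.ext hj), zero_add]
  · rw [if_neg (by omega), if_neg (by omega), if_neg (by rintro rfl; omega), add_zero]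

theorem Simp.cum_mono {n : ℕ} (t : Simp n) : Monotone t.cum := by
  intro k l h
  refine Finset.sum_le_sum fun j _ => ?_
  split_ifs with h1 h2 h2
  · exact le_rfl
  · omega
  · exact t.2.1 j
  · exact le_rfl

theorem Simp.continuous_cum {n : ℕ} (k : ℕ) : Continuous fun t : Simp n => t.cum k := by
  refine continuous_finsetSum _ fun j _ => ?_
  split_ifs
  · exact Simp.continuous_coord j
  · exact continuous_const

theorem Simp.cum_map {m n : ℕ} (θ : Fin (m + 1) → Fin (n + 1)) (t : Simp m) (k : ℕ) :
    Simp.cum (stdSimplex.map θ t) k = ∑ j, if (θ j : ℕ) < k then t j else 0 := by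
  have := Simp.sum_map θ t fun i => if (i : ℕ) < k then 1 else 0
  simpa [Simp.cum] using this

/-- A continuous monotone reparametrization of `[0, 1]`. -/
structure Reparam where
  toFun : ℝ → ℝ
  mono : Monotone toFun
  cont : Continuous toFun
  zero : toFun 0 = 0
  one : toFun 1 = 1

/-- The action of a reparametrization of `[0, 1]` on a simplex, whose points are regarded as
subdivisions of `[0, 1]` into intervals. -/
def Reparam.warp (φ : Reparam) {n : ℕ} (t : Simp n) : Simp n :=
  ⟨fun i => φ.toFun (t.cum (i + 1)) - φ.toFun (t.cum i),
    fun i => sub_nonneg.2 (φ.mono (t.cum_mono (by omega))), by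
      have := Finset.sum_range_sub (fun k => φ.toFun (t.cum k)) (n + 1)
      rw [Finset.sum_range] at this
      rw [this, t.cum_of_le le_rfl, t.cum_zero, φ.one, φ.zero, sub_zero]⟩

theorem Reparam.warp_apply (φ : Reparam) {n : ℕ} (t : Simp n) (i : Fin (n + 1)) :
    φ.warp t i = φ.toFun (t.cum (i + 1)) - φ.toFun (t.cum i) := rfl

theorem Reparam.cum_warp (φ : Reparam) {n : ℕ} (t : Simp n) (k : ℕ) :
    (φ.warp t).cum k = φ.toFun (t.cum k) := by
  induction k with
  | zero => rw [Simp.cum_zero, Simp.cum_zero, φ.zero]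
  | succ k ih =>
    by_cases hk : k < n + 1
    · have := Simp.cum_succ (φ.warp t) ⟨k, hk⟩
      rw [this, ih, φ.warp_apply]
      ring
    · rw [Simp.cum_of_le _ (by omega), Simp.cum_of_le _ (by omega), φ.one]

theorem Reparam.continuous_warp (φ : Reparam) (n : ℕ) :
    Continuous fun t : Simp n => φ.warp t := by
  refine Continuous.subtype_mk (continuous_pi fun i => ?_) _
  exact (φ.cont.comp (Simp.continuous_cum _)).sub (φ.cont.comp (Simp.continuous_cum _))

theorem Reparam.warp_pos (φ : Reparam) {n : ℕ} {t : Simp n} {i : Fin (n + 1)}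
    (h : 0 < φ.warp t i) : 0 < t i := by
  by_contra hn
  have h0 : t i = 0 := le_antisymm (not_lt.1 hn) (t.2.1 i)
  rw [φ.warp_apply, t.cum_succ, h0, add_zero, sub_self] at h
  exact lt_irrefl _ h

theorem exists_lt_iff_of_monotone {m n : ℕ} (θ : Fin (m + 1) →o Fin (n + 1)) (k : ℕ) :
    ∃ l : ℕ, ∀ j : Fin (m + 1), (θ j : ℕ) < k ↔ (j : ℕ) < l := by
  classical
  by_cases h : ∃ l : ℕ, ∃ hl : l < m + 1, k ≤ (θ ⟨l, hl⟩ : ℕ)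
  · refine ⟨Nat.find h, fun j => ⟨fun hj => ?_, fun hj => ?_⟩⟩
    · obtain ⟨hl, hk⟩ := Nat.find_spec h
      by_contra hlt
      have : (⟨Nat.find h, hl⟩ : Fin (m + 1)) ≤ j := by
        rw [Fin.le_def]
        simpa using hlt
      have h2 := θ.monotone this
      rw [Fin.le_def] at h2
      omega
    · have := Nat.find_min h hj
      push Not at this
      exact this j.2
  · push Not at h
    exact ⟨m + 1, fun j => ⟨fun _ => j.2, fun _ => h j j.2⟩⟩

/-- The preimage of an initial segment under a monotone map is an initial segment, so every partial
sum of the push-forward is a partial sum of t; the reparametrization acts on partial sums, and these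
determine the point. This naturality is what makes `act` well defined. -/
theorem Reparam.map_warp (φ : Reparam) {m n : ℕ} (θ : Fin (m + 1) →o Fin (n + 1)) (t : Simp m) :
    stdSimplex.map θ (φ.warp t) = φ.warp (stdSimplex.map θ t) := by
  have key : ∀ k, Simp.cum (stdSimplex.map θ (φ.warp t)) k
      = (φ.warp (stdSimplex.map θ t)).cum k := by
    intro k
    obtain ⟨l, hl⟩ := exists_lt_iff_of_monotone θ k
    rw [φ.cum_warp, Simp.cum_map, Simp.cum_map]
    simp only [hl]
    exact φ.cum_warp t l
  ext i
  have h1 := Simp.cum_succ (stdSimplex.map θ (φ.warp t)) i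
  have h2 := Simp.cum_succ (φ.warp (stdSimplex.map θ t)) i
  rw [key, key] at h1
  linarith

/-- The reparametrization that stretches the window `[c, d]` to `[0, 1]`. -/
noncomputable def Reparam.window (c d : ℝ) (h0 : 0 ≤ c) (h : c < d) (h1 : d ≤ 1) : Reparam where
  toFun u := max 0 (min 1 ((u - c) / (d - c)))
  mono u v huv := by
    have : 0 < d - c := sub_pos.2 h
    exact max_le_max_left _ (min_le_min_left _ (by gcongr))
  cont := by fun_prop
  zero := by
    have : 0 < d - c := sub_pos.2 h
    have h2 : (0 - c) / (d - c) ≤ 0 := div_nonpos_of_nonpos_of_nonneg (by linarith) this.le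
    rw [min_eq_right (by linarith), max_eq_left h2]
  one := by
    have : 0 < d - c := sub_pos.2 h
    have h2 : 1 ≤ (1 - c) / (d - c) := by rw [le_div_iff₀ this]; linarith
    rw [min_eq_left h2, max_eq_right zero_le_one]

theorem Reparam.window_of_le {c d : ℝ} {h0 : 0 ≤ c} {h : c < d} {h1 : d ≤ 1} {u : ℝ}
    (hu : u ≤ c) : (Reparam.window c d h0 h h1).toFun u = 0 := by
  have : 0 < d - c := sub_pos.2 h
  have h2 : (u - c) / (d - c) ≤ 0 := div_nonpos_of_nonpos_of_nonneg (by linarith) this.le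
  change max 0 (min 1 ((u - c) / (d - c))) = 0
  rw [min_eq_right (by linarith), max_eq_left h2]

theorem Reparam.window_of_ge {c d : ℝ} {h0 : 0 ≤ c} {h : c < d} {h1 : d ≤ 1} {u : ℝ}
    (hu : d ≤ u) : (Reparam.window c d h0 h h1).toFun u = 1 := by
  have : 0 < d - c := sub_pos.2 h
  have h2 : 1 ≤ (u - c) / (d - c) := by rw [le_div_iff₀ this]; linarith
  change max 0 (min 1 ((u - c) / (d - c))) = 1
  rw [min_eq_left h2, max_eq_right zero_le_one]

theorem Reparam.window_of_mem {c d : ℝ} {h0 : 0 ≤ c} {h : c < d} {h1 : d ≤ 1} {u : ℝ}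
    (hc : c ≤ u) (hd : u ≤ d) : (Reparam.window c d h0 h h1).toFun u = (u - c) / (d - c) := by
  have : 0 < d - c := sub_pos.2 h
  change max 0 (min 1 ((u - c) / (d - c))) = _
  rw [min_eq_right (by rw [div_le_one this]; linarith),
    max_eq_right (div_nonneg (by linarith) this.le)]

/-- A window inside the `i`-th interval of the subdivision moves all the mass to the `i`-th
vertex. -/
theorem Reparam.warp_window_eq_vertex {n : ℕ} {t : Simp n} {i : Fin (n + 1)} {c d : ℝ}
    {h0 : 0 ≤ c} {h : c < d} {h1 : d ≤ 1} (hc : t.cum i ≤ c) (hd : d ≤ t.cum (i + 1)) :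
    (Reparam.window c d h0 h h1).warp t = stdSimplex.vertex i := by
  ext j
  rw [Reparam.warp_apply, stdSimplex.vertex_coe]
  rcases lt_trichotomy (j : ℕ) (i : ℕ) with hj | hj | hj
  · rw [Reparam.window_of_le ((t.cum_mono (show (j : ℕ) + 1 ≤ i by omega)).trans hc),
      Reparam.window_of_le ((t.cum_mono hj.le).trans hc),
      Pi.single_eq_of_ne (by rintro rfl; omega), sub_zero]
  · obtain rfl : j = i := Fin.ext hj
    rw [Reparam.window_of_ge hd, Reparam.window_of_le hc, Pi.single_eq_same, sub_zero]
  · rw [Reparam.window_of_ge (hd.trans (t.cum_mono (show (i : ℕ) + 1 ≤ j + 1 by omega))),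
      Reparam.window_of_ge (hd.trans (t.cum_mono (show (i : ℕ) + 1 ≤ j by omega))),
      Pi.single_eq_of_ne (by rintro rfl; omega), sub_self]

end Simplex

/-! ### Points, vertices and invariants of the realization -/

namespace NilClassifying

theorem indicator_one_nonneg {α : Type*} (V : Set α) (g : α) : (0 : ℝ) ≤ V.indicator 1 g :=
  Set.indicator_nonneg (fun _ _ => zero_le_one) _

theorem indicator_one_le {α : Type*} (V : Set α) (g : α) : V.indicator (1 : α → ℝ) g ≤ 1 :=
  Set.indicator_le_self' (fun _ _ => zero_le_one) _

section Algebra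

variable {q : ℕ} {G : Type*} [Group G]

/-- The vertices `1, g₁, g₁g₂, …` of a simplex. -/
def vert {n : ℕ} (x : nilTuples q G n) (i : Fin (n + 1)) : G := Fin.partialProd x.1 i

@[simp] theorem vert_zero {n : ℕ} (x : nilTuples q G n) : vert x 0 = 1 := Fin.partialProd_zero _

theorem vert_nilMap {m n : ℕ} (θ : Fin (m + 1) →o Fin (n + 1)) (x : nilTuples q G n)
    (i : Fin (m + 1)) : vert (nilMap θ x) i = (vert x (θ 0))⁻¹ * vert x (θ i) :=
  partialProd_barMap θ x.1 i

theorem vert_succ {n : ℕ} (x : nilTuples q G n) (j : Fin n) :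
    (vert x j.castSucc)⁻¹ * vert x j.succ = x.1 j := Fin.partialProd_right_inv _ _

/-- The point of `B(q, G)` with the given coordinates. -/
def mk {n : ℕ} (x : nilTuples q G n) (t : Simp n) : NilClassifying q G := Quot.mk _ ⟨n, x, t⟩

theorem mk_glue {m n : ℕ} (θ : Fin (m + 1) →o Fin (n + 1)) (x : nilTuples q G n) (t : Simp m) :
    mk (nilMap θ x) t = mk x (stdSimplex.map θ t) := Quot.sound (NilGlue.glue θ x t)

theorem exists_mk (z : NilClassifying q G) :
    ∃ (n : ℕ) (x : nilTuples q G n) (t : Simp n), z = mk x t := by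
  obtain ⟨⟨n, x, t⟩, rfl⟩ := Quot.exists_rep z
  exact ⟨n, x, t, rfl⟩

/-- The tuple all of whose entries are `1`. -/
def oneTuple (q : ℕ) (G : Type*) [Group G] (n : ℕ) : nilTuples q G n :=
  ⟨fun _ => 1, by
    have : FreeGroup.lift (fun _ : Fin n => (1 : G)) = 1 := by ext; simp
    intro x _
    rw [MonoidHom.mem_ker, this, MonoidHom.one_apply]⟩

/-- The vertex of `B(q, G)`. -/
def pt (q : ℕ) (G : Type*) [Group G] : NilClassifying q G :=
  mk (oneTuple q G 0) (stdSimplex.vertex 0)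

/-- The filtration of `B(q, G)` by the images of the `Bₙ(q, G) × Δⁿ`. -/
def fil (q : ℕ) (G : Type*) [Group G] (n : ℕ) : Set (NilClassifying q G) :=
  {z | ∃ (x : nilTuples q G n) (t : Simp n), z = mk x t}

theorem mk_mem_fil {n : ℕ} (x : nilTuples q G n) (t : Simp n) : mk x t ∈ fil q G n := ⟨x, t, rfl⟩

/-- Restrict to the face spanned by the support of t. The exact size of that face is recorded so
that a vanishing coordinate visibly lowers the filtration degree. -/
theorem exists_pos_rep {n : ℕ} (x : nilTuples q G n) (t : Simp n) :
    ∃ (m : ℕ) (y : nilTuples q G m) (s : Simp m),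
      m ≤ n ∧ (∀ i, 0 < s i) ∧ mk x t = mk y s ∧ m + 1 = {i | 0 < t i}.ncard := by
  classical
  set S : Finset (Fin (n + 1)) := Finset.univ.filter fun i => 0 < t i with hS
  have hSne : S.Nonempty := by
    by_contra h
    rw [Finset.not_nonempty_iff_eq_empty] at h
    have h1 := stdSimplex.sum_eq_one t
    have h2 : ∑ i, t i = 0 := Finset.sum_eq_zero fun i _ => by
      by_contra hi
      have : i ∈ S := Finset.mem_filter.2
        ⟨Finset.mem_univ _, lt_of_le_of_ne (t.2.1 i) (Ne.symm hi)⟩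
      simp [h] at this
    linarith
  obtain ⟨m, hm⟩ : ∃ m, S.card = m + 1 := ⟨S.card - 1, by have := hSne.card_pos; omega⟩
  let θ : Fin (m + 1) ↪o Fin (n + 1) := S.orderEmbOfFin hm
  have hθ : ∀ j, 0 < t (θ j) := fun j =>
    (Finset.mem_filter.1 (Finset.orderEmbOfFin_mem S hm j)).2
  have hr : ∀ i, 0 < t i → ∃ j, θ j = i := fun i hi => by
    have : i ∈ Set.range (S.orderEmbOfFin hm) := by
      rw [Finset.range_orderEmbOfFin]
      exact Finset.mem_coe.2 (Finset.mem_filter.2 ⟨Finset.mem_univ _, hi⟩)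
    exact this
  have hsum : ∀ f : Fin (n + 1) → ℝ, (∀ i, ¬ 0 < t i → f i = 0) →
      ∑ j, f (θ j) = ∑ i, f i := by
    intro f hf
    rw [← Finset.sum_image (s := Finset.univ) (g := θ) (f := f)
      fun a _ b _ h => θ.injective h]
    refine Finset.sum_subset (Finset.subset_univ _) fun i _ hi => hf i fun hpos => hi ?_
    obtain ⟨j, rfl⟩ := hr i hpos
    exact Finset.mem_image_of_mem _ (Finset.mem_univ _)
  have ht0 : ∀ i, ¬ 0 < t i → t i = 0 := fun i hi => le_antisymm (not_lt.1 hi) (t.2.1 i)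
  let s : Simp m := ⟨fun j => t (θ j), fun j => t.2.1 _, by
    rw [hsum (fun i => t i) ht0]; exact stdSimplex.sum_eq_one t⟩
  have hmap : stdSimplex.map θ s = t := by
    ext i
    have h1 := Simp.sum_map θ s fun k => if k = i then 1 else 0
    simp only [ite_mul, one_mul, zero_mul, Finset.sum_ite_eq', Finset.mem_univ, if_true] at h1
    rw [h1]
    have h2 := hsum (fun k => if k = i then t k else 0) fun k hk => by simp [ht0 k hk]
    refine Eq.trans h2 ?_
    simp
  refine ⟨m, nilMap θ.toOrderHom x, s, ?_, hθ, ?_, ?_⟩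
  · have := S.card_le_univ
    simp only [Fintype.card_fin] at this
    omega
  · rw [mk_glue]
    exact congrArg (mk x) hmap.symm
  · rw [← hm, ← Set.ncard_coe_finset S]
    congr 1
    ext i
    simp [hS]

/-- A property of coordinates that is compatible with the identifications. -/
def IsInvariant (P : ∀ n : ℕ, nilTuples q G n → Simp n → Prop) : Prop :=
  ∀ (m n : ℕ) (θ : Fin (m + 1) →o Fin (n + 1)) (x : nilTuples q G n) (t : Simp m),
    P m (nilMap θ x) t ↔ P n x (stdSimplex.map θ t)

/-- The subset of `B(q, G)` defined by an invariant property of coordinates. -/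
def ofInvariant (P : ∀ n : ℕ, nilTuples q G n → Simp n → Prop) (hP : IsInvariant P) :
    Set (NilClassifying q G) :=
  Quot.lift (fun p => P p.1 p.2.1 p.2.2) (by
    rintro _ _ ⟨θ, x, t⟩
    exact propext (hP _ _ θ x t))

/-- The part of the mass of `t` that lies at the vertices in `gV`. -/
noncomputable def mass {n : ℕ} (x : nilTuples q G n) (t : Simp n) (g : G) (V : Set G) : ℝ :=
  ∑ i, V.indicator 1 (g⁻¹ * vert x i) * t i

/-- The structure maps renormalize the first vertex to 1, which translates all vertices on the left.
Conditions on mass therefore descend to the realization once they are quantified over g. -/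
theorem mass_nilMap {m n : ℕ} (θ : Fin (m + 1) →o Fin (n + 1)) (x : nilTuples q G n) (t : Simp m)
    (g : G) (V : Set G) :
    mass (nilMap θ x) t g V = mass x (stdSimplex.map θ t) (vert x (θ 0) * g) V := by
  have := Simp.sum_map θ t fun k => V.indicator 1 ((vert x (θ 0) * g)⁻¹ * vert x k)
  rw [mass, mass, this]
  simp [vert_nilMap, mul_assoc]

theorem mass_mix {n : ℕ} (x : nilTuples q G n) (s : I) (t t' : Simp n) (g : G) (V : Set G) :
    mass x (Simp.mix s t t') g V = (1 - (s : ℝ)) * mass x t g V + s * mass x t' g V := by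
  simp only [mass, Simp.mix_apply, Finset.mul_sum, ← Finset.sum_add_distrib]
  exact Finset.sum_congr rfl fun i _ => by ring

theorem mass_mono {n : ℕ} (x : nilTuples q G n) (t : Simp n) (g : G) {V W : Set G}
    (h : ∀ i, g⁻¹ * vert x i ∈ V → g⁻¹ * vert x i ∈ W) : mass x t g V ≤ mass x t g W := by
  classical
  refine Finset.sum_le_sum fun i _ => mul_le_mul_of_nonneg_right ?_ (t.2.1 i)
  by_cases hi : g⁻¹ * vert x i ∈ V
  · rw [indicator_of_mem hi, indicator_of_mem (h i hi)]
  · rw [indicator_of_notMem hi]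
    exact indicator_one_nonneg _ _

theorem mass_eq_one {n : ℕ} (x : nilTuples q G n) (t : Simp n) (g : G) (V : Set G)
    (h : ∀ i, 0 < t i → g⁻¹ * vert x i ∈ V) : mass x t g V = 1 := by
  rw [← stdSimplex.sum_eq_one t]
  refine Finset.sum_congr rfl fun i _ => ?_
  rcases (show 0 ≤ t i from t.2.1 i).eq_or_lt with hi | hi
  · rw [← hi, mul_zero]
  · rw [indicator_of_mem (h i hi), Pi.one_apply, one_mul]

theorem mass_vertex {n : ℕ} (x : nilTuples q G n) (i : Fin (n + 1)) (g : G) (V : Set G)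
    (h : g⁻¹ * vert x i ∈ V) : mass x (stdSimplex.vertex i) g V = 1 := by
  refine mass_eq_one x _ g V fun j hj => ?_
  obtain rfl : j = i := by
    by_contra hne
    rw [stdSimplex.vertex_coe, Pi.single_eq_of_ne hne] at hj
    exact lt_irrefl _ hj
  exact h

theorem exists_of_mass_pos {n : ℕ} {x : nilTuples q G n} {t : Simp n} {g : G} {V : Set G}
    (h : 0 < mass x t g V) : ∃ i, 0 < t i ∧ g⁻¹ * vert x i ∈ V := by
  by_contra hn
  push Not at hn
  refine h.ne' (Finset.sum_eq_zero fun i _ => ?_)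
  rcases (show 0 ≤ t i from t.2.1 i).eq_or_lt with hi | hi
  · rw [← hi, mul_zero]
  · rw [indicator_of_notMem (hn i hi), zero_mul]

/-- Two sets each carrying more than half of the mass meet. -/
theorem exists_of_mass_gt_half {n : ℕ} {x : nilTuples q G n} {t : Simp n} {g h : G} {V W : Set G}
    (hg : 1 / 2 < mass x t g V) (hh : 1 / 2 < mass x t h W) :
    ∃ i, 0 < t i ∧ g⁻¹ * vert x i ∈ V ∧ h⁻¹ * vert x i ∈ W := by
  by_contra hn
  push Not at hn
  have : mass x t g V + mass x t h W ≤ 1 := by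
    rw [← stdSimplex.sum_eq_one t, mass, mass, ← Finset.sum_add_distrib]
    refine Finset.sum_le_sum fun i _ => ?_
    rcases (show 0 ≤ t i from t.2.1 i).eq_or_lt with hi | hi
    · rw [← hi]; simp
    · by_cases h1 : g⁻¹ * vert x i ∈ V
      · rw [indicator_of_notMem (hn i hi h1), zero_mul, add_zero]
        exact mul_le_of_le_one_left (t.2.1 i) (indicator_one_le _ _)
      · rw [indicator_of_notMem h1, zero_mul, zero_add]
        exact mul_le_of_le_one_left (t.2.1 i) (indicator_one_le _ _)
  linarith

theorem isInvariant_conc (φ ψ : Reparam) (V W : Set G) (c : ℝ) :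
    IsInvariant fun n (x : nilTuples q G n) t =>
      ∃ g, c < mass x (φ.warp t) g V ∧ c < mass x (ψ.warp t) g W := by
  intro m n θ x t
  simp only [mass_nilMap, Reparam.map_warp]
  constructor
  · rintro ⟨g, hg⟩
    exact ⟨_, hg⟩
  · rintro ⟨g, hg⟩
    exact ⟨(vert x (θ 0))⁻¹ * g, by rwa [mul_inv_cancel_left]⟩

/-- The points for which the mass seen through `φ` is concentrated in `gV` and that seen through
`ψ` is concentrated in `gW`, for some `g`. -/
def conc (q : ℕ) {G : Type*} [Group G] (φ ψ : Reparam) (V W : Set G) (c : ℝ) :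
    Set (NilClassifying q G) :=
  ofInvariant _ (isInvariant_conc φ ψ V W c)

theorem mk_mem_conc {φ ψ : Reparam} {V W : Set G} {c : ℝ} {n : ℕ} {x : nilTuples q G n}
    {t : Simp n} : mk x t ∈ conc q φ ψ V W c ↔
      ∃ g, c < mass x (φ.warp t) g V ∧ c < mass x (ψ.warp t) g W := Iff.rfl

theorem isInvariant_labelsIn (C : Set G) :
    IsInvariant fun n (x : nilTuples q G n) t =>
      ∀ i j, i ≤ j → 0 < t i → 0 < t j → (vert x i)⁻¹ * vert x j ∈ C := by
  intro m n θ x t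
  simp only [Simp.map_pos_iff]
  constructor
  · rintro h i j hij ⟨k, rfl, hk⟩ ⟨l, rfl, hl⟩
    have key : ∀ a b, a ≤ b → 0 < t a → 0 < t b → (vert x (θ a))⁻¹ * vert x (θ b) ∈ C := by
      intro a b hab ha hb
      have := h a b hab ha hb
      simpa [vert_nilMap] using this
    rcases le_total k l with hkl | hkl
    · exact key k l hkl hk hl
    -- The order of k and l is reversed only when both have the same image; the label is then 1,
    -- which already lies in C as the label from k to itself.
    · have he : θ k = θ l := le_antisymm hij (θ.monotone hkl)
      have := key k k le_rfl hk hk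
      rwa [← he]
  · intro h i j hij hi hj
    have := h (θ i) (θ j) (θ.monotone hij) ⟨i, rfl, hi⟩ ⟨j, rfl, hj⟩
    simpa [vert_nilMap] using this

/-- The points all of whose edges are labelled by elements of `C`. -/
def labelsIn (q : ℕ) {G : Type*} [Group G] (C : Set G) : Set (NilClassifying q G) :=
  ofInvariant _ (isInvariant_labelsIn C)

theorem mk_mem_labelsIn {C : Set G} {n : ℕ} {x : nilTuples q G n} {t : Simp n} :
    mk x t ∈ labelsIn q C ↔
      ∀ i j, i ≤ j → 0 < t i → 0 < t j → (vert x i)⁻¹ * vert x j ∈ C := Iff.rfl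

theorem mk_oneTuple {n : ℕ} (t : Simp n) : mk (oneTuple q G n) t = pt q G := by
  let ζ : Fin (n + 1) →o Fin (0 + 1) := ⟨fun _ => 0, fun _ _ _ => le_rfl⟩
  have : oneTuple q G n = nilMap ζ (oneTuple q G 0) :=
    Subtype.ext (funext fun j => by
      change 1 = (Fin.partialProd _ (0 : Fin 1))⁻¹ * Fin.partialProd _ (0 : Fin 1)
      simp)
  rw [this, mk_glue, pt]
  congr 1
  exact Subsingleton.elim _ _

/-- The set of points all of whose labels are 1 is well defined on the quotient, and a
representative with positive coordinates and only trivial labels is the tuple of ones, which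
collapses to the vertex. -/
theorem eq_pt_iff {n : ℕ} {x : nilTuples q G n} {t : Simp n} :
    mk x t = pt q G ↔ ∀ i j, 0 < t i → 0 < t j → vert x i = vert x j := by
  have h1 : mk x t ∈ labelsIn q {1} ↔ ∀ i j, 0 < t i → 0 < t j → vert x i = vert x j := by
    rw [mk_mem_labelsIn]
    constructor
    · intro h i j hi hj
      rcases le_total i j with hij | hij
      · exact inv_mul_eq_one.1 (h i j hij hi hj)
      · exact (inv_mul_eq_one.1 (h j i hij hj hi)).symm
    · intro h i j _ hi hj
      exact inv_mul_eq_one.2 (h i j hi hj)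
  rw [← h1]
  constructor
  · intro h
    rw [h]
    refine mk_mem_labelsIn.2 fun i j _ _ _ => ?_
    rw [Subsingleton.elim (α := Fin 1) i j, inv_mul_cancel]
    rfl
  · intro h
    obtain ⟨m, y, s, -, hs, he, -⟩ := exists_pos_rep x t
    rw [he] at h ⊢
    have hy : y = oneTuple q G m := Subtype.ext (funext fun j => by
      rw [← vert_succ]
      exact mk_mem_labelsIn.1 h _ _ (Fin.castSucc_le_succ j) (hs _) (hs _))
    rw [hy, mk_oneTuple]

theorem mk_vertex {n : ℕ} (x : nilTuples q G n) (i : Fin (n + 1)) :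
    mk x (stdSimplex.vertex i) = pt q G := by
  have h : ∀ j, 0 < (stdSimplex.vertex i : Simp n) j → j = i := fun j hj => by
    by_contra hne
    rw [stdSimplex.vertex_coe, Pi.single_eq_of_ne hne] at hj
    exact lt_irrefl _ hj
  exact eq_pt_iff.2 fun j k hj hk => by rw [h j hj, h k hk]

theorem pt_mem_labelsIn {C : Set G} (hC : 1 ∈ C) : pt q G ∈ labelsIn q C := by
  refine mk_mem_labelsIn.2 fun i j _ _ _ => ?_
  rw [Subsingleton.elim (α := Fin 1) i j, inv_mul_cancel]
  exact hC

theorem fil_mono {m n : ℕ} (h : m ≤ n) : fil q G m ⊆ fil q G n := by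
  rintro _ ⟨x, t, rfl⟩
  let ζ : Fin (n + 1) →o Fin (m + 1) :=
    ⟨fun i => ⟨min i m, by omega⟩, fun i j hij => Fin.mk_le_mk.2 (by
      have : (i : ℕ) ≤ j := hij
      omega)⟩
  let δ : Fin (m + 1) → Fin (n + 1) := Fin.castLE (by omega)
  have hζ : ζ ∘ δ = id := funext fun i => Fin.ext (by
    change min (i : ℕ) m = i
    omega)
  refine ⟨nilMap ζ x, stdSimplex.map δ t, ?_⟩
  rw [mk_glue]
  congr 1
  rw [stdSimplex.map_comp_apply]
  exact (congrArg (fun f => stdSimplex.map f t) hζ).symm ▸ (stdSimplex.map_id_apply t).symm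

theorem pt_mem_fil (n : ℕ) : pt q G ∈ fil q G n := fil_mono (Nat.zero_le n) (mk_mem_fil _ _)

theorem eq_pt_of_mem_fil_zero {z : NilClassifying q G} (h : z ∈ fil q G 0) : z = pt q G := by
  obtain ⟨x, t, rfl⟩ := h
  exact eq_pt_iff.2 fun i j _ _ => by rw [Subsingleton.elim (α := Fin 1) i j]

theorem mem_fil_iff {n : ℕ} {z : NilClassifying q G} :
    z ∈ fil q G n ↔ ∃ (m : ℕ) (x : nilTuples q G m) (t : Simp m),
      m ≤ n ∧ (∀ i, 0 < t i) ∧ z = mk x t := by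
  constructor
  · rintro ⟨x, t, rfl⟩
    obtain ⟨m, y, s, hm, hs, he, -⟩ := exists_pos_rep x t
    exact ⟨m, y, s, hm, hs, he⟩
  · rintro ⟨m, x, t, hm, -, rfl⟩
    exact fil_mono hm (mk_mem_fil _ _)

theorem mk_mem_fil_of_eq_zero {n : ℕ} (x : nilTuples q G (n + 1)) (t : Simp (n + 1))
    (i : Fin (n + 2)) (h : t i = 0) : mk x t ∈ fil q G n := by
  obtain ⟨m, y, s, hm, -, he, hc⟩ := exists_pos_rep x t
  rw [he]
  refine fil_mono ?_ (mk_mem_fil _ _)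
  have hlt : {i | 0 < t i}.ncard < (Set.univ : Set (Fin (n + 2))).ncard :=
    Set.ncard_lt_ncard ((Set.ssubset_univ_iff).2 fun hu => by
      have : i ∈ {i | 0 < t i} := hu ▸ Set.mem_univ i
      rw [Set.mem_ofPred_eq, h] at this
      exact lt_irrefl _ this)
  rw [Set.ncard_univ, Nat.card_fin] at hlt
  omega

/-- The action of a reparametrization of `[0, 1]` on `B(q, G)`. -/
def act (φ : Reparam) : NilClassifying q G → NilClassifying q G :=
  Quot.lift (fun p => mk p.2.1 (φ.warp p.2.2)) (by
    rintro _ _ ⟨θ, x, t⟩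
    change mk (nilMap θ x) (φ.warp t) = mk x (φ.warp (stdSimplex.map θ t))
    rw [mk_glue, φ.map_warp])

theorem act_mk (φ : Reparam) {n : ℕ} (x : nilTuples q G n) (t : Simp n) :
    act φ (mk x t) = mk x (φ.warp t) := rfl

/-- The path in `B(q, G)` from a point to its image under a reparametrization. -/
def track (φ : Reparam) (s : I) : NilClassifying q G → NilClassifying q G :=
  Quot.lift (fun p => mk p.2.1 (Simp.mix s p.2.2 (φ.warp p.2.2))) (by
    rintro _ _ ⟨θ, x, t⟩
    change mk (nilMap θ x) (Simp.mix s t (φ.warp t))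
      = mk x (Simp.mix s (stdSimplex.map θ t) (φ.warp (stdSimplex.map θ t)))
    rw [mk_glue, Simp.map_mix, φ.map_warp])

theorem track_mk (φ : Reparam) (s : I) {n : ℕ} (x : nilTuples q G n) (t : Simp n) :
    track φ s (mk x t) = mk x (Simp.mix s t (φ.warp t)) := rfl

theorem track_zero (φ : Reparam) (z : NilClassifying q G) : track φ 0 z = z := by
  obtain ⟨n, x, t, rfl⟩ := exists_mk z
  rw [track_mk, Simp.mix_zero]

theorem track_one (φ : Reparam) (z : NilClassifying q G) : track φ 1 z = act φ z := by
  obtain ⟨n, x, t, rfl⟩ := exists_mk z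
  rw [track_mk, Simp.mix_one, act_mk]

end Algebra

section Topology

variable {q : ℕ} {G : Type*} [Group G] [TopologicalSpace G]

theorem continuous_mk (q : ℕ) (G : Type*) [Group G] [TopologicalSpace G] (n : ℕ) :
    Continuous fun p : nilTuples q G n × Simp n => mk p.1 p.2 :=
  continuous_quot_mk.comp 
    (show Continuous (Sigma.mk n : _ → Σ n : ℕ, nilTuples q G n × Simp n) from continuous_sigmaMk)

theorem isOpen_iff {S : Set (NilClassifying q G)} :
    IsOpen S ↔ ∀ n, IsOpen {p : nilTuples q G n × Simp n | mk p.1 p.2 ∈ S} := by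
  have h : IsOpen S ↔ IsOpen (Quot.mk (NilGlue q G) ⁻¹' S) :=
    (isQuotientMap_quot_mk.isOpen_preimage (s := S)).symm
  rw [h, isOpen_sigma_iff]
  rfl

theorem isClosed_iff {S : Set (NilClassifying q G)} :
    IsClosed S ↔ ∀ n, IsClosed {p : nilTuples q G n × Simp n | mk p.1 p.2 ∈ S} := by
  rw [← isOpen_compl_iff, isOpen_iff]
  exact forall_congr' fun n => isOpen_compl_iff

theorem continuous_of_mk {Y : Type*} [TopologicalSpace Y] {f : NilClassifying q G → Y}
    (h : ∀ n, Continuous fun p : nilTuples q G n × Simp n => f (mk p.1 p.2)) : Continuous f :=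
  isQuotientMap_quot_mk.continuous_iff.2 (continuous_sigma h)

/-- A product of a quotient map with a space need not be a quotient map, so continuity is checked
for the curried map into C(I, B(q, G)), on charts, and uncurried using that I is locally compact. -/
theorem continuous_track (φ : Reparam) :
    Continuous fun p : NilClassifying q G × I => track φ p.2 p.1 := by
  let F : NilClassifying q G → C(I, NilClassifying q G) := fun z =>
    ⟨fun s => track φ s z, by
      obtain ⟨n, x, t, rfl⟩ := exists_mk z
      simp only [track_mk]
      exact (continuous_mk q G n).comp ((continuous_const (y := x)).prodMk
        (Simp.continuous_mix.comp (continuous_id.prodMk (continuous_const (y := (t, φ.warp t))))))⟩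
  have hF : Continuous F := by
    refine continuous_of_mk fun n => ?_
    let H : C((nilTuples q G n × Simp n) × I, NilClassifying q G) :=
      ⟨fun p => mk p.1.1 (Simp.mix p.2 p.1.2 (φ.warp p.1.2)),
        (continuous_mk q G n).comp ((continuous_fst.comp continuous_fst).prodMk
          (Simp.continuous_mix.comp (continuous_snd.prodMk
            ((continuous_snd.comp continuous_fst).prodMk
              ((φ.continuous_warp n).comp (continuous_snd.comp continuous_fst))))))⟩
    exact H.curry.continuous
  exact ContinuousMap.continuous_uncurry_of_continuous ⟨F, hF⟩

theorem continuous_act (φ : Reparam) : Continuous (act φ : NilClassifying q G → _) := by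
  have h : (act φ : NilClassifying q G → _) = fun z => track φ 1 z :=
    funext fun z => (track_one φ z).symm
  rw [h]
  exact (continuous_track φ).comp (continuous_id.prodMk continuous_const)

variable [IsTopologicalGroup G]

theorem continuous_vert {n : ℕ} (i : Fin (n + 1)) :
    Continuous fun x : nilTuples q G n => vert x i := by
  induction i using Fin.induction with
  | zero => simpa using continuous_const
  | succ i ih =>
    simp only [vert, Fin.partialProd_succ]
    exact ih.mul ((continuous_apply i).comp continuous_subtype_val)

/-- The indicator of an open set is lower semicontinuous, and it is multiplied by a continuous
nonnegative coordinate. -/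
theorem isOpen_mass_gt {n : ℕ} {V : Set G} (hV : IsOpen V) (g : G) (c : ℝ) (φ : Reparam) :
    IsOpen {p : nilTuples q G n × Simp n | c < mass p.1 (φ.warp p.2) g V} := by
  have hl : LowerSemicontinuous fun p : nilTuples q G n × Simp n =>
      mass p.1 (φ.warp p.2) g V := by
    refine lowerSemicontinuous_sum fun i _ => ?_
    have ho : IsOpen {p : nilTuples q G n × Simp n | g⁻¹ * vert p.1 i ∈ V} :=
      hV.preimage (continuous_const.mul ((continuous_vert i).comp continuous_fst))
    have hc : Continuous fun p : nilTuples q G n × Simp n => φ.warp p.2 i :=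
      (Simp.continuous_coord i).comp ((φ.continuous_warp n).comp continuous_snd)
    intro p y hy
    simp only [gt_iff_lt] at hy ⊢
    by_cases hp : g⁻¹ * vert p.1 i ∈ V
    · rw [indicator_of_mem hp, Pi.one_apply, one_mul] at hy
      filter_upwards [ho.mem_nhds hp, hc.continuousAt.eventually (lt_mem_nhds hy)] with r hr hr'
      rwa [indicator_of_mem hr, Pi.one_apply, one_mul]
    · rw [indicator_of_notMem hp, zero_mul] at hy
      exact Filter.Eventually.of_forall fun r => hy.trans_le
        (mul_nonneg (indicator_one_nonneg _ _) ((φ.warp r.2).2.1 i))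
  exact hl.isOpen_preimage c

theorem isOpen_conc {V W : Set G} (hV : IsOpen V) (hW : IsOpen W) (φ ψ : Reparam) (c : ℝ) :
    IsOpen (conc q φ ψ V W c) := by
  refine isOpen_iff.2 fun n => ?_
  simp only [mk_mem_conc, ofPred_exists, ofPred_and]
  exact isOpen_iUnion fun g => (isOpen_mass_gt hV g c φ).inter (isOpen_mass_gt hW g c ψ)

theorem isClosed_labelsIn {C : Set G} (hC : IsClosed C) : IsClosed (labelsIn q C) := by
  refine isClosed_iff.2 fun n => ?_
  simp only [mk_mem_labelsIn, ofPred_forall]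
  refine isClosed_iInter fun i => isClosed_iInter fun j => isClosed_iInter fun _ => ?_
  have hpos : ∀ k, IsOpen {p : nilTuples q G n × Simp n | 0 < p.2 k} := fun k =>
    isOpen_lt continuous_const ((Simp.continuous_coord k).comp continuous_snd)
  have hc : IsClosed {p : nilTuples q G n × Simp n | (vert p.1 i)⁻¹ * vert p.1 j ∈ C} :=
    hC.preimage ((((continuous_vert i).comp continuous_fst).inv).mul
      ((continuous_vert j).comp continuous_fst))
  have := ((hpos i).isClosed_compl.union ((hpos j).isClosed_compl.union hc))
  convert this using 1
  ext p
  simp only [mem_ofPred_eq, mem_union, mem_compl_iff]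
  tauto

theorem isClosed_singleton_pt [T1Space G] : IsClosed {pt q G} := by
  have : {pt q G} = labelsIn q ({1} : Set G) := by
    ext z
    obtain ⟨n, x, t, rfl⟩ := exists_mk z
    rw [mem_singleton_iff, eq_pt_iff, mk_mem_labelsIn]
    constructor
    · intro h i j _ hi hj
      exact inv_mul_eq_one.2 (h i j hi hj)
    · intro h i j hi hj
      rcases le_total i j with hij | hij
      · exact inv_mul_eq_one.1 (h i j hij hi hj)
      · exact (inv_mul_eq_one.1 (h j i hij hj hi)).symm
  rw [this]
  exact isClosed_labelsIn isClosed_singleton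

end Topology

end NilClassifying

/-! ### Windows and compactness -/

namespace NilClassifying

section Windows

variable {q : ℕ} {G : Type*} [Group G]

/-- A window that contains no subdivision point in its interior sees a single vertex. -/
theorem exists_cum_mem_of_act_ne_pt {n : ℕ} (x : nilTuples q G n) (t : Simp n) {c d : ℝ}
    {h0 : 0 ≤ c} {h : c < d} {h1 : d ≤ 1}
    (hne : act (Reparam.window c d h0 h h1) (mk x t) ≠ pt q G) :
    ∃ k : Fin n, c < t.cum (k + 1) ∧ t.cum (k + 1) < d := by
  classical
  by_contra hn
  push Not at hn
  refine hne ?_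
  have hex : ∃ k, c < t.cum k := ⟨n + 1, by rw [t.cum_of_le le_rfl]; linarith⟩
  obtain ⟨k, hk⟩ : ∃ k, Nat.find hex = k + 1 := by
    refine ⟨Nat.find hex - 1, ?_⟩
    have : Nat.find hex ≠ 0 := fun h => by
      have := Nat.find_spec hex
      rw [h, t.cum_zero] at this
      linarith
    omega
  have hk1 : c < t.cum (k + 1) := hk ▸ Nat.find_spec hex
  have hk2 : t.cum k ≤ c := not_lt.1 (Nat.find_min hex (by omega))
  have hkn : k < n + 1 := by
    by_contra hkn
    rw [t.cum_of_le (by omega)] at hk2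
    linarith
  have hd : d ≤ t.cum (k + 1) := by
    by_cases hkn' : k < n
    · exact hn ⟨k, hkn'⟩ hk1
    · rw [t.cum_of_le (by omega)]; exact h1
  rw [act_mk, Reparam.warp_window_eq_vertex (i := ⟨k, hkn⟩) hk2 hd, mk_vertex]

/-- The window is the middle third of the i-th interval, so it sees vertex i only. Away from the
base vertex some j in the support has a vertex different from the i-th one. If j < i, the part of
[0, 1] to the left of the window sees two different vertices, which is an open condition; it forces
the 0-th interval of nearby points to end before the window, so the window kills the 0-th coordinate
and the filtration degree drops. The case j > i is symmetric and kills the last coordinate. -/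
theorem exists_window_aux [TopologicalSpace G] [IsTopologicalGroup G] [T1Space G] {n : ℕ}
    (x : nilTuples q G n) (t : Simp n) (i : Fin (n + 1)) (hi : 0 < t i) :
    ∃ φ : Reparam, φ.warp t = stdSimplex.vertex i ∧ (mk x t ≠ pt q G →
      ∃ U : Set (NilClassifying q G), IsOpen U ∧ mk x t ∈ U ∧
        ∀ (m : ℕ), ∀ z ∈ U, z ∈ fil q G (m + 1) → act φ z ∈ fil q G m) := by
  have hs := t.cum_succ i
  have hi0 : 0 ≤ t.cum i := by rw [← t.cum_zero]; exact t.cum_mono (Nat.zero_le _)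
  have hi1 : t.cum (i + 1) ≤ 1 := by
    rw [← t.cum_of_le le_rfl]; exact t.cum_mono (by omega)
  -- Thirds leave room on both sides, so that [0, c] and [d, 1] are also nondegenerate windows, each
  -- seeing part of the i-th interval.
  obtain ⟨c, hc⟩ : ∃ c, c = t.cum i + t i / 3 := ⟨_, rfl⟩
  obtain ⟨d, hd⟩ : ∃ d, d = t.cum i + 2 * t i / 3 := ⟨_, rfl⟩
  have h0 : 0 < c := by linarith
  have hcd : c < d := by linarith
  have h1 : d < 1 := by linarith
  refine ⟨Reparam.window c d h0.le hcd h1.le,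
    Reparam.warp_window_eq_vertex (by linarith) (by linarith), fun hne => ?_⟩
  obtain ⟨j, hj, hij⟩ : ∃ j, 0 < t j ∧ vert x j ≠ vert x i := by
    by_contra hn
    push Not at hn
    exact hne (eq_pt_iff.2 fun a b ha hb => (hn a ha).trans (hn b hb).symm)
  have hopen : ∀ φ : Reparam, IsOpen {z : NilClassifying q G | act φ z ≠ pt q G} := fun φ =>
    (isClosed_singleton_pt.isOpen_compl).preimage (continuous_act φ)
  have hsj := t.cum_succ j
  rcases lt_trichotomy (j : ℕ) (i : ℕ) with hlt | heq | hgt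
  · refine ⟨_, hopen (Reparam.window 0 c le_rfl h0 (by linarith)), ?_, ?_⟩
    · intro hpt
      rw [act_mk, eq_pt_iff] at hpt
      refine hij (hpt j i ?_ ?_)
      · have h2 : t.cum (j + 1) ≤ t.cum i := t.cum_mono (by omega)
        have h3 : 0 ≤ t.cum j := by rw [← t.cum_zero]; exact t.cum_mono (Nat.zero_le _)
        rw [Reparam.warp_apply, Reparam.window_of_mem (by linarith) (by linarith),
          Reparam.window_of_mem (by linarith) (by linarith), ← sub_div]
        exact div_pos (by linarith) (by linarith)
      · rw [Reparam.warp_apply, Reparam.window_of_ge (by linarith),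
          Reparam.window_of_mem (by linarith) (by linarith), sub_pos, div_lt_one (by linarith)]
        linarith
    · rintro m _ hz ⟨y, s, rfl⟩
      refine mk_mem_fil_of_eq_zero y _ 0 ?_
      have hs0 : s.cum ((0 : Fin (m + 2)) + 1 : ℕ) < c := by
        by_contra hge
        refine hz ?_
        rw [act_mk, Reparam.warp_window_eq_vertex (i := 0) ?_ (not_lt.1 hge), mk_vertex]
        exact (s.cum_zero).le
      rw [Reparam.warp_apply, Reparam.window_of_le hs0.le, Reparam.window_of_le, sub_zero]
      exact (s.cum_mono (Nat.le_succ _)).trans hs0.le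
  · exact absurd (congrArg (vert x) (Fin.ext heq)) hij
  · refine ⟨_, hopen (Reparam.window d 1 (by linarith) h1 le_rfl), ?_, ?_⟩
    · intro hpt
      rw [act_mk, eq_pt_iff] at hpt
      refine hij (hpt j i ?_ ?_)
      · have h2 : t.cum (i + 1) ≤ t.cum j := t.cum_mono (by omega)
        have h3 : t.cum (j + 1) ≤ 1 := by
          rw [← t.cum_of_le le_rfl]; exact t.cum_mono (by omega)
        rw [Reparam.warp_apply, Reparam.window_of_mem (by linarith) (by linarith),
          Reparam.window_of_mem (by linarith) (by linarith), ← sub_div]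
        exact div_pos (by linarith) (by linarith)
      · rw [Reparam.warp_apply, Reparam.window_of_mem (by linarith) (by linarith),
          Reparam.window_of_le (by linarith), sub_zero]
        exact div_pos (by linarith) (by linarith)
    · rintro m _ hz ⟨y, s, rfl⟩
      refine mk_mem_fil_of_eq_zero y _ (Fin.last _) ?_
      have hs0 : d < s.cum (Fin.last (m + 1) : ℕ) := by
        by_contra hge
        refine hz ?_
        rw [act_mk, Reparam.warp_window_eq_vertex (i := Fin.last _) (not_lt.1 hge) ?_, mk_vertex]
        exact (s.cum_of_le (by simp)).ge
      rw [Reparam.warp_apply, Reparam.window_of_ge hs0.le, Reparam.window_of_ge, sub_self]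
      exact hs0.le.trans (s.cum_mono (Nat.le_succ _))

theorem mk_mem_fil_of_entry_eq_one {n : ℕ} (x : nilTuples q G (n + 1)) (t : Simp (n + 1))
    (j : Fin (n + 1)) (h : x.1 j = 1) : mk x t ∈ fil q G n := by
  let ζ : Fin (n + 2) →o Fin (n + 1) := ⟨j.predAbove, Fin.predAbove_right_monotone j⟩
  let δ : Fin (n + 1) →o Fin (n + 2) := ⟨j.succ.succAbove, (Fin.strictMono_succAbove _).monotone⟩
  have hv : vert x j.castSucc = vert x j.succ := by
    rw [← inv_mul_eq_one, vert_succ, h]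
  have hζδ : ∀ i, vert x (δ (ζ i)) = vert x i := by
    intro i
    by_cases hi : i = j.succ
    · subst hi
      rw [← hv]
      congr 1
      change j.succ.succAbove (j.predAbove j.succ) = _
      simp
    · congr 1
      change j.succ.succAbove (j.predAbove i) = i
      exact Fin.succ_succAbove_predAbove hi
  have hx : x = nilMap ζ (nilMap δ x) := by
    refine Subtype.ext (funext fun k => ?_)
    have hvk : ∀ i, vert (nilMap ζ (nilMap δ x)) i = vert x i := fun i => by
      rw [vert_nilMap, vert_nilMap, vert_nilMap, hζδ, hζδ, vert_zero]
      group
    rw [← vert_succ, ← vert_succ, hvk, hvk]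
  rw [hx, mk_glue]
  exact mk_mem_fil _ _

theorem mem_conc_id {V : Set G} {c : ℝ} {φ : Reparam} {n : ℕ} {x : nilTuples q G n} {t : Simp n} :
    mk x t ∈ conc q φ φ V V c ↔ ∃ g, c < mass x (φ.warp t) g V := by
  rw [mk_mem_conc]
  simp

/-- The trivial reparametrization. -/
def _root_.Reparam.id : Reparam := ⟨fun u => u, monotone_id, continuous_id, rfl, rfl⟩

@[simp] theorem _root_.Reparam.id_warp {n : ℕ} (t : Simp n) : Reparam.id.warp t = t := by
  ext i
  rw [Reparam.warp_apply]
  change t.cum (i + 1) - t.cum i = t i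
  rw [t.cum_succ]
  ring

theorem pt_mem_conc {φ ψ : Reparam} {V W : Set G} (hV : 1 ∈ V) (hW : 1 ∈ W) {c : ℝ} (hc : c < 1) :
    pt q G ∈ conc q φ ψ V W c := by
  refine mk_mem_conc.2 ⟨1, ?_, ?_⟩ <;> rw [mass_eq_one]
  · exact hc
  · intro i _
    obtain rfl : i = 0 := Subsingleton.elim (α := Fin 1) i 0
    simpa
  · exact hc
  · intro i _
    obtain rfl : i = 0 := Subsingleton.elim (α := Fin 1) i 0
    simpa

end Windows

section Compactness

variable {q : ℕ} {G : Type*} [Group G] [TopologicalSpace G] [IsTopologicalGroup G]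

/-- Take V so small that quotients of its elements avoid all nontrivial labels of z, and let ε be
the smallest coordinate. If more than 1 - ε of the mass lay in a translate of V, no vertex could be
missing from it, so all labels would be trivial. -/
theorem exists_isOpen_pt_notMem [T1Space G] {z : NilClassifying q G} (hz : z ≠ pt q G) :
    ∃ U, IsOpen U ∧ pt q G ∈ U ∧ z ∉ U := by
  obtain ⟨n, x₀, t₀, rfl⟩ := exists_mk z
  obtain ⟨m, x, t, -, ht, he, -⟩ := exists_pos_rep x₀ t₀
  rw [he] at hz ⊢
  obtain ⟨V, hVo, hV1, hV⟩ : ∃ V : Set G, IsOpen V ∧ 1 ∈ V ∧ ∀ i j, vert x i ≠ vert x j →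
      ∀ a ∈ V, ∀ b ∈ V, a⁻¹ * b ≠ (vert x i)⁻¹ * vert x j := by
    have hW : (⋂ i, ⋂ j, {g : G | vert x i ≠ vert x j → g ≠ (vert x i)⁻¹ * vert x j}) ∈
        𝓝 (1 : G) := by
      refine Filter.iInter_mem.2 fun i => Filter.iInter_mem.2 fun j => ?_
      by_cases hij : vert x i = vert x j
      · simp [hij]
      · refine Filter.mem_of_superset (isOpen_ne.mem_nhds
          (fun h : (1 : G) = (vert x i)⁻¹ * vert x j => hij (inv_mul_eq_one.1 h.symm))) ?_
        exact fun g hg _ => hg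
    have hcont : ContinuousAt (fun p : G × G => p.1⁻¹ * p.2) (1, 1) := by fun_prop
    have := hcont.preimage_mem_nhds (by rw [inv_one, one_mul]; exact hW)
    rw [nhds_prod_eq, Filter.mem_prod_iff] at this
    obtain ⟨A, hA, B, hB, hAB⟩ := this
    refine ⟨interior (A ∩ B), isOpen_interior,
      mem_interior_iff_mem_nhds.2 (Filter.inter_mem hA hB), fun i j hij a ha b hb => ?_⟩
    have := hAB (mk_mem_prod (interior_subset ha).1 (interior_subset hb).2)
    exact mem_iInter.1 (mem_iInter.1 this i) j hij
  obtain ⟨ε, hε, hεt⟩ : ∃ ε > 0, ∀ i, ε ≤ t i := by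
    obtain ⟨i, hi⟩ := Finite.exists_min fun i => t i
    exact ⟨t i, ht i, hi⟩
  refine ⟨conc q Reparam.id Reparam.id V V (1 - ε), isOpen_conc hVo hVo _ _ _,
    pt_mem_conc hV1 hV1 (by linarith), fun hmem => hz ?_⟩
  obtain ⟨g, hg⟩ := mem_conc_id.1 hmem
  rw [Reparam.id_warp] at hg
  have hall : ∀ i, g⁻¹ * vert x i ∈ V := by
    intro i
    by_contra hi
    have h1 : mass x t g V + t i ≤ 1 := by
      rw [← stdSimplex.sum_eq_one t, mass, ← Finset.sum_erase_add _ _ (Finset.mem_univ i),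
        ← Finset.sum_erase_add (f := fun i => t i) (h := Finset.mem_univ i),
        indicator_of_notMem hi, zero_mul, add_zero]
      refine add_le_add (Finset.sum_le_sum fun j _ => ?_) le_rfl
      exact mul_le_of_le_one_left (t.2.1 j) (indicator_one_le _ _)
    linarith [hεt i]
  refine eq_pt_iff.2 fun i j _ _ => ?_
  by_contra hij
  refine hV i j hij _ (hall i) _ (hall j) ?_
  group

/-- A compact subset of `B(q, G)` lies in a finite stage of the filtration. -/
theorem exists_subset_fil [T1Space G] {K : Set (NilClassifying q G)} (hK : IsCompact K) :
    ∃ N, K ⊆ fil q G N := by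
  classical
  by_contra hn
  push Not at hn
  have hZ : ∀ N, ∃ Z : Set (NilClassifying q G), IsClosed Z ∧ (Z ∩ K).Nonempty ∧
      Disjoint Z (fil q G N) := by
    intro N
    obtain ⟨z, hzK, hzN⟩ := not_subset.1 (hn N)
    have hex : ∃ m, z ∈ fil q G m := by
      obtain ⟨m, x, t, rfl⟩ := exists_mk z
      exact ⟨m, mk_mem_fil _ _⟩
    obtain ⟨m, hm⟩ : ∃ m, Nat.find hex = m := ⟨_, rfl⟩
    have hmin : ∀ k < m, z ∉ fil q G k := fun k hk => Nat.find_min hex (hm ▸ hk)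
    have hmN : N < m := by
      by_contra h
      exact hzN (fil_mono (not_lt.1 h) (hm ▸ Nat.find_spec hex))
    obtain ⟨m, rfl⟩ : ∃ k, m = k + 1 := ⟨m - 1, by omega⟩
    obtain ⟨x, t, rfl⟩ : z ∈ fil q G (m + 1) := hm ▸ Nat.find_spec hex
    have hpos : ∀ i, 0 < t i := by
      intro i
      by_contra h
      exact hmin m (Nat.lt_succ_self m) (mk_mem_fil_of_eq_zero x t i
        (le_antisymm (not_lt.1 h) (t.2.1 i)))
    have hone : ∀ j, x.1 j ≠ 1 := fun j h =>
      hmin m (Nat.lt_succ_self m) (mk_mem_fil_of_entry_eq_one x t j h)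
    -- The midpoints of the subdivision intervals bound m + 1 windows, each containing a single
    -- subdivision point; as no entry is 1, none of the windows sends the point to the vertex.
    obtain ⟨c, hc⟩ : ∃ c : ℕ → ℝ, ∀ k, c k = (t.cum k + t.cum (k + 1)) / 2 := ⟨_, fun k => rfl⟩
    have hcm : Monotone c := fun a b hab => by
      rw [hc, hc]
      linarith [t.cum_mono hab, t.cum_mono (Nat.succ_le_succ hab)]
    have hsucc : ∀ k : Fin (m + 2), t.cum k < t.cum (k + 1) := fun k => by
      rw [t.cum_succ]; linarith [hpos k]
    have hc1 : ∀ k : Fin (m + 1), t.cum k < c k ∧ c k < t.cum (k + 1) ∧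
        t.cum (k + 1) < c (k + 1) ∧ c (k + 1) < t.cum (k + 2) := fun k => by
      have h1 := hsucc k.castSucc
      have h2 := hsucc k.succ
      simp only [Fin.val_castSucc, Fin.val_succ] at h1 h2
      rw [hc, hc]
      refine ⟨by linarith, by linarith, ?_, ?_⟩
      · linarith
      · change (t.cum (k + 1) + t.cum (k + 1 + 1)) / 2 < t.cum (k + 1 + 1)
        linarith
    have hc0 : ∀ k, 0 ≤ t.cum k := fun k => by
      rw [← t.cum_zero]; exact t.cum_mono (Nat.zero_le _)
    have hcle : ∀ k : Fin (m + 1), c (k + 1) ≤ 1 := fun k => by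
      refine (hc1 k).2.2.2.le.trans ?_
      rw [← t.cum_of_le le_rfl]
      exact t.cum_mono (by omega)
    let w : Fin (m + 1) → Reparam := fun k =>
      Reparam.window (c k) (c (k + 1)) ((hc0 k).trans (hc1 k).1.le)
        ((hc1 k).2.1.trans (hc1 k).2.2.1) (hcle k)
    have hw : ∀ k, act (w k) (mk x t) ≠ pt q G := by
      intro k h
      rw [act_mk, eq_pt_iff] at h
      have hd : 0 < c (k + 1) - c k := sub_pos.2 ((hc1 k).2.1.trans (hc1 k).2.2.1)
      have := h k.castSucc k.succ (by
        simp only [w, Reparam.warp_apply, Fin.val_castSucc]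
        rw [Reparam.window_of_mem (hc1 k).2.1.le (hc1 k).2.2.1.le,
          Reparam.window_of_le (hc1 k).1.le, sub_zero]
        exact div_pos (sub_pos.2 (hc1 k).2.1) hd) (by
        simp only [w, Reparam.warp_apply, Fin.val_succ]
        rw [Reparam.window_of_mem (hc1 k).2.1.le (hc1 k).2.2.1.le,
          Reparam.window_of_ge (hc1 k).2.2.2.le, sub_pos, div_lt_one hd]
        linarith [(hc1 k).2.2.1])
      rw [← inv_mul_eq_one, vert_succ] at this
      exact hone k this
    choose O hO hpO hwO using fun k => exists_isOpen_pt_notMem (hw k)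
    refine ⟨⋂ k, act (w k) ⁻¹' (O k)ᶜ, isClosed_iInter fun k =>
      (hO k).isClosed_compl.preimage (continuous_act _), ⟨mk x t, mem_iInter.2 fun k => hwO k, hzK⟩,
      disjoint_left.2 ?_⟩
    rintro _ hmem ⟨y, s, rfl⟩
    -- Pigeonhole: each of the m + 1 windows, whose interiors are disjoint, must contain a
    -- subdivision point, while a point of the N-th stage has only N of them and N < m + 1.
    have hcut : ∀ k : Fin (m + 1), ∃ l : Fin N,
        c k < s.cum (l + 1) ∧ s.cum (l + 1) < c (k + 1) := by
      intro k
      have hmk := mem_iInter.1 hmem k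
      exact exists_cum_mem_of_act_ne_pt y s fun h : act (w k) (mk y s) = pt q G =>
        hmk (by rw [h]; exact hpO k)
    choose l hl1 hl2 using hcut
    have hinj : Function.Injective l := by
      have key : ∀ a b : Fin (m + 1), a < b → l a ≠ l b := by
        intro a b hab h
        have h1 := hl2 a
        have h2 := hl1 b
        rw [h] at h1
        have h3 : c (a + 1) ≤ c b := hcm hab
        linarith
      intro a b hab
      by_contra hne
      rcases lt_or_gt_of_ne hne with h | h
      · exact key a b h hab
      · exact key b a h hab.symm
    have := Fintype.card_le_of_injective l hinj
    simp only [Fintype.card_fin] at this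
    omega
  choose Z hZc hZK hZd using hZ
  -- The family Z is locally finite on charts: since Z N misses the N-th stage, the n-dimensional
  -- chart meets Z N only for N < n. The complements of the tails form an increasing open cover,
  -- which contradicts compactness.
  have hclosed : ∀ k, IsClosed (⋃ N ≥ k, Z N) := by
    intro k
    refine isClosed_iff.2 fun n => ?_
    have : {p : nilTuples q G n × Simp n | mk p.1 p.2 ∈ ⋃ N ≥ k, Z N}
        = ⋃ N ∈ Finset.Ico k n, (fun p : nilTuples q G n × Simp n => mk p.1 p.2) ⁻¹' Z N := by
      ext p
      simp only [mem_iUnion, mem_preimage, Finset.mem_Ico, exists_prop]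
      refine exists_congr fun N => ⟨fun h => ⟨⟨h.1, ?_⟩, h.2⟩, fun h => ⟨h.1.1, h.2⟩⟩
      by_contra hN
      exact disjoint_left.1 (hZd N) h.2 (fil_mono (not_lt.1 hN) (mk_mem_fil _ _))
    rw [this]
    exact isClosed_biUnion_finset fun N _ => (hZc N).preimage (continuous_mk q G n)
  obtain ⟨k, hk⟩ := hK.elim_directed_cover (fun k => (⋃ N ≥ k, Z N)ᶜ)
    (fun k => (hclosed k).isOpen_compl) (by
      intro z _
      obtain ⟨n, x, t, rfl⟩ := exists_mk z
      refine mem_iUnion.2 ⟨n, fun hmem => ?_⟩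
      simp only [mem_iUnion] at hmem
      obtain ⟨N, hN, hz⟩ := hmem
      exact disjoint_left.1 (hZd N) hz (fil_mono hN (mk_mem_fil _ _)))
    (Monotone.directed_le fun a b hab => compl_subset_compl.2 (iUnion₂_subset fun N hN =>
      subset_iUnion₂_of_subset N (hab.trans hN) Subset.rfl))
  obtain ⟨z, hz, hzK⟩ := hZK k
  exact hk hzK (mem_iUnion₂.2 ⟨k, le_rfl, hz⟩)

end Compactness

end NilClassifying

/-! ### Labels occurring in a compact set -/

namespace NilClassifying

variable {q : ℕ} {G : Type*} [Group G]

/-- The mass of the pairs of vertices whose quotient lies in `D`. -/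
noncomputable def pairMass {n : ℕ} (x : nilTuples q G n) (t : Simp n) (D : Set G) : ℝ :=
  ∑ i, ∑ j, D.indicator 1 ((vert x i)⁻¹ * vert x j) * t j * t i

/-- Avoiding a closed set of labels need not be an open condition, because coordinates may vanish.
Weighting pairs of vertices by the product of their coordinates replaces it by open conditions, the
weight being 1 when all labels are good. -/
theorem isInvariant_pairMass (D : Set G) (c : ℝ) :
    IsInvariant fun n (x : nilTuples q G n) t => c < pairMass x t D := by
  intro m n θ x t
  have h : pairMass x (stdSimplex.map θ t) D = pairMass (nilMap θ x) t D := by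
    have h1 : ∀ i, ∑ j, D.indicator 1 ((vert x i)⁻¹ * vert x j) * stdSimplex.map θ t j
        * stdSimplex.map θ t i = (∑ j, D.indicator 1 ((vert x i)⁻¹ * vert x (θ j)) * t j)
          * stdSimplex.map θ t i := fun i => by
      rw [← Finset.sum_mul, Simp.sum_map θ t fun k => D.indicator 1 ((vert x i)⁻¹ * vert x k)]
    simp only [pairMass, h1]
    rw [Simp.sum_map θ t fun k => ∑ j, D.indicator 1 ((vert x k)⁻¹ * vert x (θ j)) * t j]
    simp [vert_nilMap, Finset.sum_mul]
  change c < pairMass (nilMap θ x) t D ↔ c < pairMass x (stdSimplex.map θ t) D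
  rw [h]

theorem sum_sum_eq_one {n : ℕ} (t : Simp n) : ∑ i, ∑ j, t j * t i = 1 := by
  simp only [← Finset.sum_mul, stdSimplex.sum_eq_one, one_mul]

theorem pairMass_eq_one {n : ℕ} (x : nilTuples q G n) (t : Simp n) {D : Set G}
    (h : ∀ i j, (vert x i)⁻¹ * vert x j ∈ D) : pairMass x t D = 1 := by
  rw [← sum_sum_eq_one t]
  refine Finset.sum_congr rfl fun i _ => Finset.sum_congr rfl fun j _ => ?_
  rw [indicator_of_mem (h i j), Pi.one_apply, one_mul]

theorem pairMass_add_le {n : ℕ} (x : nilTuples q G n) (t : Simp n) {D : Set G} {i j : Fin (n + 1)}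
    (h : (vert x i)⁻¹ * vert x j ∉ D) : pairMass x t D + t j * t i ≤ 1 := by
  have h1 : ∀ a b, D.indicator 1 ((vert x a)⁻¹ * vert x b) * t b * t a ≤ t b * t a := fun a b =>
    mul_le_mul_of_nonneg_right (mul_le_of_le_one_left (t.2.1 b) (indicator_one_le _ _)) (t.2.1 a)
  rw [← sum_sum_eq_one t, pairMass, ← Finset.sum_erase_add (h := Finset.mem_univ i),
    ← Finset.sum_erase_add (f := fun i => ∑ j, t j * t i) (h := Finset.mem_univ i), add_assoc]
  refine add_le_add (Finset.sum_le_sum fun a _ => Finset.sum_le_sum fun b _ => h1 a b) ?_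
  rw [← Finset.sum_erase_add (h := Finset.mem_univ j), indicator_of_notMem h, zero_mul, zero_mul,
    add_zero, ← Finset.sum_erase_add (f := fun j => t j * t i) (h := Finset.mem_univ j)]
  exact add_le_add (Finset.sum_le_sum fun b _ => h1 i b) le_rfl

variable [TopologicalSpace G] [IsTopologicalGroup G]

theorem isOpen_pairMass {D : Set G} (hD : IsOpen D) (c : ℝ) :
    IsOpen (ofInvariant _ (isInvariant_pairMass (q := q) D c)) := by
  refine isOpen_iff.2 fun n => ?_
  have hl : LowerSemicontinuous fun p : nilTuples q G n × Simp n => pairMass p.1 p.2 D := by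
    refine lowerSemicontinuous_sum fun i _ => lowerSemicontinuous_sum fun j _ => ?_
    have ho : IsOpen {p : nilTuples q G n × Simp n | (vert p.1 i)⁻¹ * vert p.1 j ∈ D} :=
      hD.preimage (((continuous_vert i).comp continuous_fst).inv.mul
        ((continuous_vert j).comp continuous_fst))
    have hc : Continuous fun p : nilTuples q G n × Simp n => p.2 j * p.2 i :=
      ((Simp.continuous_coord j).comp continuous_snd).mul
        ((Simp.continuous_coord i).comp continuous_snd)
    intro p y hy
    simp only [gt_iff_lt] at hy ⊢
    by_cases hp : (vert p.1 i)⁻¹ * vert p.1 j ∈ D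
    · rw [indicator_of_mem hp, Pi.one_apply, one_mul] at hy
      filter_upwards [ho.mem_nhds hp, hc.continuousAt.eventually (lt_mem_nhds hy)] with r hr hr'
      rwa [indicator_of_mem hr, Pi.one_apply, one_mul]
    · rw [indicator_of_notMem hp, zero_mul, zero_mul] at hy
      exact Filter.Eventually.of_forall fun r => hy.trans_le
        (mul_nonneg (mul_nonneg (indicator_one_nonneg _ _) (r.2.2.1 j)) (r.2.2.1 i))
  exact hl.isOpen_preimage c

/-- The labels of the points of a compact set avoid the tails of a locally finite sequence of
closed sets. -/
theorem exists_subset_labelsIn {K : Set (NilClassifying q G)} (hK : IsCompact K) {D : ℕ → Set G}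
    (hD : ∀ k, IsClosed (D k)) (hanti : Antitone D) (hinter : ∀ g, ∃ k, g ∉ D k) :
    ∃ k, K ⊆ labelsIn q (D k)ᶜ := by
  by_contra hn
  push Not at hn
  have hW : ∀ k, ∃ z ∈ K, ∃ c < (1 : ℝ),
      z ∉ ofInvariant _ (isInvariant_pairMass (q := q) (D k)ᶜ c) := by
    intro k
    obtain ⟨z, hzK, hz⟩ := not_subset.1 (hn k)
    obtain ⟨n, x, t, rfl⟩ := exists_mk z
    rw [mk_mem_labelsIn] at hz
    push Not at hz
    obtain ⟨i, j, -, hi, hj, hij⟩ := hz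
    -- The offending pair carries weight t j * t i, which is lost from the total weight 1.
    refine ⟨_, hzK, 1 - t j * t i, by linarith [mul_pos hj hi], fun h => ?_⟩
    have h1 : 1 - t j * t i < pairMass x t (D k)ᶜ := h
    linarith [pairMass_add_le x t hij]
  choose z hzK c hc hz using hW
  -- Only finitely many conditions matter near a point: its finitely many labels avoid D L for some
  -- L, this persists nearby, and then the pair mass is 1 for all k ≥ L.
  have hopen : ∀ m, IsOpen (⋂ k ≥ m, ofInvariant _
      (isInvariant_pairMass (q := q) (D k)ᶜ (c k))) := by
    intro m
    refine isOpen_iff.2 fun n => isOpen_iff_mem_nhds.2 fun p hp => ?_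
    choose M hM using hinter
    obtain ⟨L, hL⟩ : ∃ L, ∀ i j, M ((vert p.1 i)⁻¹ * vert p.1 j) ≤ L := by
      obtain ⟨L, hL⟩ := (Set.finite_range fun ij : Fin (n + 1) × Fin (n + 1) =>
        M ((vert p.1 ij.1)⁻¹ * vert p.1 ij.2)).bddAbove
      exact ⟨L, fun i j => hL ⟨(i, j), rfl⟩⟩
    have h1 : ∀ᶠ r : nilTuples q G n × Simp n in 𝓝 p, ∀ i j,
        (vert r.1 i)⁻¹ * vert r.1 j ∈ (D L)ᶜ := by
      refine Filter.eventually_all.2 fun i => Filter.eventually_all.2 fun j => ?_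
      have hcont : Continuous fun r : nilTuples q G n × Simp n => (vert r.1 i)⁻¹ * vert r.1 j :=
        ((continuous_vert i).comp continuous_fst).inv.mul ((continuous_vert j).comp continuous_fst)
      exact hcont.continuousAt.eventually ((hD L).isOpen_compl.mem_nhds
        fun h => hM _ (hanti (hL i j) h))
    have h2 : ∀ᶠ r : nilTuples q G n × Simp n in 𝓝 p, ∀ k ∈ Finset.Ico m L,
        mk r.1 r.2 ∈ ofInvariant _ (isInvariant_pairMass (q := q) (D k)ᶜ (c k)) := by
      refine (Finset.eventually_all _).2 fun k hk => ?_
      exact (isOpen_iff.1 (isOpen_pairMass (hD k).isOpen_compl (c k)) n).mem_nhds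
        (mem_iInter₂.1 hp k (Finset.mem_Ico.1 hk).1)
    filter_upwards [h1, h2] with r hr1 hr2
    refine mem_iInter₂.2 fun k hk => ?_
    by_cases hkL : k < L
    · exact hr2 k (Finset.mem_Ico.2 ⟨hk, hkL⟩)
    · change c k < pairMass r.1 r.2 (D k)ᶜ
      rw [pairMass_eq_one]
      · exact hc k
      · exact fun i j h => hr1 i j (hanti (not_lt.1 hkL) h)
  obtain ⟨m, hm⟩ := hK.elim_directed_cover _ hopen (by
      intro w _
      obtain ⟨n, x, t, rfl⟩ := exists_mk w
      choose M hM using hinter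
      obtain ⟨L, hL⟩ := (Set.finite_range fun ij : Fin (n + 1) × Fin (n + 1) =>
        M ((vert x ij.1)⁻¹ * vert x ij.2)).bddAbove
      refine mem_iUnion.2 ⟨L, mem_iInter₂.2 fun k hk => ?_⟩
      change c k < pairMass x t (D k)ᶜ
      rw [pairMass_eq_one]
      · exact hc k
      · exact fun i j h => hM _ (hanti ((hL ⟨(i, j), rfl⟩).trans hk) h))
    (Monotone.directed_le fun a b hab => iInter₂_mono' fun k hk => ⟨k, hab.trans hk, Subset.rfl⟩)
  exact hz m (mem_iInter₂.1 (hm (hzK m)) m le_rfl)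

end NilClassifying

/-! ### Finite unions of cells -/

section Cells

open Topology.RelCWComplex

/-- The fibre over y is compact, so its neighbourhoods are controlled by finite unions of basic open
sets; closedness of f turns these into countably many neighbourhoods of y. -/
theorem firstCountable_of_isClosedMap {X Y : Type*} [TopologicalSpace X] [TopologicalSpace Y]
    [SecondCountableTopology X] [CompactSpace X] [T1Space Y] {f : X → Y} (hf : IsClosedMap f)
    (hc : Continuous f) (hsurj : Function.Surjective f) : FirstCountableTopology Y := by
  classical
  refine ⟨fun y => ?_⟩
  obtain ⟨B, hBc, -, hB⟩ := TopologicalSpace.exists_countable_basis X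
  have := hBc.to_subtype
  have hbasis : (𝓝 y).HasBasis (fun s : Finset B => f ⁻¹' {y} ⊆ ⋃ b ∈ s, (b : Set X))
      fun s => kernImage f (⋃ b ∈ s, (b : Set X)) := by
    refine ⟨fun U => ⟨fun hU => ?_, ?_⟩⟩
    · obtain ⟨O, hOU, hO, hyO⟩ := mem_nhds_iff.1 hU
      have hcomp : IsCompact (f ⁻¹' {y}) := (isClosed_singleton.preimage hc).isCompact
      have hcov : ∀ x ∈ f ⁻¹' {y}, ∃ b : B, x ∈ (b : Set X) ∧ (b : Set X) ⊆ f ⁻¹' O := by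
        intro x hx
        obtain ⟨b, hb, hxb, hbO⟩ := hB.exists_subset_of_mem_open
          (show x ∈ f ⁻¹' O by rw [mem_preimage, show f x = y from hx]; exact hyO) (hO.preimage hc)
        exact ⟨⟨b, hb⟩, hxb, hbO⟩
      obtain ⟨s, hs⟩ := hcomp.elim_finite_subcover
        (fun b : {b : B // (b : Set X) ⊆ f ⁻¹' O} => (b.1 : Set X))
        (fun b => hB.isOpen b.1.2) (fun x hx => by
          obtain ⟨b, hxb, hbO⟩ := hcov x hx
          exact mem_iUnion.2 ⟨⟨b, hbO⟩, hxb⟩)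
      refine ⟨s.image Subtype.val, ?_, ?_⟩
      · intro x hx
        obtain ⟨b, hb, hxb⟩ := mem_iUnion₂.1 (hs hx)
        exact mem_iUnion₂.2 ⟨b.1, Finset.mem_image_of_mem _ hb, hxb⟩
      · intro w hw
        obtain ⟨x, rfl⟩ := hsurj w
        have := hw rfl
        obtain ⟨b, hb, hx⟩ := mem_iUnion₂.1 this
        obtain ⟨b', -, rfl⟩ := Finset.mem_image.1 hb
        exact hOU (b'.2 hx)
    · rintro ⟨s, hs, hsU⟩
      refine Filter.mem_of_superset ?_ hsU
      have hopen : IsOpen (⋃ b ∈ s, (b : Set X)) :=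
        isOpen_biUnion fun b _ => hB.isOpen b.2
      have := isClosedMap_iff_kernImage_interior.1 hf (s := ⋃ b ∈ s, (b : Set X))
      rw [hopen.interior_eq] at this
      exact mem_interior_iff_mem_nhds.1 (this fun x hx => hs hx)
  exact Filter.HasCountableBasis.isCountablyGenerated ⟨hbasis, to_countable _⟩

variable {G : Type*} [TopologicalSpace G] [Topology.CWComplex (univ : Set G)]

/-- A finite union of closed cells of a CW complex. -/
def cellUnion (E : Finset (Σ n, cell (univ : Set G) n)) : Set G := ⋃ e ∈ E, closedCell e.1 e.2

theorem isCompact_cellUnion (E : Finset (Σ n, cell (univ : Set G) n)) :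
    IsCompact (cellUnion E) := E.isCompact_biUnion fun _ _ => isCompact_closedCell

variable [T2Space G]

/-- A finite disjoint union of closed balls maps onto the union, and this map is closed because the
source is compact and the target is Hausdorff. -/
theorem cellUnion_aux (E : Finset (Σ n, cell (univ : Set G) n)) :
    LocallyPathConnectedSpace (cellUnion E) ∧ FirstCountableTopology (cellUnion E) := by
  have hball : ∀ n, LocallyPathConnectedSpace (Metric.closedBall (0 : Fin n → ℝ) 1) := fun n =>
    (convex_closedBall _ _).locallyPathConnectedSpace
  have hcomp : ∀ n, CompactSpace (Metric.closedBall (0 : Fin n → ℝ) 1) := fun n =>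
    isCompact_iff_compactSpace.1 (isCompact_closedBall _ _)
  let F : (Σ e : E, Metric.closedBall (0 : Fin e.1.1 → ℝ) 1) → cellUnion E := fun p =>
    ⟨Topology.RelCWComplex.map p.1.1.1 p.1.1.2 p.2.1,
      mem_biUnion (t := fun e : Σ n, cell (univ : Set G) n => closedCell e.1 e.2) p.1.2
        (mem_image_of_mem _ p.2.2)⟩
  have hF : Continuous F := by
    refine Continuous.subtype_mk (continuous_sigma fun e => ?_) _
    exact continuousOn_iff_continuous_domRestrict.1 (continuousOn (C := (univ : Set G)) e.1.1 e.1.2)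
  have hs : Function.Surjective F := by
    rintro ⟨g, hg⟩
    obtain ⟨e, he, v, hv, rfl⟩ := mem_iUnion₂.1 hg
    exact ⟨⟨⟨e, he⟩, ⟨v, hv⟩⟩, rfl⟩
  exact ⟨(hF.isClosedMap.isQuotientMap hF hs).locallyPathConnectedSpace,
    firstCountable_of_isClosedMap hF.isClosedMap hF hs⟩

theorem locallyPathConnectedSpace_of_cwComplex (G : Type*) [TopologicalSpace G] [T2Space G]
    [Topology.CWComplex (univ : Set G)] : LocallyPathConnectedSpace G := by
  have hball : ∀ n, LocallyPathConnectedSpace (Metric.closedBall (0 : Fin n → ℝ) 1) := fun n =>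
    (convex_closedBall _ _).locallyPathConnectedSpace
  have hcomp : ∀ n, CompactSpace (Metric.closedBall (0 : Fin n → ℝ) 1) := fun n =>
    isCompact_iff_compactSpace.1 (isCompact_closedBall _ _)
  let F : (Σ e : (Σ n, cell (univ : Set G) n), Metric.closedBall (0 : Fin e.1 → ℝ) 1) → G :=
    fun p => Topology.RelCWComplex.map p.1.1 p.1.2 p.2.1
  have hFe : ∀ e : Σ n, cell (univ : Set G) n, Continuous
      fun v : Metric.closedBall (0 : Fin e.1 → ℝ) 1 => Topology.RelCWComplex.map e.1 e.2 v.1 :=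
    fun e => continuousOn_iff_continuous_domRestrict.1 (continuousOn (C := (univ : Set G)) e.1 e.2)
  have hF : Continuous F := continuous_sigma hFe
  have hq : IsQuotientMap F := by
    refine isQuotientMap_iff_isClosed.2
      ⟨fun g => ?_, fun S => ⟨fun hS => hS.preimage hF, fun hS => ?_⟩⟩
    · have : g ∈ ⋃ (n : ℕ) (j : cell (univ : Set G) n), closedCell n j := by
        rw [Topology.CWComplex.union]; trivial
      obtain ⟨n, j, v, hv, rfl⟩ := mem_iUnion₂.1 this
      exact ⟨⟨⟨n, j⟩, ⟨v, hv⟩⟩, rfl⟩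
    · refine (Topology.CWComplex.closed (univ : Set G) S (subset_univ _)).2 fun n j => ?_
      have h1 : IsClosed {v : Metric.closedBall (0 : Fin n → ℝ) 1 |
          Topology.RelCWComplex.map (C := (univ : Set G)) n j v.1 ∈ S} :=
        isClosed_sigma_iff.1 hS ⟨n, j⟩
      have h2 := (h1.isCompact.image (hFe ⟨n, j⟩)).isClosed
      convert h2 using 1
      ext g
      constructor
      · rintro ⟨hg, v, hv, rfl⟩
        exact ⟨⟨v, hv⟩, hg, rfl⟩
      · rintro ⟨v, hv, rfl⟩
        exact ⟨hv, v.1, v.2, rfl⟩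
  exact hq.locallyPathConnectedSpace

/-- If L met infinitely many open cells, choosing one point in each would give a sequence all of
whose subsets are closed, as a closed cell meets only finitely many open cells. Its tails would
violate the hypothesis. -/
theorem exists_subset_cellUnion {L : Set G} (hL : ∀ D : ℕ → Set G, (∀ k, IsClosed (D k)) →
    Antitone D → (∀ g, ∃ k, g ∉ D k) → ∃ k, Disjoint L (D k)) :
    ∃ E : Finset (Σ n, cell (univ : Set G) n), L ⊆ cellUnion E := by
  classical
  have hcover : ∀ g : G, ∃ e : Σ n, cell (univ : Set G) n, g ∈ openCell e.1 e.2 := fun g => by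
    have : g ∈ ⋃ (n : ℕ) (j : cell (univ : Set G) n), openCell n j := by
      rw [Topology.CWComplex.iUnion_openCell_eq_complex]; trivial
    obtain ⟨n, j, h⟩ := mem_iUnion₂.1 this
    exact ⟨⟨n, j⟩, h⟩
  have huniq : ∀ (g : G) (e e' : Σ n, cell (univ : Set G) n), g ∈ openCell e.1 e.2 →
      g ∈ openCell e'.1 e'.2 → e = e' := by
    intro g e e' h h'
    by_contra hne
    exact disjoint_left.1 (disjoint_openCell_of_ne (C := (univ : Set G)) hne) h h'
  by_cases hfin : {e : Σ n, cell (univ : Set G) n | (openCell e.1 e.2 ∩ L).Nonempty}.Finite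
  · refine ⟨hfin.toFinset, fun g hg => ?_⟩
    obtain ⟨e, he⟩ := hcover g
    exact mem_biUnion (t := fun e : Σ n, cell (univ : Set G) n => closedCell e.1 e.2)
      (Finset.mem_coe.2 (hfin.mem_toFinset.2 ⟨g, he, hg⟩)) (openCell_subset_closedCell _ _ he)
  · exfalso
    let f := Set.Infinite.natEmbedding _ hfin
    choose g hg using fun k => (f k).2
    have hginj : ∀ k l, g k = g l → k = l := fun k l h =>
      f.injective (Subtype.ext (huniq (g k) _ _ (hg k).1 (h ▸ (hg l).1)))
    have hclosed : ∀ S : Set ℕ, IsClosed (g '' S) := by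
      intro S
      refine (Topology.CWComplex.closed (univ : Set G) _ (subset_univ _)).2 fun n j => ?_
      obtain ⟨J, hJ⟩ := Topology.CWComplex.cellFrontier_subset_finite_openCell
        (C := (univ : Set G)) n j
      have hsub : g '' S ∩ closedCell n j ⊆
          g '' {k | (f k).1 ∈ insert ⟨n, j⟩ ((Finset.range n).sigma J)} := by
        rintro _ ⟨⟨k, -, rfl⟩, hk⟩
        refine ⟨k, ?_, rfl⟩
        rw [← cellFrontier_union_openCell_eq_closedCell] at hk
        rcases hk with hk | hk
        · obtain ⟨m, hm, i, hi, hgi⟩ : ∃ m, m < n ∧ ∃ i ∈ J m, g k ∈ openCell m i := by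
            simpa using hJ hk
          rw [mem_ofPred_eq, huniq (g k) _ ⟨m, i⟩ (hg k).1 hgi]
          exact Finset.mem_insert_of_mem (Finset.mem_sigma.2 ⟨Finset.mem_range.2 hm, hi⟩)
        · rw [mem_ofPred_eq, huniq (g k) _ ⟨n, j⟩ (hg k).1 hk]
          exact Finset.mem_insert_self _ _
      refine (Finite.subset (Finite.image g ?_) hsub).isClosed
      exact Finite.preimage (fun a _ b _ h => f.injective (Subtype.ext h)) (Finset.finite_toSet _)
    obtain ⟨k, hk⟩ := hL (fun k => g '' Ici k) (fun k => hclosed _)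
      (fun a b hab => image_mono (Ici_subset_Ici.2 hab)) (fun a => by
        by_cases ha : ∃ k, g k = a
        · obtain ⟨k, rfl⟩ := ha
          refine ⟨k + 1, ?_⟩
          rintro ⟨l, hl, h⟩
          have := hginj _ _ h
          have h2 : k + 1 ≤ l := hl
          omega
        · exact ⟨0, fun ⟨l, _, h⟩ => ha ⟨l, h⟩⟩)
    exact disjoint_left.1 hk (hg k).2 ⟨k, self_mem_Ici, rfl⟩

end Cells

/-! ### Scales -/

/-- A compact set of labels together with a sequence of neighbourhoods of `1` that shrinks to `1`
inside it. -/
structure Scale (G : Type*) [Group G] [TopologicalSpace G] where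
  C : Set G
  V : ℕ → Set G
  isCompact : IsCompact C
  one_mem : 1 ∈ C
  isOpen : ∀ k, IsOpen (V k)
  one_mem_V : ∀ k, 1 ∈ V k
  mul_mem : ∀ k, ∀ a ∈ V (k + 1), ∀ b ∈ V (k + 1), ∀ c ∈ V (k + 1), a * b⁻¹ * c ∈ V k
  basis : ∀ U ∈ 𝓝 (1 : G), ∃ k, V k ∩ C ⊆ U
  joined : ∀ k, ∃ l, ∀ h ∈ V l ∩ C, JoinedIn (V k ∩ C) h 1

theorem Scale.antitone {G : Type*} [Group G] [TopologicalSpace G] (S : Scale G) :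
    Antitone S.V := antitone_nat_of_succ_le fun k a ha => by
  have := S.mul_mem k a ha 1 (S.one_mem_V _) 1 (S.one_mem_V _)
  simpa using this

/-- The neighbourhoods are built recursively: the trace of the next one lies in the next member of a
countable basis at 1 of the finite union, and its triple products a b⁻¹ c stay in the previous one.
Local path connectedness of the union gives the joining condition. -/
theorem exists_scale_of_cellUnion {G : Type*} [Group G] [TopologicalSpace G] [IsTopologicalGroup G]
    [T2Space G] [Topology.CWComplex (univ : Set G)]
    (E : Finset (Σ n, Topology.RelCWComplex.cell (univ : Set G) n)) (h1 : 1 ∈ cellUnion E) :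
    ∃ S : Scale G, S.C = cellUnion E := by
  obtain ⟨hlpc, hfc⟩ := cellUnion_aux E
  let e : cellUnion E := ⟨1, h1⟩
  obtain ⟨u, hu⟩ := (𝓝 e).exists_antitone_basis
  have ho : ∀ k, ∃ O : Set G, IsOpen O ∧ 1 ∈ O ∧ ∀ g (hg : g ∈ cellUnion E), g ∈ O →
      ⟨g, hg⟩ ∈ u k := fun k => by
    obtain ⟨W, hW, hWu⟩ := mem_nhds_subtype _ _ _ |>.1 (hu.toHasBasis.mem_of_mem (i := k) trivial)
    obtain ⟨O, hOW, hO, h1O⟩ := mem_nhds_iff.1 hW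
    exact ⟨O, hO, h1O, fun g hg hgO => hWu (hOW hgO)⟩
  choose O hO h1O hOu using ho
  have hstep : ∀ (k : ℕ) (W : {W : Set G // IsOpen W ∧ 1 ∈ W}),
      ∃ W' : {W : Set G // IsOpen W ∧ 1 ∈ W}, W'.1 ⊆ O k ∧
        ∀ a ∈ W'.1, ∀ b ∈ W'.1, ∀ c ∈ W'.1, a * b⁻¹ * c ∈ W.1 := by
    rintro k ⟨W, hW, h1W⟩
    have hcont : ContinuousAt (fun p : G × G × G => p.1 * p.2.1⁻¹ * p.2.2) (1, 1, 1) := by fun_prop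
    have := hcont.preimage_mem_nhds (by simpa using hW.mem_nhds h1W)
    rw [nhds_prod_eq, nhds_prod_eq, Filter.mem_prod_iff] at this
    obtain ⟨A, hA, B, hB, hAB⟩ := this
    obtain ⟨B', hB', C', hC', hBC⟩ := Filter.mem_prod_iff.1 hB
    refine ⟨⟨interior (A ∩ (B' ∩ C')) ∩ O k, isOpen_interior.inter (hO k),
      mem_interior_iff_mem_nhds.2 (Filter.inter_mem hA (Filter.inter_mem hB' hC')), h1O k⟩,
      inter_subset_right, fun a ha b hb c hc => ?_⟩
    exact hAB (mk_mem_prod (interior_subset ha.1).1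
      (hBC (mk_mem_prod (interior_subset hb.1).2.1 (interior_subset hc.1).2.2)))
  choose next hnext1 hnext2 using hstep
  let V : ℕ → {W : Set G // IsOpen W ∧ 1 ∈ W} := fun k =>
    Nat.rec ⟨univ, isOpen_univ, trivial⟩ (fun k W => next k W) k
  have hVO : ∀ k, (V (k + 1)).1 ⊆ O k := fun k => hnext1 k (V k)
  have hbasis : ∀ U ∈ 𝓝 e, ∃ k, ∀ g (hg : g ∈ cellUnion E), g ∈ (V k).1 → ⟨g, hg⟩ ∈ U := by
    intro U hU
    obtain ⟨k, -, hk⟩ := hu.toHasBasis.mem_iff.1 hU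
    exact ⟨k + 1, fun g hg hgV => hk (hOu k g hg (hVO k hgV))⟩
  refine ⟨⟨cellUnion E, fun k => (V k).1, isCompact_cellUnion E, h1, fun k => (V k).2.1,
    fun k => (V k).2.2, fun k => hnext2 k (V k), fun U hU => ?_, fun k => ?_⟩, rfl⟩
  · obtain ⟨k, hk⟩ := hbasis (Subtype.val ⁻¹' U) (continuous_subtype_val.continuousAt hU)
    exact ⟨k, fun g hg => hk g hg.2 hg.1⟩
  · have hmem : (Subtype.val ⁻¹' (V k).1 : Set (cellUnion E)) ∈ 𝓝 e :=
      continuous_subtype_val.continuousAt ((V k).2.1.mem_nhds (V k).2.2)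
    obtain ⟨P, ⟨hP, hPc⟩, hPV⟩ := (path_connected_basis e).mem_iff.1 hmem
    obtain ⟨l, hl⟩ := hbasis P hP
    refine ⟨l, fun h hh => ?_⟩
    have hj := (hPc.joinedIn _ (hl h hh.2 hh.1) e (mem_of_mem_nhds hP))
    have := hj.map_continuousOn (f := Subtype.val) continuous_subtype_val.continuousOn
    exact this.mono (by rintro _ ⟨g, hg, rfl⟩; exact ⟨hPV hg, g.2⟩)

namespace NilClassifying

theorem exists_scale {q : ℕ} {G : Type*} [Group G] [TopologicalSpace G] [IsTopologicalGroup G]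
    [T2Space G] [Topology.CWComplex (univ : Set G)] {K : Set (NilClassifying q G)}
    (hK : IsCompact K) : ∃ S : Scale G, K ⊆ labelsIn q S.C := by
  classical
  obtain ⟨E, hE⟩ := exists_subset_cellUnion (G := G)
    (L := {g | ∃ z ∈ K, z ∉ labelsIn q ({g}ᶜ : Set G)}) (by
      intro D hD hanti hinter
      obtain ⟨k, hk⟩ := exists_subset_labelsIn hK hD hanti hinter
      refine ⟨k, disjoint_left.2 ?_⟩
      rintro g ⟨z, hzK, hz⟩ hgD
      obtain ⟨n, x, t, rfl⟩ := exists_mk z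
      refine hz (mk_mem_labelsIn.2 fun i j hij hi hj h => ?_)
      have := mk_mem_labelsIn.1 (hk hzK) i j hij hi hj
      rw [mem_singleton_iff.1 h] at this
      exact this hgD)
  have : (1 : G) ∈ ⋃ (n : ℕ) (j : Topology.RelCWComplex.cell (univ : Set G) n),
      Topology.RelCWComplex.closedCell n j := by
    rw [Topology.CWComplex.union]; trivial
  obtain ⟨n, j, h1⟩ := mem_iUnion₂.1 this
  -- One more cell is added to make sure that 1 is among the allowed labels.
  obtain ⟨S, hS⟩ := exists_scale_of_cellUnion (insert ⟨n, j⟩ E)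
    (mem_biUnion (t := fun e : Σ n, Topology.RelCWComplex.cell (univ : Set G) n =>
      Topology.RelCWComplex.closedCell e.1 e.2) (Finset.mem_coe.2 (Finset.mem_insert_self _ _)) h1)
  refine ⟨S, fun z hz => ?_⟩
  obtain ⟨n, x, t, rfl⟩ := exists_mk z
  refine mk_mem_labelsIn.2 fun i j hij hi hj => ?_
  rw [hS]
  have : (vert x i)⁻¹ * vert x j ∈ cellUnion E :=
    hE ⟨_, hz, fun h => mk_mem_labelsIn.1 h i j hij hi hj rfl⟩
  exact biUnion_subset_biUnion_left (fun e he => Finset.mem_insert_of_mem he) this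

end NilClassifying

/-! ### Homotopy classes of paths -/

section Paths

variable {Y : Type*} [TopologicalSpace Y]

/-- The class of a path in the fundamental groupoid. -/
def pathClass {a b : Y} (p : Path a b) : FundamentalGroupoid.mk a ⟶ FundamentalGroupoid.mk b :=
  Path.Homotopic.Quotient.mk p

theorem pathClass_trans {a b c : Y} (p : Path a b) (r : Path b c) :
    pathClass (p.trans r) = pathClass p ≫ pathClass r := rfl

theorem pathClass_symm {a b : Y} (p : Path a b) :
    pathClass p.symm = Groupoid.inv (pathClass p) := rfl

theorem pathClass_refl (a : Y) : pathClass (Path.refl a) = 𝟙 (FundamentalGroupoid.mk a) := rfl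

theorem pathClass_eq_iff {a b : Y} {p r : Path a b} :
    pathClass p = pathClass r ↔ p.Homotopic r := Quotient.eq

theorem pathClass_subpath_trans {a b : Y} (γ : Path a b) (t₀ t₁ t₂ : I) :
    pathClass (γ.subpath t₀ t₁) ≫ pathClass (γ.subpath t₁ t₂) = pathClass (γ.subpath t₀ t₂) :=
  pathClass_eq_iff.2 ⟨Path.Homotopy.subpathTransSubpath γ t₀ t₁ t₂⟩

theorem pathClass_subpath_inv {a b : Y} (γ : Path a b) (t₀ t₁ : I) :
    Groupoid.inv (pathClass (γ.subpath t₀ t₁)) = pathClass (γ.subpath t₁ t₀) := by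
  rw [← pathClass_symm, Path.symm_subpath]

/-- Membership of the loops obtained by closing up the pieces of a path is a local property. -/
theorem mem_of_eventually_mem {a b y₀ : Y} (γ : Path a b)
    (κ : ∀ t, FundamentalGroupoid.mk (γ t) ⟶ FundamentalGroupoid.mk y₀)
    (E : Subgroup (FundamentalGroup Y y₀))
    (h : ∀ t₀, ∀ᶠ t in 𝓝 t₀,
      (Groupoid.inv (κ t₀) ≫ pathClass (γ.subpath t₀ t) ≫ κ t : FundamentalGroup Y y₀) ∈ E)
    (t t' : I) :
    (Groupoid.inv (κ t) ≫ pathClass (γ.subpath t t') ≫ κ t' : FundamentalGroup Y y₀) ∈ E := by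
  let P : I → I → Prop := fun t t' => (Groupoid.inv (κ t) ≫ pathClass (γ.subpath t t') ≫ κ t' :
      FundamentalGroup Y y₀) ∈ E
  have : Std.Symm P := ⟨fun s t hst => by
    have := E.inv_mem hst
    convert this using 1
    change _ = Groupoid.inv (_ ≫ _ ≫ _)
    rw [← pathClass_subpath_inv]
    simp⟩
  have : IsTrans I P := ⟨fun r s t hrs hst => by
    have := E.mul_mem hst hrs
    convert this using 1
    change _ = (_ ≫ _ ≫ _) ≫ (_ ≫ _ ≫ _)
    rw [← pathClass_subpath_trans γ r s t]
    simp⟩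
  -- A symmetric and transitive relation on a connected space that holds locally around every point
  -- holds everywhere.
  exact PreconnectedSpace.induction₂ P h this t t'

/-- The two ways around the boundary of the contractible square I × I are homotopic. -/
theorem pathClass_square {a b c d : Y} (F : C(I × I, Y)) (top : Path a b) (right : Path b d)
    (left : Path a c) (bottom : Path c d) (h₁ : ∀ r, F (r, 0) = top r)
    (h₂ : ∀ s, F (1, s) = right s) (h₃ : ∀ s, F (0, s) = left s) (h₄ : ∀ r, F (r, 1) = bottom r) :
    pathClass top ≫ pathClass right = pathClass left ≫ pathClass bottom := by
  obtain rfl : F (0, 0) = a := by rw [h₁, top.source]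
  obtain rfl : F (1, 0) = b := by rw [h₁, top.target]
  obtain rfl : F (0, 1) = c := by rw [h₃, left.target]
  obtain rfl : F (1, 1) = d := by rw [h₂, right.target]
  let p₁ : Path ((0, 0) : I × I) (1, 0) := ⟨⟨fun r => (r, 0), by fun_prop⟩, rfl, rfl⟩
  let p₂ : Path ((1, 0) : I × I) (1, 1) := ⟨⟨fun r => (1, r), by fun_prop⟩, rfl, rfl⟩
  let p₃ : Path ((0, 0) : I × I) (0, 1) := ⟨⟨fun r => (0, r), by fun_prop⟩, rfl, rfl⟩
  let p₄ : Path ((0, 1) : I × I) (1, 1) := ⟨⟨fun r => (r, 1), by fun_prop⟩, rfl, rfl⟩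
  have e₁ : top = p₁.map F.continuous := by ext r; exact (h₁ r).symm
  have e₂ : right = p₂.map F.continuous := by ext r; exact (h₂ r).symm
  have e₃ : left = p₃.map F.continuous := by ext r; exact (h₃ r).symm
  have e₄ : bottom = p₄.map F.continuous := by ext r; exact (h₄ r).symm
  rw [← pathClass_trans, ← pathClass_trans, pathClass_eq_iff, e₁, e₂, e₃, e₄, ← Path.map_trans,
    ← Path.map_trans]
  have : ContractibleSpace I := (convex_Icc (0 : ℝ) 1).contractibleSpace ⟨0, by simp⟩
  exact (SimplyConnectedSpace.paths_homotopic (p₁.trans p₂) (p₃.trans p₄)).map F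

/-- A homotopy from `γ` to `κ · κ'⁻¹` rearranged as a square with prescribed sides. -/
theorem exists_filler {a b y₀ : Y} {γ : Path a b} {κ : Path a y₀} {κ' : Path b y₀}
    (h : γ.Homotopic (κ.trans κ'.symm)) :
    ∃ F : C(I × I, Y), (∀ r, F (r, 0) = γ r) ∧ (∀ r, F (r, 1) = y₀) ∧
      (∀ s, F (0, s) = (Path.refl a).trans κ s) ∧ ∀ s, F (1, s) = (Path.refl b).trans κ' s := by
  obtain ⟨H⟩ := h
  -- For s ≤ 1/2 the homotopy runs at double speed with the path parameter fixed; for s ≥ 1/2 the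
  -- path parameter shrinks to 1/2, where the path κ · κ'⁻¹ passes through y₀. This produces the
  -- constant first half in both sides.
  let ρ : C(I, I) := ⟨fun s => projIcc 0 1 zero_le_one (2 * (s : ℝ)), by fun_prop⟩
  let τ : C(I, I) := ⟨fun s => projIcc 0 1 zero_le_one (2 * (s : ℝ) - 1), by fun_prop⟩
  have hτ : ∀ s : I, (s : ℝ) ≤ 1 / 2 → τ s = 0 := fun s hs =>
    projIcc_of_le_left zero_le_one (by linarith)
  have hρ : ∀ s : I, 1 / 2 ≤ (s : ℝ) → ρ s = 1 := fun s hs =>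
    projIcc_of_right_le zero_le_one (by linarith)
  have hτ' : ∀ s : I, 1 / 2 ≤ (s : ℝ) → (τ s : ℝ) = 2 * s - 1 := fun s hs => by
    change ((projIcc (0 : ℝ) 1 zero_le_one (2 * (s : ℝ) - 1) : I) : ℝ) = _
    rw [projIcc_of_mem _ (⟨by linarith, by linarith [s.2.2]⟩ : 2 * (s : ℝ) - 1 ∈ Icc (0 : ℝ) 1)]
  let m : C(I × I, I) := ⟨fun p => ⟨(1 - (τ p.2 : ℝ)) * p.1 + τ p.2 / 2, by
      have h1 := (τ p.2).2
      have h2 := p.1.2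
      constructor
      · nlinarith [h1.1, h1.2, h2.1, h2.2]
      · nlinarith [h1.1, h1.2, h2.1, h2.2]⟩, by fun_prop⟩
  let F : C(I × I, Y) := ⟨fun p => H (ρ p.2, m p), by fun_prop⟩
  refine ⟨F, fun r => ?_, fun r => ?_, fun s => ?_, fun s => ?_⟩
  · have h0 : ρ 0 = 0 := projIcc_of_le_left zero_le_one (by simp)
    have h1 : m (r, 0) = r := Subtype.ext (by simp [m, hτ])
    change H (ρ 0, m (r, 0)) = γ r
    rw [h0, h1, H.apply_zero]
    rfl
  · have h0 : ρ 1 = 1 := hρ 1 (by norm_num)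
    have h1 : (m (r, 1) : ℝ) = 1 / 2 := by
      simp only [m, ContinuousMap.coe_mk, hτ' 1 (by norm_num : (1:ℝ)/2 ≤ ((1 : I) : ℝ))]
      norm_num
    change H (ρ 1, m (r, 1)) = y₀
    rw [h0, H.apply_one]
    change (κ.trans κ'.symm) (m (r, 1)) = y₀
    rw [Path.trans_apply, dif_pos h1.le]
    convert κ.target using 2
    exact Subtype.ext (by simp [h1])
  · change H (ρ s, m (0, s)) = _
    have hm : (m (0, s) : ℝ) = τ s / 2 := by simp [m]
    rw [Path.trans_apply]
    split_ifs with hs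
    · have h1 : m (0, s) = 0 := Subtype.ext (by rw [hm, hτ s hs]; simp)
      rw [h1, H.source]
      rfl
    · rw [hρ s (by linarith), H.apply_one]
      change (κ.trans κ'.symm) (m (0, s)) = _
      have h2 := hτ' s (by linarith)
      rw [Path.trans_apply, dif_pos (by rw [hm, h2]; linarith [s.2.2])]
      congr 1
      exact Subtype.ext (by simp only [hm, h2]; ring)
  · change H (ρ s, m (1, s)) = _
    have hm : (m (1, s) : ℝ) = 1 - τ s / 2 := by simp [m]; ring
    rw [Path.trans_apply]
    split_ifs with hs
    · have h1 : m (1, s) = 1 := Subtype.ext (by rw [hm, hτ s hs]; simp)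
      rw [h1, H.target]
      rfl
    · rw [hρ s (by linarith), H.apply_one]
      change (κ.trans κ'.symm) (m (1, s)) = _
      have h2 := hτ' s (by linarith)
      have h3 : (0 : ℝ) ≤ τ s / 2 ∧ (τ s : ℝ) / 2 ≤ 1 / 2 :=
        ⟨by linarith [(τ s).2.1], by linarith [(τ s).2.2]⟩
      let u : I := ⟨τ s / 2, h3.1, by linarith⟩
      have h4 : m (1, s) = unitInterval.symm u := Subtype.ext (by rw [hm]; rfl)
      rw [h4]
      change (κ.trans κ'.symm).symm u = _
      rw [Path.trans_symm, Path.symm_symm, Path.trans_apply, dif_pos h3.2]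
      congr 1
      exact Subtype.ext (by simp only [u, h2]; ring)

end Paths

/-! ### Sets closed under passing to faces. -/

namespace NilClassifying

section FaceClosed

variable {q : ℕ} {G : Type*} [Group G]

/-- A set that contains with each point of a simplex the smallest closed face around it. -/
def FaceClosed (B : Set (NilClassifying q G)) : Prop :=
  ∀ ⦃n : ℕ⦄ (x : nilTuples q G n) (t t' : Simp n), mk x t ∈ B → (∀ i, 0 < t' i → 0 < t i) →
    mk x t' ∈ B

theorem faceClosed_labelsIn (C : Set G) : FaceClosed (labelsIn q C) :=
  fun _ _ _ _ h hs i j hij hi hj => h i j hij (hs i hi) (hs j hj)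

theorem FaceClosed.inter {B B' : Set (NilClassifying q G)} (h : FaceClosed B)
    (h' : FaceClosed B') : FaceClosed (B ∩ B') :=
  fun _ x t t' hB hs => ⟨h x t t' hB.1 hs, h' x t t' hB.2 hs⟩

/-- Points supported on the carrier of θ_* t lift through a section of θ with values in the support
of t. Invariance lets face closedness of `fil` be read off from a representative of low dimension,
where it is trivial. -/
theorem isInvariant_faces_mem (B : Set (NilClassifying q G)) :
    IsInvariant fun n (x : nilTuples q G n) t =>
      ∀ t' : Simp n, (∀ i, 0 < t' i → 0 < t i) → mk x t' ∈ B := by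
  classical
  intro m n θ x t
  constructor
  · intro h t' hs
    have hsec : ∀ k : Fin (n + 1), ∃ j, 0 < stdSimplex.map θ t k → θ j = k ∧ 0 < t j := fun k => by
      by_cases hk : 0 < stdSimplex.map θ t k
      · obtain ⟨j, hj⟩ := (Simp.map_pos_iff θ t k).1 hk
        exact ⟨j, fun _ => hj⟩
      · exact ⟨0, fun h => absurd h hk⟩
    choose sec hsec using hsec
    have e : stdSimplex.map θ (stdSimplex.map sec t') = t' := by
      rw [stdSimplex.map_comp_apply]
      ext k
      have := Simp.sum_map (θ ∘ sec) t' fun i => if i = k then 1 else 0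
      simp only [ite_mul, one_mul, zero_mul, Finset.sum_ite_eq', Finset.mem_univ, if_true] at this
      rw [this]
      calc _ = ∑ j, if j = k then t' j else 0 := by
            refine Finset.sum_congr rfl fun j _ => ?_
            by_cases hj : 0 < t' j
            · rw [Function.comp_apply, (hsec j (hs j hj)).1]
            · have : t' j = 0 := le_antisymm (not_lt.1 hj) (t'.2.1 j)
              simp [this]
        _ = t' k := by simp
    rw [← e, ← mk_glue]
    refine h _ fun j hj => ?_
    obtain ⟨k, rfl, hk⟩ := (Simp.map_pos_iff sec t' j).1 hj
    exact (hsec k (hs k hk)).2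
  · intro h t' hs
    rw [mk_glue]
    refine h _ fun k hk => ?_
    obtain ⟨j, rfl, hj⟩ := (Simp.map_pos_iff θ t' k).1 hk
    exact (Simp.map_pos_iff θ t _).2 ⟨j, rfl, hs j hj⟩

theorem faceClosed_fil (m : ℕ) : FaceClosed (fil q G m) := by
  intro n x t t' h hs
  obtain ⟨y, u, hu⟩ := h
  have h1 : mk y u ∈ ofInvariant _ (isInvariant_faces_mem (fil q G m)) :=
    fun t' _ => mk_mem_fil y t'
  rw [← hu] at h1
  exact h1 t' hs

theorem mix_support {n : ℕ} {t t' : Simp n} (hs : ∀ i, 0 < t' i → 0 < t i) (s : I)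
    (i : Fin (n + 1)) (hi : 0 < Simp.mix s t t' i) : 0 < t i := by
  by_contra h
  have h1 : t i = 0 := le_antisymm (not_lt.1 h) (t.2.1 i)
  have h2 : t' i = 0 := le_antisymm (not_lt.1 fun h' => h (hs i h')) (t'.2.1 i)
  simp [Simp.mix_apply, h1, h2] at hi

theorem vertex_support {n : ℕ} {t : Simp n} {i : Fin (n + 1)} (hi : 0 < t i) (j : Fin (n + 1))
    (hj : 0 < (stdSimplex.vertex i : Simp n) j) : 0 < t j := by
  rcases eq_or_ne j i with rfl | h
  · exact hi
  · simp [h] at hj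

theorem track_mem_of_faceClosed {B : Set (NilClassifying q G)} (hB : FaceClosed B) (φ : Reparam)
    (s : I) {z : NilClassifying q G} (hz : z ∈ B) : track φ s z ∈ B := by
  obtain ⟨n, x, t, rfl⟩ := exists_mk z
  exact hB x t _ hz fun i hi => mix_support (fun i hi => φ.warp_pos hi) s i hi

end FaceClosed

/-! ### Straight paths, and comparison of a short piece of path with an edge. -/

section Segments

variable {q : ℕ} {G : Type*} [Group G] [TopologicalSpace G]

theorem continuous_mk_left {n : ℕ} (x : nilTuples q G n) : Continuous fun t : Simp n => mk x t :=
  (continuous_mk q G n).comp (by fun_prop : Continuous fun t : Simp n => (x, t))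

/-- The straight path in a simplex of `B(q, G)`. -/
def segPath {A : Set (NilClassifying q G)} {n : ℕ} (x : nilTuples q G n) (t t' : Simp n) {a b : A}
    (ha : a.1 = mk x t) (hb : b.1 = mk x t') (h : ∀ s, mk x (Simp.mix s t t') ∈ A) :
    Path a b where
  toFun s := ⟨mk x (Simp.mix s t t'), h s⟩
  continuous_toFun := ((continuous_mk_left x).comp (Simp.continuous_mix.comp
    (by fun_prop : Continuous fun s : I => (s, t, t')))).subtype_mk _
  source' := Subtype.ext (by simp [ha])
  target' := Subtype.ext (by simp [hb])

/-- Two straight paths in a convex part of a simplex compose to a straight path. -/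
theorem pathClass_triangle {A : Set (NilClassifying q G)} {n : ℕ} (x : nilTuples q G n)
    {K : Set (Simp n)} (hK : ∀ s, ∀ u ∈ K, ∀ v ∈ K, Simp.mix s u v ∈ K) (hA : ∀ u ∈ K, mk x u ∈ A)
    {t₀ t₁ t₂ : Simp n} (h₀ : t₀ ∈ K) (h₁ : t₁ ∈ K) (h₂ : t₂ ∈ K) {a b c : A} (p : Path a b)
    (r : Path b c) (w : Path a c) (hp : ∀ s, (p s).1 = mk x (Simp.mix s t₀ t₁))
    (hr : ∀ s, (r s).1 = mk x (Simp.mix s t₁ t₂)) (hw : ∀ s, (w s).1 = mk x (Simp.mix s t₀ t₂)) :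
    pathClass p ≫ pathClass r = pathClass w := by
  let F : C(I × I, A) := ⟨fun u => ⟨mk x (Simp.mix u.2 (Simp.mix u.1 t₀ t₁) t₂),
      hA _ (hK _ _ (hK _ _ h₀ _ h₁) _ h₂)⟩, by
    have h1 : Continuous fun u : I × I => Simp.mix u.1 t₀ t₁ := Simp.continuous_mix.comp
      (by fun_prop : Continuous fun u : I × I => (u.1, t₀, t₁))
    have h2 : Continuous fun u : I × I => (u.2, Simp.mix u.1 t₀ t₁, t₂) := by fun_prop
    exact ((continuous_mk_left x).comp (Simp.continuous_mix.comp h2)).subtype_mk _⟩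
  have h := pathClass_square F p r w (Path.refl c) (fun s => Subtype.ext ?_)
    (fun s => Subtype.ext ?_) (fun s => Subtype.ext ?_) fun s => Subtype.ext ?_
  · rw [h, pathClass_refl, Category.comp_id]
  · simp [F, hp]
  · simp [F, hr]
  · simp [F, hw]
  · have := congrArg Subtype.val w.target
    rw [hw, Simp.mix_one] at this
    simpa [F] using this

/-- Closing up a short piece of a path along straight paths gives an edge loop, if pushing the
piece along a reparametrization closes up to a trivial loop. -/
theorem exists_edge_of_track {A : Set (NilClassifying q G)} {a b : A} (γ : Path a b) (o : A)
    (φ : Reparam) (t₀ t₁ : I) (κ₀ : Path (γ t₀) o) (hκ₀ : ∀ s, (κ₀ s).1 = track φ s (γ t₀).1)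
    (htr : ∀ s, ∀ r ∈ uIcc t₀ t₁, track φ s (γ r).1 ∈ A)
    {n : ℕ} {x : nilTuples q G n} {t : Simp n} (hz : (γ t₁).1 = mk x t) (i j : Fin (n + 1))
    (κ₁ : Path (γ t₁) o) (hκ₁ : ∀ s, (κ₁ s).1 = mk x (Simp.mix s t (stdSimplex.vertex i)))
    (K : Set (Simp n)) (hK : ∀ s, ∀ u ∈ K, ∀ v ∈ K, Simp.mix s u v ∈ K)
    (hA : ∀ u ∈ K, mk x u ∈ A) (ht : t ∈ K) (hφ : φ.warp t ∈ K) (hi : stdSimplex.vertex i ∈ K)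
    (hj : stdSimplex.vertex j ∈ K)
    (hnull : ∀ ω : Path o o, (∀ r, (∃ r' ∈ uIcc t₀ t₁, (ω r).1 = act φ (γ r').1) ∨
      ∃ s, (ω r).1 = mk x (Simp.mix s (φ.warp t) (stdSimplex.vertex j))) → pathClass ω = 𝟙 _) :
    ∃ e : Path o o,
      (∀ s, (e s).1 = mk x (Simp.mix s (stdSimplex.vertex j) (stdSimplex.vertex i))) ∧
      Groupoid.inv (pathClass κ₀) ≫ pathClass (γ.subpath t₀ t₁) ≫ pathClass κ₁ = pathClass e := by
  have ho : o.1 = pt q G := by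
    have := congrArg Subtype.val κ₁.target
    rw [hκ₁, Simp.mix_one, mk_vertex] at this
    exact this.symm
  have hsub : ∀ r, ∃ r' ∈ uIcc t₀ t₁, γ r' = γ.subpath t₀ t₁ r := fun r => by
    have : γ.subpath t₀ t₁ r ∈ range (γ.subpath t₀ t₁) := mem_range_self r
    rw [Path.range_subpath] at this
    exact this
  -- The square swept out by the piece under `track φ`: its left side is κ₀, its right side p, its
  -- bottom the image δ of the piece under `act φ`. Two straight triangles at t₁ then replace κ₁ by
  -- p, κ' and the edge e, leaving the loop δ · κ', which is trivial by assumption.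
  let F : C(I × I, A) := ⟨fun u => ⟨track φ u.2 (γ.subpath t₀ t₁ u.1).1, by
      obtain ⟨r', hr', h⟩ := hsub u.1
      rw [← h]
      exact htr _ _ hr'⟩, by
    have h1 : Continuous fun u : I × I => ((γ.subpath t₀ t₁ u.1).1, u.2) := by fun_prop
    exact ((continuous_track φ).comp h1).subtype_mk _⟩
  have h10 : F (1, 0) = γ t₁ := Subtype.ext (by simp [F, track_zero])
  have h01 : F (0, 1) = o := by
    rw [← κ₀.target]
    exact Subtype.ext (by rw [hκ₀]; simp [F])
  let p : Path (γ t₁) (F (1, 1)) := ⟨⟨fun s => F (1, s), by fun_prop⟩, h10, rfl⟩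
  let δ : Path o (F (1, 1)) := ⟨⟨fun r => F (r, 1), by fun_prop⟩, h01, rfl⟩
  have hsq := pathClass_square F (γ.subpath t₀ t₁) p κ₀ δ
    (fun r => Subtype.ext (by simp [F, track_zero])) (fun s => rfl)
    (fun s => Subtype.ext (by simp [F, hκ₀])) fun r => rfl
  have hF11 : (F (1, 1)).1 = mk x (φ.warp t) := by
    change track φ 1 (γ.subpath t₀ t₁ 1).1 = _
    rw [Path.target, track_one, hz, act_mk]
  let κ' : Path (F (1, 1)) o := segPath x (φ.warp t) (stdSimplex.vertex j) hF11
    (by rw [ho, mk_vertex]) fun s => hA _ (hK _ _ hφ _ hj)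
  let f : Path (γ t₁) o := segPath x t (stdSimplex.vertex j) hz
    (by rw [ho, mk_vertex]) fun s => hA _ (hK _ _ ht _ hj)
  let e : Path o o := segPath x (stdSimplex.vertex j) (stdSimplex.vertex i)
    (by rw [ho, mk_vertex]) (by rw [ho, mk_vertex]) fun s => hA _ (hK _ _ hj _ hi)
  refine ⟨e, fun s => rfl, ?_⟩
  have hδ : pathClass (δ.trans κ') = 𝟙 _ := by
    refine hnull _ fun r => ?_
    rw [Path.trans_apply]
    split_ifs with hr
    · left
      obtain ⟨r', hr', h⟩ := hsub ⟨2 * r, (mul_pos_mem_iff zero_lt_two).2 ⟨r.2.1, hr⟩⟩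
      refine ⟨r', hr', ?_⟩
      rw [h, ← track_one]
      rfl
    · exact Or.inr ⟨_, rfl⟩
  have h1 : pathClass p ≫ pathClass κ' = pathClass f :=
    pathClass_triangle x hK hA ht hφ hj p κ' f
      (fun s => by change track φ s (γ.subpath t₀ t₁ 1).1 = _; rw [Path.target, hz, track_mk])
      (fun s => rfl) fun s => rfl
  have h2 : pathClass f ≫ pathClass e = pathClass κ₁ :=
    pathClass_triangle x hK hA ht hj hi f e κ₁ (fun s => rfl) (fun s => rfl) hκ₁
  rw [pathClass_trans] at hδ
  rw [← h2, ← h1]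
  simp only [Category.assoc]
  rw [← Category.assoc (pathClass (γ.subpath t₀ t₁)), hsq]
  simp only [Category.assoc]
  rw [← Category.assoc (pathClass δ), hδ]
  simp

end Segments

end NilClassifying

/-! ### Gluing infinitely many null-homotopies -/

section Dyadic

/-- The `j`-th closed dyadic interval of length `2⁻ᵐ`. -/
def dyadic (m : ℕ) (j : ℤ) : Set ℝ := Icc (j * (2 ^ m)⁻¹) ((j + 1) * (2 ^ m)⁻¹)

/-- The triple of the dyadic interval avoids `T`. -/
def DyadicFar (T : Set ℝ) (m : ℕ) (j : ℤ) : Prop :=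
  ∀ t ∈ Icc ((j - 1) * (2 ^ m : ℝ)⁻¹) ((j + 2) * (2 ^ m)⁻¹), t ∉ T

/-- A dyadic interval that is maximal among those whose triple avoids `T`. -/
def DyadicMax (T : Set ℝ) (p : ℕ × ℤ) : Prop :=
  DyadicFar T p.1 p.2 ∧ ∀ m, m + 1 = p.1 → ¬ DyadicFar T m (p.2 / 2)

variable {T : Set ℝ}

theorem inv_two_pow_succ (m : ℕ) : ((2 : ℝ) ^ m)⁻¹ = 2 * (2 ^ (m + 1))⁻¹ := by
  rw [pow_succ]
  field_simp

theorem dyadicFar_half (m : ℕ) (j : ℤ) (h : DyadicFar T m (j / 2)) : DyadicFar T (m + 1) j := by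
  intro t ht
  have h0 : (0 : ℝ) < (2 ^ (m + 1))⁻¹ := by positivity
  have h1 : (2 * (j / 2 : ℤ) : ℝ) ≤ j := by exact_mod_cast (by omega : 2 * (j / 2) ≤ j)
  have h2 : (j : ℝ) ≤ 2 * (j / 2 : ℤ) + 1 := by
    exact_mod_cast (by omega : j ≤ 2 * (j / 2) + 1)
  refine h t ⟨?_, ?_⟩
  · rw [inv_two_pow_succ]
    nlinarith [ht.1]
  · rw [inv_two_pow_succ]
    nlinarith [ht.2]

theorem dyadicFar_pow (m d : ℕ) (j : ℤ) (h : DyadicFar T m (j / 2 ^ d)) :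
    DyadicFar T (m + d) j := by
  induction d generalizing j with
  | zero => simpa using h
  | succ d ih =>
    refine dyadicFar_half _ _ (ih _ ?_)
    rwa [Int.ediv_ediv_of_nonneg (by norm_num), ← pow_succ']

theorem mem_dyadic_floor (m : ℕ) (t : ℝ) : t ∈ dyadic m ⌊t * 2 ^ m⌋ := by
  have h0 : (0 : ℝ) < 2 ^ m := by positivity
  constructor
  · rw [← div_eq_mul_inv, div_le_iff₀ h0]
    exact Int.floor_le _
  · rw [← div_eq_mul_inv, le_div_iff₀ h0]
    exact (Int.lt_floor_add_one _).le

theorem floor_half (m : ℕ) (t : ℝ) : ⌊t * 2 ^ (m + 1)⌋ / 2 = ⌊t * 2 ^ m⌋ := by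
  rw [Int.ediv_eq_iff_of_pos (by norm_num)]
  have h1 := Int.floor_le (t * 2 ^ m)
  have h2 := Int.lt_floor_add_one (t * 2 ^ m)
  constructor
  · rw [Int.le_floor]
    push_cast
    rw [pow_succ]
    linarith
  · rw [Int.floor_lt]
    push_cast
    rw [pow_succ]
    linarith

theorem exists_inv_two_pow_lt {ε : ℝ} (hε : 0 < ε) : ∃ m : ℕ, ((2 : ℝ) ^ m)⁻¹ < ε := by
  obtain ⟨m, hm⟩ := exists_pow_lt_of_lt_one hε (by norm_num : (1 / 2 : ℝ) < 1)
  exact ⟨m, by simpa using hm⟩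

/-- Among the dyadic intervals around t singled out by the floor, take the coarsest whose triple
avoids T; its parent is the floor interval of the preceding level. The maximal intervals form a
Whitney decomposition of the complement of T. -/
theorem exists_dyadicMax (hT : IsClosed T) {t : ℝ} (ht : t ∉ T) :
    ∃ p, DyadicMax T p ∧ t ∈ dyadic p.1 p.2 := by
  classical
  have hex : ∃ m, DyadicFar T m ⌊t * 2 ^ m⌋ := by
    obtain ⟨ε, hε, hb⟩ := Metric.isOpen_iff.1 hT.isOpen_compl t ht
    obtain ⟨m, hm⟩ := exists_inv_two_pow_lt (half_pos hε)
    refine ⟨m, fun u hu => hb ?_⟩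
    have h := mem_dyadic_floor m t
    have h1 := h.1
    have h2 := h.2
    have h3 := hu.1
    have h4 := hu.2
    rw [Metric.mem_ball, Real.dist_eq, abs_lt]
    constructor <;> nlinarith
  refine ⟨(Nat.find hex, ⌊t * 2 ^ Nat.find hex⌋), ⟨Nat.find_spec hex, fun m hm => ?_⟩,
    mem_dyadic_floor _ _⟩
  have h := Nat.find_min hex (m := m) (by simp only at hm; omega)
  simp only at hm
  rwa [← hm, floor_half]

/-- Compare the coarser interval with the ancestor J of the finer one at the same level. If they
differ, the intervals meet only at endpoints; if they agree and the levels differ, the parent of the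
finer interval would inherit `DyadicFar`, against maximality. -/
theorem dyadicMax_eq_or (p p' : ℕ × ℤ) (hle : p.1 ≤ p'.1) (hp : DyadicMax T p)
    (hp' : DyadicMax T p') {t : ℝ} (ht : t ∈ dyadic p.1 p.2) (ht' : t ∈ dyadic p'.1 p'.2) :
    p = p' ∨ (t = p.2 * (2 ^ p.1)⁻¹ ∨ t = (p.2 + 1) * (2 ^ p.1)⁻¹) ∧
      (t = p'.2 * (2 ^ p'.1)⁻¹ ∨ t = (p'.2 + 1) * (2 ^ p'.1)⁻¹) := by
  obtain ⟨m, j⟩ := p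
  obtain ⟨m', j'⟩ := p'
  obtain ⟨d, rfl⟩ := Nat.exists_eq_add_of_le hle
  simp only at *
  set J := j' / 2 ^ d with hJ
  have h2d : (0 : ℤ) < 2 ^ d := by positivity
  have e1 : J * 2 ^ d ≤ j' := Int.ediv_mul_le _ h2d.ne'
  have e2 : j' + 1 ≤ (J + 1) * 2 ^ d := Int.lt_ediv_add_one_mul_self j' h2d
  have hh : ((2 : ℝ) ^ m)⁻¹ = 2 ^ d * (2 ^ (m + d))⁻¹ := by
    rw [pow_add]
    field_simp
  set h := ((2 : ℝ) ^ (m + d))⁻¹ with hh'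
  have h0 : 0 < h := by positivity
  have hm0 : (0 : ℝ) < ((2 : ℝ) ^ m)⁻¹ := by positivity
  have r1 : (J : ℝ) * (2 ^ m)⁻¹ ≤ j' * h := by
    rw [hh, ← mul_assoc]
    exact mul_le_mul_of_nonneg_right (by exact_mod_cast e1) h0.le
  have r2 : (j' + 1 : ℝ) * h ≤ (J + 1) * (2 ^ m)⁻¹ := by
    rw [hh, ← mul_assoc]
    exact mul_le_mul_of_nonneg_right (by exact_mod_cast e2) h0.le
  have a1 := ht.1
  have a2 := ht.2
  have b1 := ht'.1
  have b2 := ht'.2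
  rcases lt_trichotomy j J with hlt | heq | hgt
  · have : ((j + 1 : ℝ)) * (2 ^ m)⁻¹ ≤ J * (2 ^ m)⁻¹ :=
      mul_le_mul_of_nonneg_right (by exact_mod_cast hlt) hm0.le
    exact Or.inr ⟨Or.inr (by linarith), Or.inl (by linarith)⟩
  · rcases d with _ | d
    · left
      simp only [pow_zero, Int.ediv_one] at hJ
      rw [heq, hJ]
      rfl
    · refine absurd (dyadicFar_pow (T := T) m d (j' / 2) ?_) (hp'.2 (m + d) rfl)
      rw [Int.ediv_ediv_of_nonneg (by norm_num), ← pow_succ', ← hJ, ← heq]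
      exact hp.1
  · have : ((J + 1 : ℝ)) * (2 ^ m)⁻¹ ≤ j * (2 ^ m)⁻¹ :=
      mul_le_mul_of_nonneg_right (by exact_mod_cast hgt) hm0.le
    exact Or.inr ⟨Or.inl (by linarith), Or.inr (by linarith)⟩

/-- Near a point outside `T` there are only finitely many maximal intervals. -/
theorem finite_dyadicMax (hout : ∀ t, t ≤ 0 ∨ 1 ≤ t → t ∈ T) {t : ℝ} {d : ℝ} (hd : 0 < d)
    (hb : Metric.ball t d ⊆ Tᶜ) :
    {p | DyadicMax T p ∧ (dyadic p.1 p.2 ∩ Metric.ball t (d / 2)).Nonempty}.Finite := by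
  -- A parent's triple meets T, hence leaves the ball of radius d; this bounds the length of the
  -- maximal intervals meeting the half ball from below by d / 8.
  obtain ⟨M, hM⟩ := exists_inv_two_pow_lt (by positivity : 0 < d / 8)
  refine ((Set.finite_Iic M).prod (Set.finite_Icc (0 : ℤ) (2 ^ M))).subset ?_
  rintro ⟨m, j⟩ ⟨hp, u, hu, hut⟩
  simp only at hu
  have h0 : (0 : ℝ) < (2 ^ m)⁻¹ := by positivity
  have hm : m ≤ M := by
    rcases m with _ | m
    · exact Nat.zero_le _
    have hn := hp.2 m rfl
    simp only [DyadicFar, not_forall, not_not] at hn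
    obtain ⟨v, hv, hvT⟩ := hn
    have hv' : d ≤ dist v t := by
      by_contra h
      exact hb (Metric.mem_ball.2 (not_le.1 h)) hvT
    have h1 : (2 * (j / 2 : ℤ) : ℝ) ≤ j := by exact_mod_cast (by omega : 2 * (j / 2) ≤ j)
    have h2 : (j : ℝ) ≤ 2 * (j / 2 : ℤ) + 1 := by
      exact_mod_cast (by omega : j ≤ 2 * (j / 2) + 1)
    have huv : dist v u ≤ 4 * (2 ^ (m + 1))⁻¹ := by
      have h3 := hv.1
      have h4 := hv.2
      have h5 := hu.1
      have h6 := hu.2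
      simp only [inv_two_pow_succ m] at h3 h4
      rw [Real.dist_eq, abs_le]
      constructor <;> nlinarith
    have := dist_triangle v u t
    rw [Metric.mem_ball] at hut
    by_contra hlt
    have hle : ((2 : ℝ) ^ (m + 1))⁻¹ ≤ (2 ^ M)⁻¹ :=
      inv_anti₀ (by positivity) (pow_le_pow_right₀ (by norm_num) (not_le.1 hlt).le)
    linarith
  have hj : (j : ℝ) * (2 ^ m)⁻¹ ∉ T := hp.1 _ ⟨by nlinarith, by nlinarith⟩
  have hj0 : 0 < (j : ℝ) * (2 ^ m)⁻¹ := by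
    by_contra h
    exact hj (hout _ (Or.inl (not_lt.1 h)))
  have hj1 : (j : ℝ) * (2 ^ m)⁻¹ < 1 := by
    by_contra h
    exact hj (hout _ (Or.inr (not_lt.1 h)))
  have hj0' : (0 : ℝ) < j := pos_of_mul_pos_left hj0 h0.le
  have hj1' : (j : ℝ) < 2 ^ m := by
    rwa [← div_eq_mul_inv, div_lt_one (by positivity)] at hj1
  have hpow : (2 : ℤ) ^ m ≤ 2 ^ M := pow_le_pow_right₀ (by norm_num) hm
  have hj1'' : j < 2 ^ m := by exact_mod_cast hj1'
  exact ⟨hm, by exact_mod_cast hj0'.le, by omega⟩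

end Dyadic

/-- A loop is null-homotopic if its pieces off the base point have fillers with compatible sides
that become small where the pieces are small. -/
theorem exists_nullHomotopy_of_fillers {X : Type*} [TopologicalSpace X] {o : X}
    (ho : IsClosed {o}) {A W : ℕ → Set X} (hA : Antitone A) (hoA : ∀ k, o ∈ A k)
    (hbasis : ∀ U : Set X, IsOpen U → o ∈ U → ∃ k, A k ⊆ U) (hW : Antitone W)
    (hsep : ∀ z, z ≠ o → ∃ k, z ∉ W k)
    {γ : ℝ → X} (hγ : Continuous γ) (hout : ∀ t, t ≤ 0 ∨ 1 ≤ t → γ t = o) {k₀ : ℕ}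
    (hγW : ∀ t, γ t ∈ W k₀) (hnear : ∀ k t, γ t = o → ∀ᶠ u in 𝓝 t, γ u ∈ W k) (κ : X → I → X)
    (hfill : ∀ k, k₀ ≤ k → ∀ a b : ℝ, a < b → (∀ t ∈ Icc a b, γ t ∈ W k ∧ γ t ≠ o) →
      ∃ F : ℝ × I → X, Continuous F ∧
        (∀ t ∈ Icc a b, (∀ s, F (t, s) ∈ A k) ∧ F (t, 0) = γ t ∧ F (t, 1) = o) ∧
        (∀ s, F (a, s) = κ (γ a) s) ∧ ∀ s, F (b, s) = κ (γ b) s) :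
    ∃ H : ℝ × I → X, Continuous H ∧ (∀ p, H p ∈ A k₀) ∧
      ∀ t, H (t, 0) = γ t ∧ H (t, 1) = o ∧ (γ t = o → ∀ s, H (t, s) = o) := by
  classical
  set T : Set ℝ := γ ⁻¹' {o} with hTdef
  have hT : IsClosed T := ho.preimage hγ
  -- On each Whitney interval use the deepest level that contains the piece of γ; it exists because
  -- the piece avoids o and is therefore not in every W k.
  have hlev : ∀ p : ℕ × ℤ, DyadicMax T p → ∃ k, k₀ ≤ k ∧ (∀ t ∈ dyadic p.1 p.2, γ t ∈ W k) ∧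
      ∀ l, (∀ t ∈ dyadic p.1 p.2, γ t ∈ W l) → l ≤ k := by
    intro p hp
    have h0 : (0 : ℝ) < (2 ^ p.1)⁻¹ := by positivity
    have hmem : (p.2 : ℝ) * (2 ^ p.1)⁻¹ ∈ dyadic p.1 p.2 := ⟨le_rfl, by nlinarith⟩
    have hne : γ ((p.2 : ℝ) * (2 ^ p.1)⁻¹) ≠ o := hp.1 _ ⟨by nlinarith, by nlinarith⟩
    obtain ⟨b, hb⟩ := hsep _ hne
    have hbd : ∀ l, (∀ t ∈ dyadic p.1 p.2, γ t ∈ W l) → l ≤ b := fun l hl => by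
      by_contra h
      exact hb (hW (not_le.1 h).le (hl _ hmem))
    let P : ℕ → Prop := fun l => ∀ t ∈ dyadic p.1 p.2, γ t ∈ W l
    have hP : P k₀ := fun t _ => hγW t
    exact ⟨Nat.findGreatest P b, Nat.le_findGreatest (hbd _ hP) hP,
      Nat.findGreatest_spec (hbd _ hP) hP, fun l hl => Nat.le_findGreatest (hbd l hl) hl⟩
  choose! lev hlev0 hlev1 hlev2 using hlev
  have hF : ∀ p : ℕ × ℤ, DyadicMax T p → ∃ F : ℝ × I → X, Continuous F ∧
        (∀ t ∈ dyadic p.1 p.2, (∀ s, F (t, s) ∈ A (lev p)) ∧ F (t, 0) = γ t ∧ F (t, 1) = o) ∧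
        (∀ s, F (p.2 * (2 ^ p.1)⁻¹, s) = κ (γ (p.2 * (2 ^ p.1)⁻¹)) s) ∧
        ∀ s, F ((p.2 + 1) * (2 ^ p.1)⁻¹, s) = κ (γ ((p.2 + 1) * (2 ^ p.1)⁻¹)) s := by
    intro p hp
    have h0 : (0 : ℝ) < (2 ^ p.1)⁻¹ := by positivity
    refine hfill _ (hlev0 p hp) _ _ (by nlinarith) fun t ht => ⟨hlev1 p hp t ht, ?_⟩
    exact hp.1 t ⟨by nlinarith [ht.1], by nlinarith [ht.2]⟩
  have : Nonempty X := ⟨o⟩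
  choose! F hFc hFA hFl hFr using hF
  have hagree1 : ∀ p p' : ℕ × ℤ, p.1 ≤ p'.1 → DyadicMax T p → DyadicMax T p' → ∀ t,
      t ∈ dyadic p.1 p.2 → t ∈ dyadic p'.1 p'.2 → ∀ s, F p (t, s) = F p' (t, s) := by
    intro p p' hle hp hp' t ht ht' s
    have hend : ∀ p, DyadicMax T p → (t = p.2 * (2 ^ p.1)⁻¹ ∨ t = (p.2 + 1) * (2 ^ p.1)⁻¹) →
        F p (t, s) = κ (γ t) s := by
      rintro p hp (rfl | rfl)
      · exact hFl p hp s
      · exact hFr p hp s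
    rcases dyadicMax_eq_or p p' hle hp hp' ht ht' with rfl | ⟨h1, h2⟩
    · rfl
    · rw [hend p hp h1, hend p' hp' h2]
  have hagree : ∀ p p' : ℕ × ℤ, DyadicMax T p → DyadicMax T p' → ∀ t,
      t ∈ dyadic p.1 p.2 → t ∈ dyadic p'.1 p'.2 → ∀ s, F p (t, s) = F p' (t, s) := by
    intro p p' hp hp' t ht ht' s
    rcases le_total p.1 p'.1 with h | h
    · exact hagree1 p p' h hp hp' t ht ht' s
    · exact (hagree1 p' p h hp' hp t ht' ht s).symm
  have hsel : ∀ t, t ∉ T → ∃ p, DyadicMax T p ∧ t ∈ dyadic p.1 p.2 :=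
    fun t ht => exists_dyadicMax hT ht
  choose! sel hselM hselm using hsel
  let H : ℝ × I → X := fun u => if u.1 ∈ T then o else F (sel u.1) u
  have hHT : ∀ t s, t ∈ T → H (t, s) = o := fun t s ht => if_pos ht
  have hHF : ∀ t s p, DyadicMax T p → t ∈ dyadic p.1 p.2 → H (t, s) = F p (t, s) := by
    intro t s p hp ht
    have h0 : (0 : ℝ) < (2 ^ p.1)⁻¹ := by positivity
    have htT : t ∉ T := hp.1 t ⟨by nlinarith [ht.1], by nlinarith [ht.2]⟩
    change (if t ∈ T then o else F (sel t) (t, s)) = _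
    rw [if_neg htT]
    exact hagree _ _ (hselM t htT) hp t (hselm t htT) ht s
  refine ⟨H, continuous_iff_continuousAt.2 ?_, ?_, fun t => ⟨?_, ?_, fun ht s => hHT t s ht⟩⟩
  · rintro ⟨t, s⟩
    by_cases ht : t ∈ T
    · change Filter.Tendsto H _ _
      rw [hHT t s ht, (nhds_basis_opens o).tendsto_right_iff]
      rintro U ⟨hoU, hU⟩
      obtain ⟨k, hk⟩ := hbasis U hU hoU
      obtain ⟨ε, hε, hb⟩ := Metric.eventually_nhds_iff.1 (hnear k t ht)
      have hnhd : ∀ᶠ u : ℝ × I in 𝓝 (t, s), dist u.1 t < ε / 3 :=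
        (continuous_fst.tendsto (t, s)).eventually (Metric.ball_mem_nhds t (by positivity))
      filter_upwards [hnhd]
      rintro ⟨u, r⟩ hu
      by_cases huT : u ∈ T
      · rw [hHT u r huT]
        exact hoU
      have hM := hselM u huT
      have hm := hselm u huT
      rw [hHF u r _ hM hm]
      refine hk (hA ?_ ((hFA _ hM u hm).1 r))
      -- The triple of the Whitney interval of u avoids t, so its length is at most the distance
      -- from u to t; the whole interval thus lies within ε of t, and the level of its filler is at
      -- least k.
      refine hlev2 _ hM k fun v hv => hb ?_
      have h0 : (0 : ℝ) < (2 ^ (sel u).1)⁻¹ := by positivity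
      have hfar : ¬ t ∈ Icc (((sel u).2 - 1 : ℝ) * (2 ^ (sel u).1)⁻¹)
        (((sel u).2 + 2 : ℝ) * (2 ^ (sel u).1)⁻¹) := fun h => hM.1 t h ht
      have h1 := hv.1
      have h2 := hv.2
      have h3 := hm.1
      have h4 := hm.2
      simp only [Real.dist_eq, abs_lt] at hu ⊢
      simp only [mem_Icc, not_and_or, not_le] at hfar
      rcases hfar with h5 | h5 <;> constructor <;> nlinarith
    · obtain ⟨d, hd, hb⟩ := Metric.isOpen_iff.1 hT.isOpen_compl t ht
      have hfin := finite_dyadicMax (T := T) hout hd hb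
      change Filter.Tendsto H _ _
      rw [(nhds_basis_opens _).tendsto_right_iff]
      rintro U ⟨hoU, hU⟩
      have hev : ∀ p ∈ {p | DyadicMax T p ∧ (dyadic p.1 p.2 ∩ Metric.ball t (d / 2)).Nonempty},
          ∀ᶠ u : ℝ × I in 𝓝 (t, s), u.1 ∈ dyadic p.1 p.2 → F p u ∈ U := by
        rintro p ⟨hp, -⟩
        by_cases htp : t ∈ dyadic p.1 p.2
        · rw [hHF t s p hp htp] at hoU
          filter_upwards [(hFc p hp).continuousAt.preimage_mem_nhds (hU.mem_nhds hoU)] with u hu _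
          exact hu
        · have : ∀ᶠ u : ℝ × I in 𝓝 (t, s), u.1 ∈ (dyadic p.1 p.2)ᶜ :=
            (continuous_fst.tendsto (t, s)).eventually (isClosed_Icc.isOpen_compl.mem_nhds htp)
          filter_upwards [this] with u hu h
          exact absurd h hu
      have hnhd : ∀ᶠ u : ℝ × I in 𝓝 (t, s), u.1 ∈ Metric.ball t (d / 2) :=
        (continuous_fst.tendsto (t, s)).eventually (Metric.ball_mem_nhds t (by positivity))
      filter_upwards [(Filter.eventually_all_finite hfin).2 hev, hnhd]
      rintro ⟨u, r⟩ hu hut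
      have huT : u ∉ T := hb (Metric.ball_subset_ball (by linarith) hut)
      rw [hHF u r _ (hselM u huT) (hselm u huT)]
      exact hu _ ⟨hselM u huT, u, hselm u huT, hut⟩ (hselm u huT)
  · rintro ⟨t, s⟩
    by_cases ht : t ∈ T
    · rw [hHT t s ht]
      exact hoA _
    · rw [hHF t s _ (hselM t ht) (hselm t ht)]
      exact hA (hlev0 _ (hselM t ht)) ((hFA _ (hselM t ht) t (hselm t ht)).1 s)
  · by_cases ht : t ∈ T
    · rw [hHT t 0 ht]
      exact ht.symm
    · rw [hHF t 0 _ (hselM t ht) (hselm t ht)]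
      exact (hFA _ (hselM t ht) t (hselm t ht)).2.1
  · by_cases ht : t ∈ T
    · exact hHT t 1 ht
    · rw [hHF t 1 _ (hselM t ht) (hselm t ht)]
      exact (hFA _ (hselM t ht) t (hselm t ht)).2.2

/-! ### Small neighbourhoods of the vertex in the bounded part. -/

namespace NilClassifying

section SmallSets

variable {q : ℕ} {G : Type*} [Group G]

theorem mem_nilTuples_of_commute (hq : 2 ≤ q) {n : ℕ} {g : Fin n → G}
    (h : ∀ i j, Commute (g i) (g j)) : g ∈ nilTuples q G n := by
  have h1 : ∀ i (w : FreeGroup (Fin n)), Commute (g i) (FreeGroup.lift g w) := fun i w => by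
    induction w using FreeGroup.induction_on with
    | C1 => simp
    | of j => simpa using h i j
    | inv_of j hj => simpa using h i j
    | mul x y hx hy => simpa using hx.mul_right hy
  have h2 : ∀ w w' : FreeGroup (Fin n), Commute (FreeGroup.lift g w) (FreeGroup.lift g w') :=
    fun w w' => by
      induction w using FreeGroup.induction_on with
      | C1 => simp
      | of j => simpa using h1 j w'
      | inv_of j hj => simpa using (h1 j w').inv_left
      | mul x y hx hy => simpa using hx.mul_left hy
  refine ((⊤ : Subgroup (FreeGroup (Fin n))).lowerCentralSeries_antitone
    (by omega : 1 ≤ q - 1)).trans ?_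
  rw [Subgroup.lowerCentralSeries_succ, Subgroup.commutator_le]
  intro w _ w' _
  rw [MonoidHom.mem_ker, map_commutatorElement, commutatorElement_eq_one_iff_commute]
  exact h2 w w'

theorem mass_add_le {n : ℕ} (x : nilTuples q G n) (t : Simp n) {g : G} {V : Set G}
    {i : Fin (n + 1)} (hi : g⁻¹ * vert x i ∉ V) : mass x t g V + t i ≤ 1 := by
  classical
  have h : t i = ∑ j, if j = i then t j else 0 := by simp
  rw [← stdSimplex.sum_eq_one t, mass, h, ← Finset.sum_add_distrib]
  refine Finset.sum_le_sum fun j _ => ?_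
  split_ifs with hj
  · rw [hj, indicator_of_notMem hi, zero_mul, zero_add]
  · rw [add_zero]
    exact mul_le_of_le_one_left (t.2.1 j) (indicator_one_le _ _)

variable [TopologicalSpace G]

/-- The mass that has to lie in a translate of the `k`-th neighbourhood of a scale. -/
noncomputable def threshold (k : ℕ) : ℝ := 1 - 1 / (k + 3)

theorem threshold_lt_one (k : ℕ) : threshold k < 1 := by
  have : (0 : ℝ) < 1 / (k + 3) := by positivity
  rw [threshold]
  linarith

theorem half_lt_threshold (k : ℕ) : 1 / 2 < threshold k := by
  have : (1 : ℝ) / (k + 3) < 1 / 2 := one_div_lt_one_div_of_lt (by norm_num) (by linarith)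
  rw [threshold]
  linarith

theorem threshold_mono : Monotone threshold := fun k l h => by
  have : (1 : ℝ) / (l + 3) ≤ 1 / (k + 3) :=
    one_div_le_one_div_of_le (by positivity) (by exact_mod_cast Nat.add_le_add_right h 3)
  rw [threshold, threshold]
  linarith

/-- The points of `B(q, G)` most of whose mass lies in a translate of the `k`-th neighbourhood. -/
def small (q : ℕ) (S : Scale G) (k : ℕ) : Set (NilClassifying q G) :=
  conc q Reparam.id Reparam.id (S.V k) (S.V k) (threshold k)

theorem mk_mem_small {S : Scale G} {k : ℕ} {n : ℕ} {x : nilTuples q G n} {t : Simp n} :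
    mk x t ∈ small q S k ↔ ∃ g, threshold k < mass x t g (S.V k) := by
  rw [small, mem_conc_id]
  simp

theorem small_antitone (S : Scale G) : Antitone (small q S) := by
  intro k l h z hz
  obtain ⟨n, x, t, rfl⟩ := exists_mk z
  obtain ⟨g, hg⟩ := mk_mem_small.1 hz
  exact mk_mem_small.2 ⟨g, (threshold_mono h).trans_lt
    (hg.trans_le (mass_mono x t g fun i hi => S.antitone h hi))⟩

theorem pt_mem_small (S : Scale G) (k : ℕ) : pt q G ∈ small q S k :=
  pt_mem_conc (S.one_mem_V k) (S.one_mem_V k) (threshold_lt_one k)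

variable [IsTopologicalGroup G]

theorem isOpen_small (S : Scale G) (k : ℕ) : IsOpen (small q S k) :=
  isOpen_conc (S.isOpen k) (S.isOpen k) _ _ _

theorem isClosed_nilTuples [T1Space G] (q n : ℕ) : IsClosed (nilTuples q G n) := by
  have hc : ∀ w : FreeGroup (Fin n), Continuous fun g : Fin n → G => FreeGroup.lift g w := by
    intro w
    induction w using FreeGroup.induction_on with
    | C1 => simpa using continuous_const
    | of j => simpa using continuous_apply j
    | inv_of j hj =>
      simp only [map_inv, FreeGroup.lift_apply_of]
      exact (continuous_apply j).inv
    | mul x y hx hy =>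
      simp only [map_mul]
      exact hx.mul hy
  have : nilTuples q G n = ⋂ w ∈ (⊤ : Subgroup (FreeGroup (Fin n))).lowerCentralSeries (q - 1),
      (fun g : Fin n → G => FreeGroup.lift g w) ⁻¹' {1} := by
    ext g
    simp only [mem_iInter]
    rfl
  rw [this]
  exact isClosed_biInter fun w _ => isClosed_singleton.preimage (hc w)

/-- If every level had a counterexample, they would cluster at some point by compactness of the set
of tuples with entries in C. A cluster point in U is impossible, and one outside U has a nontrivial
label between vertices of positive weight, whereas the nearby counterexamples have labels tending to
1. -/
theorem exists_small_subset_aux [T2Space G] (S : Scale G) (n : ℕ) {U : Set (NilClassifying q G)}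
    (hU : IsOpen U) (hpt : pt q G ∈ U) :
    ∃ k, ∀ (x : nilTuples q G n) (t : Simp n), (∀ i j, i ≤ j → (vert x i)⁻¹ * vert x j ∈ S.C) →
      mk x t ∈ small q S k → mk x t ∈ U := by
  by_contra hn
  push Not at hn
  choose x t hxC hs hxU using hn
  have hcomp : IsCompact {p : nilTuples q G n × Simp n | ∀ j, p.1.1 j ∈ S.C} := by
    have h1 : IsCompact {y : nilTuples q G n | ∀ j, y.1 j ∈ S.C} := by
      have := (isClosed_nilTuples (G := G) q n).isClosedEmbedding_subtypeVal.isCompact_preimage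
        (isCompact_univ_pi fun _ : Fin n => S.isCompact)
      convert this using 1
      ext y
      simp
    convert h1.prod (isCompact_univ (X := Simp n)) using 1
    ext p
    simp
  obtain ⟨⟨y, u⟩, -, hy⟩ := hcomp.exists_mapClusterPt (f := Filter.atTop)
    (u := fun k => (x k, t k)) (by
      rw [Filter.le_principal_iff, Filter.mem_map]
      refine Filter.univ_mem' fun k j => ?_
      have := hxC k j.castSucc j.succ (Fin.castSucc_lt_succ).le
      rwa [vert_succ] at this)
  by_cases hyU : mk y u ∈ U
  · obtain ⟨k, hk⟩ := (hy.frequently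
      ((isOpen_iff.1 hU n).mem_nhds (show (y, u) ∈ {p | _} from hyU))).exists
    exact hxU k hk
  have hne : mk y u ≠ pt q G := fun h => hyU (h ▸ hpt)
  have hij : ∃ i j, i ≤ j ∧ 0 < u i ∧ 0 < u j ∧ vert y i ≠ vert y j := by
    by_contra hall
    push Not at hall
    refine hne (eq_pt_iff.2 fun i j hi hj => ?_)
    rcases le_total i j with h | h
    · exact hall i j h hi hj
    · exact (hall j i h hj hi).symm
  obtain ⟨i, j, hle, hi, hj, hv⟩ := hij
  have h1 : (1 : G) ≠ (vert y i)⁻¹ * vert y j := fun h => hv (inv_mul_eq_one.1 h.symm)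
  obtain ⟨U₁, W, hU₁, hW, h1U, hhW, hdisj⟩ := t2_separation h1
  obtain ⟨l, hl⟩ := S.basis U₁ (hU₁.mem_nhds h1U)
  obtain ⟨N, hN⟩ := exists_nat_one_div_lt (show 0 < min (u i) (u j) from lt_min hi hj)
  have hopen : IsOpen {p : nilTuples q G n × Simp n | 1 / ((N : ℝ) + 1) < p.2 i ∧
      1 / ((N : ℝ) + 1) < p.2 j ∧ (vert p.1 i)⁻¹ * vert p.1 j ∈ W} := by
    refine (isOpen_lt continuous_const ((Simp.continuous_coord i).comp continuous_snd)).inter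
      ((isOpen_lt continuous_const ((Simp.continuous_coord j).comp continuous_snd)).inter
        (hW.preimage ?_))
    exact ((continuous_vert i).comp continuous_fst).inv.mul
      ((continuous_vert j).comp continuous_fst)
  have hfreq := hy.frequently (hopen.mem_nhds (show (y, u) ∈ {p | _} from
    ⟨hN.trans_le (min_le_left _ _), hN.trans_le (min_le_right _ _), hhW⟩))
  obtain ⟨k, hk, hki, hkj, hkW⟩ := Filter.frequently_atTop.1 hfreq (max (l + 1) N)
  simp only at hki hkj hkW
  obtain ⟨g, hg⟩ := mk_mem_small.1 (hs k)
  have hkN : (1 : ℝ) / (k + 3) < 1 / (N + 1) := by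
    refine one_div_lt_one_div_of_lt (by positivity) ?_
    have : (N : ℝ) ≤ k := by exact_mod_cast (le_max_right _ _).trans hk
    linarith
  -- For k ≥ N the mass outside the translate is below 1/(k + 3), so no vertex of weight above 1/(N
  -- + 1) can lie outside it.
  have hmem : ∀ r, 1 / ((N : ℝ) + 1) < t k r → g⁻¹ * vert (x k) r ∈ S.V (l + 1) := fun r hr => by
    by_contra h
    have := mass_add_le (x k) (t k) (g := g) (V := S.V k) (i := r)
      fun h' => h (S.antitone ((le_max_left _ _).trans hk) h')
    rw [threshold] at hg
    linarith
  have h2 := S.mul_mem l 1 (S.one_mem_V _) _ (hmem i hki) _ (hmem j hkj)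
  have h3 : (vert (x k) i)⁻¹ * vert (x k) j ∈ S.V l := by
    convert h2 using 1
    group
  exact disjoint_left.1 hdisj (hl ⟨h3, hxC k i j hle⟩) hkW

theorem exists_small_subset [T2Space G] (S : Scale G) (N : ℕ) {U : Set (NilClassifying q G)}
    (hU : IsOpen U) (hpt : pt q G ∈ U) :
    ∃ k, fil q G N ∩ labelsIn q S.C ∩ small q S k ⊆ U := by
  choose k hk using fun n => exists_small_subset_aux S n hU hpt
  refine ⟨(Finset.range (N + 1)).sup k, ?_⟩
  rintro z ⟨⟨hz, hzC⟩, hzs⟩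
  obtain ⟨m, x, t, hm, ht, rfl⟩ := mem_fil_iff.1 hz
  exact hk m x t (fun i j hij => hzC i j hij (ht i) (ht j)) (small_antitone S
    (Finset.le_sup (f := k) (Finset.mem_range.2 (by omega))) hzs)

theorem exists_notMem_small [T2Space G] (S : Scale G) (N : ℕ) {z : NilClassifying q G}
    (hz : z ∈ fil q G N ∩ labelsIn q S.C) (hne : z ≠ pt q G) : ∃ k, z ∉ small q S k := by
  obtain ⟨U, hU, hpt, hzU⟩ := exists_isOpen_pt_notMem hne
  obtain ⟨k, hk⟩ := exists_small_subset S N hU hpt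
  exact ⟨k, fun h => hzU (hk ⟨hz, h⟩)⟩

end SmallSets

end NilClassifying

/-! ### Edge loops and the relations between them. -/

namespace NilClassifying

section Edges

variable {q : ℕ} {G : Type*} [Group G]

/-- The `1`-simplex of `B(q, G)` labelled by `g`. -/
def edge (hq : 2 ≤ q) (g : G) : nilTuples q G 1 :=
  ⟨fun _ => g, mem_nilTuples_of_commute hq fun _ _ => Commute.refl g⟩

/-- The points of the `1`-simplex labelled by `g`. -/
def edgePoint (hq : 2 ≤ q) (g : G) (s : I) : NilClassifying q G :=
  mk (edge hq g) (Simp.mix s (stdSimplex.vertex 0) (stdSimplex.vertex 1))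

theorem edgePoint_zero (hq : 2 ≤ q) (g : G) : edgePoint hq g 0 = pt q G := by
  rw [edgePoint, Simp.mix_zero, mk_vertex]

theorem edgePoint_one (hq : 2 ≤ q) (g : G) : edgePoint hq g 1 = pt q G := by
  rw [edgePoint, Simp.mix_one, mk_vertex]

theorem edgePoint_label_one (hq : 2 ≤ q) (s : I) : edgePoint hq (1 : G) s = pt q G :=
  mk_oneTuple _

theorem vert_edge_zero (hq : 2 ≤ q) (g : G) : vert (edge hq g) 0 = 1 := by
  simp [vert]

theorem vert_edge_one (hq : 2 ≤ q) (g : G) : vert (edge hq g) 1 = g := by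
  have := vert_succ (edge hq g) 0
  change (vert (edge hq g) 0)⁻¹ * vert (edge hq g) 1 = g at this
  rwa [vert_edge_zero, inv_one, one_mul] at this

theorem edgePoint_mem_labelsIn (hq : 2 ≤ q) {C : Set G} (h1 : 1 ∈ C) {g : G} (hg : g ∈ C) (s : I) :
    edgePoint hq g s ∈ labelsIn q C := by
  intro i j hij _ _
  have h0 := vert_edge_zero hq g
  have h2 := vert_edge_one hq g
  fin_cases i <;> fin_cases j <;> simp_all

/-- Glue along the map [1] → [n] with values i and j; the case i = j is included and gives the label
1. -/
theorem mk_mix_vertex_eq_edgePoint (hq : 2 ≤ q) {n : ℕ} (x : nilTuples q G n) {i j : Fin (n + 1)}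
    (hij : i ≤ j) (s : I) : mk x (Simp.mix s (stdSimplex.vertex i) (stdSimplex.vertex j)) =
      edgePoint hq ((vert x i)⁻¹ * vert x j) s := by
  let θ : Fin (1 + 1) →o Fin (n + 1) := ⟨![i, j], by
    intro a b hab
    fin_cases a <;> fin_cases b <;> simp_all⟩
  have h1 : nilMap θ x = edge hq ((vert x i)⁻¹ * vert x j) := by
    refine Subtype.ext (funext fun k => ?_)
    have := vert_succ (nilMap θ x) k
    rw [← this, vert_nilMap, vert_nilMap]
    fin_cases k
    change ((vert x i)⁻¹ * vert x i)⁻¹ * ((vert x i)⁻¹ * vert x j) = (vert x i)⁻¹ * vert x j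
    group
  rw [edgePoint, ← h1, mk_glue, Simp.map_mix, stdSimplex.map_vertex, stdSimplex.map_vertex]
  rfl

theorem mix_symm {n : ℕ} (s : I) (t t' : Simp n) : Simp.mix (σ s) t t' = Simp.mix s t' t := by
  ext i
  simp only [Simp.mix_apply, coe_symm_eq]
  ring

variable [TopologicalSpace G]

theorem edgePoint_mem_small (hq : 2 ≤ q) (S : Scale G) {k : ℕ} {g : G} (hg : g ∈ S.V k) (s : I) :
    edgePoint hq g s ∈ small q S k := by
  refine mk_mem_small.2 ⟨1, ?_⟩
  rw [mass_eq_one]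
  · exact threshold_lt_one k
  · intro i _
    have h0 := vert_edge_zero hq g
    have h2 := vert_edge_one hq g
    have h3 := S.one_mem_V k
    fin_cases i <;> simp_all

theorem continuous_edgePoint (hq : 2 ≤ q) :
    Continuous fun p : G × I => edgePoint hq p.1 p.2 := by
  have h1 : Continuous fun p : G × I => edge hq p.1 :=
    Continuous.subtype_mk (continuous_pi fun _ => continuous_fst) _
  have h2 : Continuous fun p : G × I => (Simp.mix p.2 (stdSimplex.vertex 0) (stdSimplex.vertex 1) :
      Simp 1) := Simp.continuous_mix.comp (by fun_prop : Continuous fun p : G × I =>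
        (p.2, (stdSimplex.vertex 0 : Simp 1), (stdSimplex.vertex 1 : Simp 1)))
  exact (continuous_mk q G 1).comp (h1.prodMk h2)

/-- Edge loops with joined labels are homotopic. -/
theorem pathClass_edge_eq_of_joinedIn (hq : 2 ≤ q) {A : Set (NilClassifying q G)} {D : Set G}
    {g h : G} (hj : JoinedIn D g h) (hD : ∀ a ∈ D, ∀ s, edgePoint hq a s ∈ A) {o : A}
    (p r : Path o o) (hp : ∀ s, (p s).1 = edgePoint hq g s)
    (hr : ∀ s, (r s).1 = edgePoint hq h s) : pathClass p = pathClass r := by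
  obtain ⟨γ, hγ⟩ := hj
  have ho : o.1 = pt q G := by
    have := congrArg Subtype.val p.source
    rw [hp, edgePoint_zero] at this
    exact this.symm
  let F : C(I × I, A) := ⟨fun u => ⟨edgePoint hq (γ u.2) u.1, hD _ (hγ _) _⟩, by
    have h1 : Continuous fun u : I × I => (γ u.2, u.1) := by fun_prop
    exact ((continuous_edgePoint hq).comp h1).subtype_mk _⟩
  have := pathClass_square F p (Path.refl o) (Path.refl o) r
    (fun s => Subtype.ext (by simp [F, hp])) (fun s => Subtype.ext (by simp [F, edgePoint_one, ho]))
    (fun s => Subtype.ext (by simp [F, edgePoint_zero, ho])) fun s => Subtype.ext (by simp [F, hr])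
  simpa [pathClass_refl] using this

theorem pathClass_edge_one (hq : 2 ≤ q) {A : Set (NilClassifying q G)} {o : A}
    (p : Path o o) (hp : ∀ s, (p s).1 = edgePoint hq 1 s) : pathClass p = 𝟙 _ := by
  rw [← pathClass_refl]
  congr 1
  ext s
  rw [hp, edgePoint_label_one, Path.refl_apply, ← p.source, hp, edgePoint_zero]

/-- Edge loops with small labels are null-homotopic. -/
theorem exists_pathClass_segment_eq_one (hq : 2 ≤ q) (S : Scale G) (k : ℕ) :
    ∃ l, ∀ {A : Set (NilClassifying q G)}, fil q G 1 ∩ labelsIn q S.C ∩ small q S k ⊆ A →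
      ∀ {n : ℕ} (x : nilTuples q G n) (i j : Fin (n + 1)) (g : G), g⁻¹ * vert x i ∈ S.V l →
      g⁻¹ * vert x j ∈ S.V l → (∀ s, mk x (Simp.mix s (stdSimplex.vertex i)
        (stdSimplex.vertex j)) ∈ labelsIn q S.C) → ∀ {o : A} (p : Path o o),
      (∀ s, (p s).1 = mk x (Simp.mix s (stdSimplex.vertex i) (stdSimplex.vertex j))) →
      pathClass p = 𝟙 _ := by
  obtain ⟨l, hl⟩ := S.joined k
  have key : ∀ {A : Set (NilClassifying q G)}, fil q G 1 ∩ labelsIn q S.C ∩ small q S k ⊆ A →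
      ∀ {n : ℕ} (x : nilTuples q G n) (i j : Fin (n + 1)) (g : G), i ≤ j →
      g⁻¹ * vert x i ∈ S.V (l + 1) →
      g⁻¹ * vert x j ∈ S.V (l + 1) → (∀ s, mk x (Simp.mix s (stdSimplex.vertex i)
        (stdSimplex.vertex j)) ∈ labelsIn q S.C) → ∀ {o : A} (p : Path o o),
      (∀ s, (p s).1 = mk x (Simp.mix s (stdSimplex.vertex i) (stdSimplex.vertex j))) →
      pathClass p = 𝟙 _ := by
    intro A hA n x i j g hij hi hj hC o p hp
    have hhC : (vert x i)⁻¹ * vert x j ∈ S.C := by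
      -- At the midpoint both ends have positive weight, so the condition on labels applies to the
      -- pair (i, j).
      let m : I := ⟨1 / 2, by norm_num, by norm_num⟩
      refine hC m i j hij ?_ ?_ <;> simp only [Simp.mix_apply, stdSimplex.vertex_coe, m]
      · have : (0 : ℝ) ≤ Pi.single (M := fun _ => ℝ) j 1 i := by
          rw [Pi.single_apply]; split_ifs <;> norm_num
        rw [Pi.single_eq_same]
        linarith
      · have : (0 : ℝ) ≤ Pi.single (M := fun _ => ℝ) i 1 j := by
          rw [Pi.single_apply]; split_ifs <;> norm_num
        rw [Pi.single_eq_same]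
        linarith
    have hhV : (vert x i)⁻¹ * vert x j ∈ S.V l := by
      have := S.mul_mem l 1 (S.one_mem_V _) _ hi _ hj
      convert this using 1
      group
    have hD : ∀ a ∈ S.V k ∩ S.C, ∀ s, edgePoint hq a s ∈ A := fun a ha s =>
      hA ⟨⟨mk_mem_fil _ _, edgePoint_mem_labelsIn hq S.one_mem ha.2 s⟩,
        edgePoint_mem_small hq S ha.1 s⟩
    have ho : o.1 = pt q G := by
      have := congrArg Subtype.val p.source
      rw [hp, Simp.mix_zero, mk_vertex] at this
      exact this.symm
    have hr : ∀ s, ((Path.refl o) s).1 = edgePoint hq 1 s := fun s => by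
      rw [Path.refl_apply, edgePoint_label_one, ho]
    rw [pathClass_edge_eq_of_joinedIn hq (hl _ ⟨hhV, hhC⟩) hD p (Path.refl o)
      (fun s => by rw [hp, mk_mix_vertex_eq_edgePoint hq x hij]) hr, pathClass_refl]
  refine ⟨l + 1, fun {A} hA n x i j g hi hj hC o p hp => ?_⟩
  rcases le_total i j with h | h
  · exact key hA x i j g h hi hj hC p hp
  · have := key hA x j i g h hj hi (fun s => by rw [← mix_symm]; exact hC _) p.symm
      fun s => by rw [Path.symm_apply, Function.comp_apply, hp, mix_symm]
    rw [pathClass_symm, Groupoid.inv_eq_inv] at this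
    calc pathClass p = pathClass p ≫ inv (pathClass p) := by rw [this, Category.comp_id]
      _ = 𝟙 _ := IsIso.hom_inv_id _

end Edges

section Products

variable {q : ℕ} {G : Type*} [Group G] [TopologicalSpace G]

/-- Edge loops with commuting labels multiply. -/
theorem pathClass_edge_mul (hq : 2 ≤ q) {g h : G} (hc : Commute g h)
    {o : (univ : Set (NilClassifying q G))} (p r w : Path o o)
    (hp : ∀ s, (p s).1 = edgePoint hq g s) (hr : ∀ s, (r s).1 = edgePoint hq h s)
    (hw : ∀ s, (w s).1 = edgePoint hq (g * h) s) :
    pathClass p ≫ pathClass r = pathClass w := by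
  let x : nilTuples q G 2 := ⟨![g, h], mem_nilTuples_of_commute hq fun i j => by
    fin_cases i <;> fin_cases j <;> first | exact Commute.refl _ | exact hc | exact hc.symm⟩
  have v0 : vert x 0 = 1 := by simp [vert]
  have v1 : vert x 1 = g := by
    have := vert_succ x 0
    change (vert x 0)⁻¹ * vert x 1 = g at this
    rwa [v0, inv_one, one_mul] at this
  have v2 : vert x 2 = g * h := by
    have := vert_succ x 1
    change (vert x 1)⁻¹ * vert x 2 = h at this
    rwa [v1, inv_mul_eq_iff_eq_mul] at this
  refine pathClass_triangle x (K := univ) (fun _ _ _ _ _ => mem_univ _) (fun _ _ => mem_univ _)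
    (t₀ := stdSimplex.vertex 0) (t₁ := stdSimplex.vertex 1) (t₂ := stdSimplex.vertex 2)
    (mem_univ _) (mem_univ _) (mem_univ _) p r w (fun s => ?_) (fun s => ?_) fun s => ?_
  · rw [hp, mk_mix_vertex_eq_edgePoint hq x (by decide), v0, v1, inv_one, one_mul]
  · rw [hr, mk_mix_vertex_eq_edgePoint hq x (by decide), v1, v2, inv_mul_cancel_left]
  · rw [hw, mk_mix_vertex_eq_edgePoint hq x (by decide), v0, v2, inv_one, one_mul]

end Products

end NilClassifying

/-! ### Contraction of small loops. -/

theorem eventually_forall_uIcc {p : I → Prop} {t₀ : I} (h : ∀ᶠ t in 𝓝 t₀, p t) :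
    ∀ᶠ t in 𝓝 t₀, ∀ r ∈ uIcc t₀ t, p r := by
  have h1 : Filter.Tendsto (fun t => uIcc t₀ t) (𝓝 t₀) (𝓝 t₀).smallSets :=
    tendsto_const_nhds.uIcc Filter.tendsto_id
  exact h1.eventually (Filter.eventually_smallSets_forall.2 h)

namespace NilClassifying

section Contract

theorem lt_mass_mix {q : ℕ} {G : Type*} [Group G] {n : ℕ} {x : nilTuples q G n}
    {t t' : Simp n} {g : G} {V : Set G} {c : ℝ} (h : c < mass x t g V) (h' : c < mass x t' g V) (s : I) :
    c < mass x (Simp.mix s t t') g V := by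
  rw [mass_mix]
  have h1 := s.2.1
  have h2 := s.2.2
  rcases h1.eq_or_lt with h3 | h3
  · rw [← h3]
    linarith
  · nlinarith


variable {q : ℕ} {G : Type*} [Group G] [TopologicalSpace G]

/-- The bounded part of `B(q, G)` on which labels are controlled by the scale at level `k`. -/
def stage (q : ℕ) (S : Scale G) (N k : ℕ) : Set (NilClassifying q G) :=
  fil q G N ∩ labelsIn q S.C ∩ small q S k

theorem stage_antitone (S : Scale G) (N : ℕ) : Antitone (stage q S N) :=
  fun _ _ h _ hz => ⟨hz.1, small_antitone S h hz.2⟩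

theorem pt_mem_stage (S : Scale G) (N k : ℕ) : pt q G ∈ stage q S N k :=
  ⟨⟨pt_mem_fil N, pt_mem_labelsIn S.one_mem⟩, pt_mem_small S k⟩

theorem faceClosed_bounded (S : Scale G) (N : ℕ) :
    FaceClosed (fil q G N ∩ labelsIn q S.C) :=
  (faceClosed_fil N).inter (faceClosed_labelsIn _)

/-- A loop at the vertex that contracts inside `A`. -/
def NullIn (A : Set (NilClassifying q G)) (ω : I → NilClassifying q G) : Prop :=
  ∃ H : C(I × I, NilClassifying q G), (∀ u, H u ∈ A) ∧
    ∀ r, H (r, 0) = ω r ∧ H (r, 1) = pt q G ∧ H (0, r) = pt q G ∧ H (1, r) = pt q G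

theorem NullIn.mono {A A' : Set (NilClassifying q G)} (h : A ⊆ A') {ω : I → NilClassifying q G}
    (hω : NullIn A ω) : NullIn A' ω := by
  obtain ⟨H, hH, h1⟩ := hω
  exact ⟨H, fun u => h (hH u), h1⟩

theorem NullIn.pathClass_eq_one {A : Set (NilClassifying q G)} {o : A} (p : Path o o)
    (h : NullIn A fun r => (p r).1) : pathClass p = 𝟙 _ := by
  obtain ⟨H, hH, h1⟩ := h
  have ho : o.1 = pt q G := by
    have h2 := (h1 0).1
    rw [(h1 0).2.2.1] at h2
    simpa using h2.symm
  let F : C(I × I, A) := ⟨fun u => ⟨H u, hH u⟩, by fun_prop⟩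
  have := pathClass_square F p (Path.refl o) (Path.refl o) (Path.refl o)
    (fun s => Subtype.ext (h1 s).1) (fun s => Subtype.ext ((h1 s).2.2.2.trans ho.symm))
    (fun s => Subtype.ext ((h1 s).2.2.1.trans ho.symm))
    fun s => Subtype.ext ((h1 s).2.1.trans ho.symm)
  simpa [pathClass_refl] using this

theorem track_mem_small {S : Scale G} {k : ℕ} {φ : Reparam} {z : NilClassifying q G}
    (hz : z ∈ conc q Reparam.id φ (S.V k) (S.V k) (threshold k)) (s : I) :
    track φ s z ∈ small q S k := by
  obtain ⟨n, x, t, rfl⟩ := exists_mk z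
  obtain ⟨g, h1, h2⟩ := mk_mem_conc.1 hz
  rw [Reparam.id_warp] at h1
  exact mk_mem_small.2 ⟨g, lt_mass_mix h1 h2 s⟩

/-- A vertex near which the mass of a point is concentrated at every level of the scale. -/
structure MainVertex (S : Scale G) (z : NilClassifying q G) where
  ofCoords ::
  n : ℕ
  x : nilTuples q G n
  t : Simp n
  i : Fin (n + 1)
  eq : z = mk x t
  pos : 0 < t i
  good : ∀ k, z ∈ small q S k → ∃ g, threshold k < mass x t g (S.V k) ∧ g⁻¹ * vert x i ∈ S.V k

theorem exists_pos_coord {n : ℕ} (t : Simp n) : ∃ i, 0 < t i := by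
  by_contra h
  push Not at h
  have h1 := stdSimplex.sum_eq_one t
  have h2 : ∑ i, t i ≤ 0 := Finset.sum_nonpos fun i _ => h i
  linarith

/-- The straight path from a point to its main vertex. -/
def MainVertex.seg {S : Scale G} {z : NilClassifying q G} (v : MainVertex S z) (s : I) :
    NilClassifying q G := mk v.x (Simp.mix s v.t (stdSimplex.vertex v.i))

theorem MainVertex.seg_mem {S : Scale G} {z : NilClassifying q G} (v : MainVertex S z) {N k : ℕ}
    (hz : z ∈ stage q S N k) (s : I) : v.seg s ∈ stage q S N k := by
  obtain ⟨g, h1, h2⟩ := v.good k hz.2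
  refine ⟨faceClosed_bounded S N v.x v.t _ (v.eq ▸ hz.1) fun j hj =>
    mix_support (fun j hj => vertex_support v.pos j hj) s j hj, mk_mem_small.2 ⟨g, ?_⟩⟩
  refine lt_mass_mix h1 ?_ s
  rw [mass_vertex _ _ _ _ h2]
  exact threshold_lt_one k

/-- The path from a point to its main vertex inside a stage. -/
def MainVertex.path {S : Scale G} {N k : ℕ} {z o : stage q S N k} (v : MainVertex S z.1)
    (ho : o.1 = pt q G) : Path z o :=
  segPath v.x v.t (stdSimplex.vertex v.i) v.eq (by rw [ho, mk_vertex]) (v.seg_mem z.2)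

variable [IsTopologicalGroup G] [T2Space G]

/-- A point other than the vertex lies in `small` only up to some last level M. A vertex inside a
translate carrying most of the mass at level M works, with the same translate, at every earlier
level; if the point is in no level, any vertex of the support works. -/
theorem nonempty_mainVertex (S : Scale G) {N : ℕ} {z : NilClassifying q G}
    (hz : z ∈ fil q G N ∩ labelsIn q S.C) : Nonempty (MainVertex S z) := by
  classical
  by_cases hne : z = pt q G
  · refine ⟨⟨0, oneTuple q G 0, stdSimplex.vertex 0, 0, hne, by simp, fun k _ => ⟨1, ?_⟩⟩⟩
    have h1 : (1 : G)⁻¹ * vert (oneTuple q G 0) 0 ∈ S.V k := by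
      simpa [vert] using S.one_mem_V k
    exact ⟨by rw [mass_vertex _ _ _ _ h1]; exact threshold_lt_one k, h1⟩
  have hex := exists_notMem_small S N hz hne
  obtain ⟨n, x, t, rfl⟩ := exists_mk z
  rcases hM : Nat.find hex with _ | M
  · obtain ⟨i, hi⟩ := exists_pos_coord t
    refine ⟨⟨n, x, t, i, rfl, hi, fun k hk => ?_⟩⟩
    have := Nat.find_spec hex
    rw [hM] at this
    exact absurd (small_antitone S (Nat.zero_le k) hk) this
  · have h1 := Nat.find_spec hex
    have h2 := Nat.find_min hex (m := M) (by omega)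
    rw [not_not] at h2
    rw [hM] at h1
    obtain ⟨g, hg⟩ := mk_mem_small.1 h2
    obtain ⟨i, hi, hV⟩ := exists_of_mass_pos (by linarith [half_lt_threshold M])
    refine ⟨⟨n, x, t, i, rfl, hi, fun k hk => ⟨g, ?_, ?_⟩⟩⟩ <;>
    · have hkM : k ≤ M := by
        by_contra h
        exact h1 (small_antitone S (by omega) hk)
      first
      | exact (threshold_mono hkM).trans_lt
          (hg.trans_le (mass_mono x t g fun i hi => S.antitone hkM hi))
      | exact S.antitone hkM hV

/-- A chosen main vertex. -/
noncomputable def mainVertex (S : Scale G) {N : ℕ} {z : NilClassifying q G}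
    (hz : z ∈ fil q G N ∩ labelsIn q S.C) : MainVertex S z :=
  (nonempty_mainVertex S hz).some

/-- Small loops in the `n`-th filtration step contract inside small sets. -/
def LoopsContract (q : ℕ) (S : Scale G) (N n : ℕ) : Prop :=
  ∀ k, ∃ l, ∀ ω : C(I, NilClassifying q G), ω 0 = pt q G → ω 1 = pt q G →
    (∀ r, ω r ∈ fil q G n ∩ stage q S N l) → NullIn (stage q S N k) ω

/-- Off the vertex, the window at the main vertex of γ(t₀) lowers the filtration degree nearby. The
loop it leaves over is thus small and of degree n, hence contracts by hypothesis, and the remaining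
edge has a small label. So the closed-up pieces are locally trivial, and connectedness makes the
whole closed-up path trivial. -/
theorem exists_homotopic_of_ne_pt (hq : 2 ≤ q) (S : Scale G) {N n : ℕ} (hN : 1 ≤ N)
    (hn : LoopsContract q S N n) (k : ℕ) :
    ∃ l, ∀ (o : stage q S N k) (ho : o.1 = pt q G) (γ : C(I, stage q S N k)),
      (∀ r, (γ r).1 ∈ fil q G (n + 1) ∧ (γ r).1 ∈ small q S l ∧ (γ r).1 ≠ pt q G) →
      Path.Homotopic (⟨γ, rfl, rfl⟩ : Path (γ 0) (γ 1))
        (((mainVertex S (γ 0).2.1).path ho).trans ((mainVertex S (γ 1).2.1).path ho).symm) := by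
  obtain ⟨l', hl'⟩ := hn k
  obtain ⟨m, hm⟩ := exists_pathClass_segment_eq_one hq S k
  -- The homotopies must stay in level k, the edge must be small at level m, and the residual loop
  -- small at level l'. One further level is spent below on comparing two translates.
  let l₁ := max k (max m l')
  have hl₁k : k ≤ l₁ := le_max_left _ _
  have hl₁m : m ≤ l₁ := (le_max_left _ _).trans (le_max_right _ _)
  have hl₁l : l' ≤ l₁ := (le_max_right _ _).trans (le_max_right _ _)
  refine ⟨l₁ + 1, fun o ho γ hγ => ?_⟩
  let p : Path (γ 0) (γ 1) := ⟨γ, rfl, rfl⟩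
  let κ : ∀ t, Path (p t) o := fun t => (mainVertex S (p t).2.1).path ho
  have hloc : ∀ t₀, ∀ᶠ t in 𝓝 t₀, (Groupoid.inv (pathClass (κ t₀)) ≫
      pathClass (p.subpath t₀ t) ≫ pathClass (κ t) : FundamentalGroup (stage q S N k) o) ∈
        (⊥ : Subgroup (FundamentalGroup (stage q S N k) o)) := by
    intro t₀
    set v := mainVertex S (p t₀).2.1 with hv
    obtain ⟨φ, hφ, hU⟩ := exists_window_aux v.x v.t v.i v.pos
    obtain ⟨U, hUo, hzU, hUf⟩ := hU (v.eq ▸ (hγ t₀).2.2)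
    have hW : (p t₀).1 ∈ U ∩ conc q Reparam.id φ (S.V (l₁ + 1)) (S.V (l₁ + 1))
        (threshold (l₁ + 1)) := by
      obtain ⟨g, h1, h2⟩ := v.good _ (hγ t₀).2.1
      rw [v.eq]
      refine ⟨hzU, mk_mem_conc.2 ⟨g, by rwa [Reparam.id_warp], ?_⟩⟩
      rw [hφ, mass_vertex _ _ _ _ h2]
      exact threshold_lt_one _
    have hWo := hUo.inter (isOpen_conc (q := q) (S.isOpen (l₁ + 1)) (S.isOpen (l₁ + 1)) Reparam.id
      φ (threshold (l₁ + 1)))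
    have hpc : Continuous fun t => (p t).1 := by fun_prop
    filter_upwards [eventually_forall_uIcc (hpc.continuousAt.preimage_mem_nhds (hWo.mem_nhds hW))]
      with t₁ ht₁
    set w := mainVertex S (p t₁).2.1 with hw
    have hB1 : mk w.x w.t ∈ fil q G N ∩ labelsIn q S.C := w.eq ▸ (p t₁).2.1
    have hWt := ht₁ t₁ right_mem_uIcc
    have hconc : mk w.x w.t ∈ conc q Reparam.id φ (S.V (l₁ + 1)) (S.V (l₁ + 1))
        (threshold (l₁ + 1)) := w.eq ▸ hWt.2
    obtain ⟨g, hg1, hg2⟩ := mk_mem_conc.1 hconc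
    rw [Reparam.id_warp] at hg1
    have hhalf := half_lt_threshold (l₁ + 1)
    obtain ⟨j, hj, hjV⟩ := exists_of_mass_pos (by linarith : 0 < mass w.x (φ.warp w.t) g _)
    obtain ⟨g', hg', hiV⟩ := w.good _ (hγ t₁).2.1
    obtain ⟨c, -, hc1, hc2⟩ := exists_of_mass_gt_half (hhalf.trans hg1) (hhalf.trans hg')
    -- The translates by g and g' each carry more than half of the mass, so they share a vertex c;
    -- passing through c uses one triple product.
    have hiV' : g⁻¹ * vert w.x w.i ∈ S.V l₁ := by
      have := S.mul_mem l₁ _ hc1 _ hc2 _ hiV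
      convert this using 1
      group
    have hjV' : g⁻¹ * vert w.x j ∈ S.V l₁ := S.antitone (Nat.le_succ _) hjV
    have hstage : ∀ {r}, r ∈ uIcc t₀ t₁ → ∀ s, track φ s (p r).1 ∈ stage q S N (l₁ + 1) :=
      fun hr s => ⟨track_mem_of_faceClosed (faceClosed_bounded S N) φ s (p _).2.1,
        track_mem_small (ht₁ _ hr).2 s⟩
    have hlift : threshold l₁ < mass w.x w.t g (S.V l₁) := (threshold_mono (Nat.le_succ _)).trans_lt
      (hg1.trans_le (mass_mono _ _ _ fun i hi => S.antitone (Nat.le_succ _) hi))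
    have hlift' : threshold l₁ < mass w.x (φ.warp w.t) g (S.V l₁) :=
      (threshold_mono (Nat.le_succ _)).trans_lt
        (hg2.trans_le (mass_mono _ _ _ fun i hi => S.antitone (Nat.le_succ _) hi))
    have hjt : 0 < w.t j := φ.warp_pos hj
    obtain ⟨e, he, hcl⟩ := exists_edge_of_track p o φ t₀ t₁ (κ t₀)
      (fun s => by
        rw [congrArg (track φ s) v.eq, track_mk, hφ]
        rfl)
      (fun s r hr => stage_antitone S N (hl₁k.trans (Nat.le_succ _)) (hstage hr s))
      w.eq w.i j (κ t₁) (fun s => rfl)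
      -- A convex part of the simplex containing the point, its image under the window and both
      -- vertices, and mapping into the stage.
      {u | threshold l₁ < mass w.x u g (S.V l₁) ∧ ∀ i, 0 < u i → 0 < w.t i}
      (fun s u hu u' hu' => ⟨lt_mass_mix hu.1 hu'.1 s, fun i hi => by
        by_contra h
        have h1 : u i = 0 := le_antisymm (not_lt.1 fun h' => h (hu.2 i h')) (u.2.1 i)
        have h2 : u' i = 0 := le_antisymm (not_lt.1 fun h' => h (hu'.2 i h')) (u'.2.1 i)
        simp [Simp.mix_apply, h1, h2] at hi⟩)
      (fun u hu => stage_antitone S N hl₁k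
        ⟨faceClosed_bounded S N _ _ _ hB1 hu.2, mk_mem_small.2 ⟨g, hu.1⟩⟩)
      ⟨hlift, fun i hi => hi⟩ ⟨hlift', fun i hi => φ.warp_pos hi⟩
      ⟨by rw [mass_vertex _ _ _ _ hiV']; exact threshold_lt_one _, vertex_support w.pos⟩
      ⟨by rw [mass_vertex _ _ _ _ hjV']; exact threshold_lt_one _, vertex_support hjt⟩
      (fun ω hω => by
        refine NullIn.pathClass_eq_one ω (hl' ⟨fun r => (ω r).1, by fun_prop⟩ ?_ ?_ fun r => ?_)
        · simp [ho]
        · simp [ho]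
        · rcases hω r with ⟨r', hr', h⟩ | ⟨s, h⟩
          · change (ω r).1 ∈ _
            rw [h]
            refine ⟨hUf n _ (ht₁ _ hr').1 (hγ r').1, ?_⟩
            have := hstage hr' 1
            rw [track_one] at this
            exact stage_antitone S N (hl₁l.trans (Nat.le_succ _)) this
          · change (ω r).1 ∈ _
            rw [h]
            have hf : mk w.x (φ.warp w.t) ∈ fil q G n := by
              have := hUf n _ hWt.1 (hγ t₁).1
              change act φ (p t₁).1 ∈ _ at this
              rwa [w.eq, act_mk] at this
            have hs := fun i => mix_support (fun i hi => vertex_support hj i hi) s i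
            refine ⟨faceClosed_fil n _ _ _ hf hs, ?_⟩
            refine stage_antitone S N (hl₁l.trans (Nat.le_succ _))
              ⟨faceClosed_bounded S N _ _ _ hB1 fun i hi => φ.warp_pos (hs i hi),
                mk_mem_small.2 ⟨g, lt_mass_mix hg2 ?_ s⟩⟩
            rw [mass_vertex _ _ _ _ hjV]
            exact threshold_lt_one _)
    have hA : fil q G 1 ∩ labelsIn q S.C ∩ small q S k ⊆ stage q S N k :=
      fun z hz => ⟨⟨fil_mono hN hz.1.1, hz.1.2⟩, hz.2⟩
    have hone : pathClass e = 𝟙 _ := by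
      refine hm hA w.x j w.i g (S.antitone hl₁m hjV') (S.antitone hl₁m hiV') (fun s => ?_) e he
      exact (faceClosed_bounded S N _ _ _ hB1 fun i hi => by
        by_contra h
        have h1 : i ≠ j := fun h' => h (h' ▸ hjt)
        have h2 : i ≠ w.i := fun h' => h (h' ▸ w.pos)
        simp [Simp.mix_apply, h1, h2] at hi).2
    rw [hcl, hone]
    exact (⊥ : Subgroup (FundamentalGroup (stage q S N k) o)).one_mem
  have := mem_of_eventually_mem p (fun t => pathClass (κ t)) ⊥ hloc 0 1
  replace this := (Subgroup.mem_bot (G := FundamentalGroup (stage q S N k) o)).1 this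
  have hsub : pathClass (p.subpath 0 1) = pathClass p := by
    congr 1
    ext t
    simp [Path.subpath, p]
  have h1 : Groupoid.inv (pathClass (κ 0)) ≫ pathClass p ≫ pathClass (κ 1) = 𝟙 _ := by
    rw [← hsub]
    exact this
  rw [← pathClass_eq_iff, pathClass_trans, pathClass_symm]
  change pathClass p = pathClass (κ 0) ≫ Groupoid.inv (pathClass (κ 1))
  rw [Groupoid.inv_eq_inv] at h1 ⊢
  rw [IsIso.inv_comp_eq, Category.comp_id] at h1
  rw [← h1]
  simp

end Contract

end NilClassifying

namespace NilClassifying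

theorem loopsContract_zero {q : ℕ} {G : Type*} [Group G] [TopologicalSpace G]
    (S : Scale G) (N : ℕ) : LoopsContract q S N 0 := by
  refine fun k => ⟨0, fun ω _ _ h => ⟨ContinuousMap.const _ (pt q G),
    fun _ => pt_mem_stage S N k, fun r => ⟨?_, rfl, rfl, rfl⟩⟩⟩
  exact (eq_pt_of_mem_fil_zero (h r).1).symm

variable {q : ℕ} {G : Type*} [Group G] [TopologicalSpace G] [IsTopologicalGroup G] [T2Space G]

/-- The path to the main vertex, preceded by a constant path. -/
noncomputable def delayedSeg (S : Scale G) (N : ℕ) (z : NilClassifying q G) (s : I) :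
    NilClassifying q G :=
  open Classical in
  if h : z ∈ fil q G N ∩ labelsIn q S.C then
    if hs : (s : ℝ) ≤ 1 / 2 then z
    else (mainVertex S h).seg ⟨2 * s - 1, unitInterval.two_mul_sub_one_mem_iff.2
      ⟨(not_le.1 hs).le, s.2.2⟩⟩
  else z

theorem trans_path_apply (S : Scale G) {N k : ℕ} {z o : stage q S N k} (ho : o.1 = pt q G)
    (s : I) : (((Path.refl z).trans ((mainVertex S z.2.1).path ho)) s).1 =
      delayedSeg S N z.1 s := by
  rw [Path.trans_apply, delayedSeg, dif_pos z.2.1]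
  split_ifs
  · rfl
  · rfl

/-- The times at which the loop is at the vertex are removed, the homotopies of
`exists_homotopic_of_ne_pt` fill the Whitney intervals of the rest, and all fillers use the same
paths to main vertices, so they fit together at common endpoints. -/
theorem loopsContract_succ (hq : 2 ≤ q) (S : Scale G) {N n : ℕ} (hN : 1 ≤ N)
    (hn : LoopsContract q S N n) : LoopsContract q S N (n + 1) := by
  choose ℓ hℓ using fun k => exists_homotopic_of_ne_pt hq S hN hn k
  intro k₀
  refine ⟨(Finset.range (k₀ + 1)).sup (fun j => max (ℓ j) j), fun ω h0 h1 hω => ?_⟩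
  -- The levels ℓ j need not be monotone in j, so W k imposes all conditions up to k; this makes W
  -- decreasing, and only finitely many conditions have to hold near a return to the vertex.
  let W : ℕ → Set (NilClassifying q G) := fun k => {z | z ∈ fil q G (n + 1) ∧
    z ∈ fil q G N ∩ labelsIn q S.C ∧ ∀ j ≤ k, z ∈ small q S (ℓ j) ∧ z ∈ small q S j}
  let γ : ℝ → NilClassifying q G := fun t => ω (projIcc 0 1 zero_le_one t)
  have hγ : Continuous γ := by fun_prop
  obtain ⟨H, hHc, hHA, hH⟩ := exists_nullHomotopy_of_fillers (o := pt q G) isClosed_singleton_pt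
    (A := stage q S N) (W := W) (stage_antitone S N) (pt_mem_stage S N)
    (fun U hU hpt => exists_small_subset S N hU hpt)
    (fun k l hkl z hz => ⟨hz.1, hz.2.1, fun j hj => hz.2.2 j (hj.trans hkl)⟩)
    (fun z hz => by
      by_cases hB : z ∈ fil q G N ∩ labelsIn q S.C
      · obtain ⟨k, hk⟩ := exists_notMem_small S N hB hz
        exact ⟨k, fun h => hk (h.2.2 k le_rfl).2⟩
      · exact ⟨0, fun h => hB h.2.1⟩)
    (γ := γ) hγ (fun t ht => by
      rcases ht with ht | ht
      · change ω _ = _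
        rw [projIcc_of_le_left _ ht]
        exact h0
      · change ω _ = _
        rw [projIcc_of_right_le _ ht]
        exact h1)
    (k₀ := k₀) (fun t => by
      have h := hω (projIcc 0 1 zero_le_one t)
      refine ⟨h.1, h.2.1, fun j hj => ?_⟩
      have hle : max (ℓ j) j ≤ (Finset.range (k₀ + 1)).sup (fun j => max (ℓ j) j) :=
        Finset.le_sup (f := fun j => max (ℓ j) j) (Finset.mem_range.2 (by omega))
      exact ⟨small_antitone S ((le_max_left _ _).trans hle) h.2.2,
        small_antitone S ((le_max_right _ _).trans hle) h.2.2⟩)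
    (fun k t ht => by
      have hev : ∀ j ∈ Finset.range (k + 1), ∀ᶠ u in 𝓝 t,
          γ u ∈ small q S (ℓ j) ∧ γ u ∈ small q S j := fun j _ =>
        (hγ.continuousAt.preimage_mem_nhds
          (((isOpen_small S _).inter (isOpen_small S _)).mem_nhds
            (show γ t ∈ small q S (ℓ j) ∩ small q S j from
              ht.symm ▸ ⟨pt_mem_small S _, pt_mem_small S _⟩)))
      filter_upwards [(Filter.eventually_all_finset _).2 hev] with u hu
      have h := hω (projIcc 0 1 zero_le_one u)
      exact ⟨h.1, h.2.1, fun j hj => hu j (Finset.mem_range.2 (by omega))⟩)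
    (delayedSeg S N) (fun k _ a b hab hW => by
      have hba : 0 < b - a := sub_pos.2 hab
      have hmem : ∀ r : I, a + r * (b - a) ∈ Icc a b := fun r =>
        ⟨by nlinarith [r.2.1], by nlinarith [r.2.2]⟩
      let o : stage q S N k := ⟨pt q G, pt_mem_stage S N k⟩
      let F₀ : C(I, stage q S N k) := ⟨fun r => ⟨γ (a + r * (b - a)),
        (hW _ (hmem r)).1.2.1, ((hW _ (hmem r)).1.2.2 k le_rfl).2⟩, by fun_prop⟩
      have hF0 : (F₀ 0).1 = γ a := by simp [F₀]
      have hF1 : (F₀ 1).1 = γ b := by simp [F₀]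
      obtain ⟨F, hFb, hFt, hFl, hFr⟩ := exists_filler (hℓ k o rfl F₀ fun r =>
        ⟨(hW _ (hmem r)).1.1, ((hW _ (hmem r)).1.2.2 k le_rfl).1, (hW _ (hmem r)).2⟩)
      refine ⟨fun u => (F (projIcc 0 1 zero_le_one ((u.1 - a) / (b - a)), u.2)).1, by fun_prop,
        fun t ht => ⟨fun s => (F _).2, ?_, ?_⟩, fun s => ?_, fun s => ?_⟩
      · have hm : (t - a) / (b - a) ∈ Icc (0 : ℝ) 1 :=
          ⟨div_nonneg (by linarith [ht.1]) hba.le, (div_le_one hba).2 (by linarith [ht.2])⟩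
        simp only [hFb]
        change γ (a + (projIcc (0 : ℝ) 1 zero_le_one ((t - a) / (b - a)) : ℝ) * (b - a)) = γ t
        rw [projIcc_of_mem zero_le_one hm]
        congr 1
        field_simp
        ring
      · simp only [hFt]
        rfl
      · have hm : projIcc (0 : ℝ) 1 zero_le_one ((a - a) / (b - a)) = 0 :=
          projIcc_of_le_left _ (by simp)
        simp only [hm, hFl]
        rw [← hF0]
        exact trans_path_apply S rfl s
      · have hm : projIcc (0 : ℝ) 1 zero_le_one ((b - a) / (b - a)) = 1 :=
          projIcc_of_right_le _ (by rw [div_self hba.ne'])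
        simp only [hm, hFr]
        rw [← hF1]
        exact trans_path_apply S rfl s)
  refine ⟨⟨fun u => H (u.1, u.2), by fun_prop⟩, fun u => hHA _, fun r => ⟨?_, (hH _).2.1, ?_, ?_⟩⟩
  · change H ((r : ℝ), 0) = ω r
    rw [(hH _).1]
    change ω (projIcc 0 1 zero_le_one (r : ℝ)) = ω r
    rw [projIcc_val]
  · refine (hH _).2.2 ?_ r
    change ω (projIcc 0 1 zero_le_one (0 : ℝ)) = _
    rw [projIcc_of_le_left _ le_rfl]
    exact h0
  · refine (hH _).2.2 ?_ r
    change ω (projIcc 0 1 zero_le_one (1 : ℝ)) = _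
    rw [projIcc_of_right_le _ le_rfl]
    exact h1

theorem loopsContract (hq : 2 ≤ q) (S : Scale G) {N : ℕ} (hN : 1 ≤ N) (n : ℕ) :
    LoopsContract q S N n := by
  induction n with
  | zero => exact loopsContract_zero S N
  | succ n ih => exact loopsContract_succ hq S hN ih

end NilClassifying

/-! ### The homomorphism from π₀(G), and its surjectivity. -/

theorem pathClass_close {Y : Type*} [TopologicalSpace Y] {a : Y} (p : Path a a)
    (κ₀ : Path (p 0) a) (κ₁ : Path (p 1) a) (h₀ : ∀ s, κ₀ s = a) (h₁ : ∀ s, κ₁ s = a) :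
    Groupoid.inv (pathClass κ₀) ≫ pathClass (p.subpath 0 1) ≫ pathClass κ₁ = pathClass p := by
  let F : C(I × I, Y) := ⟨fun u => p u.1, by fun_prop⟩
  rw [pathClass_square F (p.subpath 0 1) κ₁ κ₀ p (fun r => by simp [F, Path.subpath])
    (fun s => by simp [F, h₁]) (fun s => by simp [F, h₀]) fun r => rfl]
  simp

namespace NilClassifying

section EdgeLoops

variable {q : ℕ} {G : Type*} [Group G] [TopologicalSpace G]

/-- The vertex, in the whole space regarded as a subset. -/
def univPt (q : ℕ) (G : Type*) [Group G] [TopologicalSpace G] :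
    (univ : Set (NilClassifying q G)) := ⟨pt q G, mem_univ _⟩

/-- The loop along the `1`-simplex labelled by `g`. -/
def edgeLoop (hq : 2 ≤ q) (g : G) : Path (univPt q G) (univPt q G) :=
  segPath (edge hq g) (stdSimplex.vertex 0) (stdSimplex.vertex 1) (mk_vertex _ _).symm
    (mk_vertex _ _).symm fun _ => mem_univ _

theorem edgeLoop_apply (hq : 2 ≤ q) (g : G) (s : I) : (edgeLoop hq g s).1 = edgePoint hq g s := rfl

variable [IsTopologicalGroup G]

/-- The homomorphism from `π₀(G)` to the fundamental group given by a section of `G → π₀(G)`. -/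
def edgeHom (hq : 2 ≤ q) (hcomm : ∀ a b : ZerothHomotopy G, a * b = b * a)
    (s : ZerothHomotopy G →* G) :
    ZerothHomotopy G →* FundamentalGroup (univ : Set (NilClassifying q G)) (univPt q G) where
  toFun a := pathClass (edgeLoop hq (s a))
  map_one' := pathClass_edge_one hq _ fun r => by rw [map_one, edgeLoop_apply]
  map_mul' a b := by
    -- Multiplication in the fundamental group composes from right to left, so the loop of s b comes
    -- first; commutativity absorbs the order.
    have h := pathClass_edge_mul hq (g := s b) (h := s a)
      (by rw [Commute, SemiconjBy, ← map_mul, hcomm, map_mul])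
      (edgeLoop hq (s b)) (edgeLoop hq (s a)) (edgeLoop hq (s (a * b))) (fun _ => rfl)
      (fun _ => rfl) fun r => by rw [edgeLoop_apply, hcomm, map_mul]
    exact h.symm

theorem joined_section (s : ZerothHomotopy G →* G)
    (hs : (toPiZero G).comp s = MonoidHom.id _) (g : G) :
    Joined g (s (ZerothHomotopy.mk g)) := by
  have := DFunLike.congr_fun hs (ZerothHomotopy.mk g)
  exact (Quotient.exact this).symm

theorem pathClass_edge_mem_range (hq : 2 ≤ q) (hcomm : ∀ a b : ZerothHomotopy G, a * b = b * a)
    (s : ZerothHomotopy G →* G) (hs : (toPiZero G).comp s = MonoidHom.id _) (g : G)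
    (e : Path (univPt q G) (univPt q G)) (he : ∀ r, (e r).1 = edgePoint hq g r) :
    (pathClass e : FundamentalGroup (univ : Set (NilClassifying q G)) (univPt q G)) ∈
      (edgeHom hq hcomm s).range := by
  refine ⟨ZerothHomotopy.mk g, ?_⟩
  exact (pathClass_edge_eq_of_joinedIn hq (joinedIn_univ.2 (joined_section s hs g))
    (fun _ _ _ => mem_univ _) e _ he fun _ => rfl).symm

theorem pathClass_segment_mem_range (hq : 2 ≤ q)
    (hcomm : ∀ a b : ZerothHomotopy G, a * b = b * a)
    (s : ZerothHomotopy G →* G) (hs : (toPiZero G).comp s = MonoidHom.id _) {n : ℕ}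
    (x : nilTuples q G n) (i j : Fin (n + 1)) (e : Path (univPt q G) (univPt q G))
    (he : ∀ r, (e r).1 = mk x (Simp.mix r (stdSimplex.vertex i) (stdSimplex.vertex j))) :
    (pathClass e : FundamentalGroup (univ : Set (NilClassifying q G)) (univPt q G)) ∈
      (edgeHom hq hcomm s).range := by
  rcases le_total i j with h | h
  · exact pathClass_edge_mem_range hq hcomm s hs _ e fun r => by
      rw [he, mk_mix_vertex_eq_edgePoint hq x h]
  · have := pathClass_edge_mem_range hq hcomm s hs _ e.symm fun r => by
      rw [Path.symm_apply, Function.comp_apply, he, mix_symm, mk_mix_vertex_eq_edgePoint hq x h]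
    have h2 := (edgeHom hq hcomm s).range.inv_mem this
    convert h2 using 1
    change pathClass e = Groupoid.inv (Groupoid.inv (pathClass e))
    simp

variable [T2Space G] [Topology.CWComplex (univ : Set G)]

/-- Every loop at the vertex is homotopic to an edge loop. -/
theorem edgeHom_surjective (hq : 2 ≤ q) (hcomm : ∀ a b : ZerothHomotopy G, a * b = b * a)
    (s : ZerothHomotopy G →* G) (hs : (toPiZero G).comp s = MonoidHom.id _) :
    Function.Surjective (edgeHom hq hcomm s) := by
  rw [← MonoidHom.range_eq_top, eq_top_iff]
  rintro c -
  induction c using Quotient.inductionOn with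
  | h p =>
  have hK : IsCompact (range fun r => (p r).1) := isCompact_range (by fun_prop)
  obtain ⟨N₀, hN₀⟩ := exists_subset_fil hK
  obtain ⟨S, hS⟩ := exists_scale hK
  let N := max 1 N₀
  obtain ⟨l, hl⟩ := loopsContract hq S (le_max_left 1 N₀) N 0
  have hB : ∀ r, (p r).1 ∈ fil q G N ∩ labelsIn q S.C := fun r =>
    ⟨fil_mono (le_max_right _ _) (hN₀ ⟨r, rfl⟩), hS ⟨r, rfl⟩⟩
  let κ : ∀ t, Path (p t) (univPt q G) := fun t =>
    segPath (mainVertex S (hB t)).x (mainVertex S (hB t)).t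
      (stdSimplex.vertex (mainVertex S (hB t)).i) (mainVertex S (hB t)).eq (mk_vertex _ _).symm
      fun _ => mem_univ _
  -- The local argument for small loops, now in the whole space: the window sends p(t₀) to the
  -- vertex, so nearby it leaves a loop small enough to contract. The edge left over may have any
  -- label, and its class is in the range because the label is joined to a value of s.
  have hloc : ∀ t₀, ∀ᶠ t in 𝓝 t₀, (Groupoid.inv (pathClass (κ t₀)) ≫
      pathClass (p.subpath t₀ t) ≫ pathClass (κ t) :
        FundamentalGroup (univ : Set (NilClassifying q G)) (univPt q G)) ∈
      (edgeHom hq hcomm s).range := by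
    intro t₀
    set v := mainVertex S (hB t₀) with hv
    obtain ⟨φ, hφ, -⟩ := exists_window_aux v.x v.t v.i v.pos
    have hW : act φ (p t₀).1 ∈ small q S l := by
      rw [congrArg (act φ) v.eq, act_mk, hφ, mk_vertex]
      exact pt_mem_small S l
    have hpc : Continuous fun t => act φ (p t).1 := (continuous_act φ).comp (by fun_prop)
    filter_upwards [eventually_forall_uIcc (hpc.continuousAt.preimage_mem_nhds
      ((isOpen_small S l).mem_nhds hW))] with t₁ ht₁
    set w := mainVertex S (hB t₁) with hw
    have hB1 : mk w.x w.t ∈ fil q G N ∩ labelsIn q S.C := w.eq ▸ hB t₁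
    have hact : mk w.x (φ.warp w.t) ∈ small q S l := by
      have := ht₁ t₁ right_mem_uIcc
      change act φ (p t₁).1 ∈ _ at this
      rwa [congrArg (act φ) w.eq, act_mk] at this
    obtain ⟨g, hg⟩ := mk_mem_small.1 hact
    obtain ⟨j, hj, hjV⟩ := exists_of_mass_pos
      (by linarith [half_lt_threshold l] : 0 < mass w.x (φ.warp w.t) g _)
    obtain ⟨e, he, hcl⟩ := exists_edge_of_track p (univPt q G) φ t₀ t₁ (κ t₀)
      (fun s => by
        rw [congrArg (track φ s) v.eq, track_mk, hφ]
        rfl)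
      (fun _ _ _ => mem_univ _) w.eq w.i j (κ t₁) (fun _ => rfl) univ
      (fun _ _ _ _ _ => mem_univ _) (fun _ _ => mem_univ _) (mem_univ _) (mem_univ _)
      (mem_univ _) (mem_univ _) fun ω hω => by
        refine NullIn.pathClass_eq_one ω ((hl ⟨fun r => (ω r).1, by fun_prop⟩ ?_ ?_
          fun r => ?_).mono (subset_univ _))
        · exact congrArg Subtype.val ω.source
        · exact congrArg Subtype.val ω.target
        · suffices h : (ω r).1 ∈ stage q S N l from ⟨h.1.1, h⟩
          rcases hω r with ⟨r', hr', h⟩ | ⟨s, h⟩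
          · rw [h]
            refine ⟨?_, ht₁ _ hr'⟩
            rw [← track_one]
            exact track_mem_of_faceClosed (faceClosed_bounded S N) φ 1 (hB r')
          · rw [h]
            have hs := fun i => mix_support (fun i hi => vertex_support hj i hi) s i
            refine ⟨faceClosed_bounded S N _ _ _ hB1 fun i hi => φ.warp_pos (hs i hi),
              mk_mem_small.2 ⟨g, lt_mass_mix hg ?_ s⟩⟩
            rw [mass_vertex _ _ _ _ hjV]
            exact threshold_lt_one _
    rw [hcl]
    exact pathClass_segment_mem_range hq hcomm s hs w.x j w.i e he
  have h01 := mem_of_eventually_mem p (fun t => pathClass (κ t)) _ hloc 0 1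
  -- The chosen closing paths at the two ends are constant: when a point is the vertex, the whole
  -- face carrying it collapses to the vertex.
  have hκ : ∀ t, p t = univPt q G → ∀ r, κ t r = univPt q G := by
    intro t ht r
    set v := mainVertex S (hB t) with hv
    have h1 : mk v.x v.t = pt q G := by
      rw [← v.eq, ht]
      rfl
    refine Subtype.ext (eq_pt_iff.2 fun i j hi hj => eq_pt_iff.1 h1 i j ?_ ?_)
    · exact mix_support (fun i hi => vertex_support v.pos i hi) r i hi
    · exact mix_support (fun i hi => vertex_support v.pos i hi) r j hj
  have := pathClass_close p (κ 0) (κ 1) (hκ 0 p.source) (hκ 1 p.target)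
  rw [this] at h01
  exact h01

end EdgeLoops

end NilClassifying

/-! ### The covering space of path components. -/

namespace NilClassifying

section Cover

variable {q : ℕ} {G : Type*} [Group G] [TopologicalSpace G] [IsTopologicalGroup G]

/-- The elements of `G` in a given path component. -/
def comp (a : ZerothHomotopy G) : Set G := {g | toPiZero G g = a}

theorem mem_comp {a : ZerothHomotopy G} {g : G} : g ∈ comp a ↔ toPiZero G g = a := Iff.rfl

/-- The points at which the majority components of the vertices seen by `φ` and by `ψ` differ
by `a`. -/
def jump (q : ℕ) (φ ψ : Reparam) (a : ZerothHomotopy G) : Set (NilClassifying q G) :=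
  conc q φ ψ (comp 1) (comp a) (1 / 2)

/-- Two majorities seen through the same reparametrization share a vertex, which fixes the relative
component of the two translations; comparing once for φ and once for ψ gives a = b. -/
theorem jump_unique {φ ψ : Reparam} {a b : ZerothHomotopy G} {z : NilClassifying q G}
    (ha : z ∈ jump q φ ψ a) (hb : z ∈ jump q φ ψ b) : a = b := by
  obtain ⟨n, x, t, rfl⟩ := exists_mk z
  obtain ⟨g, g1, g2⟩ := mk_mem_conc.1 ha
  obtain ⟨h, h1, h2⟩ := mk_mem_conc.1 hb
  obtain ⟨i, -, i1, i2⟩ := exists_of_mass_gt_half g1 h1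
  obtain ⟨j, -, j1, j2⟩ := exists_of_mass_gt_half g2 h2
  simp only [mem_comp, map_mul, map_inv, inv_mul_eq_iff_eq_mul, mul_one] at i1 i2 j1 j2
  rw [j1, ← i1, i2] at j2
  exact mul_left_cancel j2

theorem jump_trans {φ ψ χ : Reparam} {a b : ZerothHomotopy G} {z : NilClassifying q G}
    (ha : z ∈ jump q φ ψ a) (hb : z ∈ jump q ψ χ b) : z ∈ jump q φ χ (a * b) := by
  obtain ⟨n, x, t, rfl⟩ := exists_mk z
  obtain ⟨g, g1, g2⟩ := mk_mem_conc.1 ha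
  obtain ⟨h, h1, h2⟩ := mk_mem_conc.1 hb
  obtain ⟨i, -, i1, i2⟩ := exists_of_mass_gt_half g2 h1
  refine mk_mem_conc.2 ⟨g, g1, h2.trans_le ?_⟩
  have : ∀ j, h⁻¹ * vert x j ∈ comp b → g⁻¹ * vert x j ∈ comp (a * b) := by
    intro j hj
    simp only [mem_comp, map_mul, map_inv, inv_mul_eq_iff_eq_mul, mul_one] at i1 i2 hj ⊢
    rw [hj, ← i2, i1, mul_assoc]
  refine Finset.sum_le_sum fun j _ => ?_
  by_cases hj : h⁻¹ * vert x j ∈ comp b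
  · rw [indicator_of_mem hj, indicator_of_mem (this j hj)]
    rfl
  · rw [indicator_of_notMem hj, zero_mul]
    exact mul_nonneg (indicator_one_nonneg _ _) ((χ.warp t).2.1 j)

theorem exists_jump {φ ψ : Reparam} {z : NilClassifying q G}
    (hφ : z ∈ jump q φ φ (1 : ZerothHomotopy G)) (hψ : z ∈ jump q ψ ψ (1 : ZerothHomotopy G)) :
    ∃ a : ZerothHomotopy G, z ∈ jump q φ ψ a := by
  obtain ⟨n, x, t, rfl⟩ := exists_mk z
  obtain ⟨g, g1, -⟩ := mk_mem_conc.1 hφ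
  obtain ⟨h, h1, -⟩ := mk_mem_conc.1 hψ
  refine ⟨toPiZero G (g⁻¹ * h), mk_mem_conc.2 ⟨g, g1, h1.trans_le ?_⟩⟩
  have : ∀ j, h⁻¹ * vert x j ∈ comp 1 → g⁻¹ * vert x j ∈ comp (toPiZero G (g⁻¹ * h)) := by
    intro j hj
    simp only [mem_comp, map_mul, map_inv, inv_mul_eq_iff_eq_mul, mul_one] at hj ⊢
    rw [hj, mul_inv_cancel_left]
  refine Finset.sum_le_sum fun j _ => ?_
  by_cases hj : h⁻¹ * vert x j ∈ comp 1
  · rw [indicator_of_mem hj, indicator_of_mem (this j hj)]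
    rfl
  · rw [indicator_of_notMem hj, zero_mul]
    exact mul_nonneg (indicator_one_nonneg _ _) ((ψ.warp t).2.1 j)

theorem mk_mem_jump_of_vertex {φ ψ : Reparam} {n : ℕ} {x : nilTuples q G n} {t : Simp n}
    {i j : Fin (n + 1)} (hφ : φ.warp t = stdSimplex.vertex i)
    (hψ : ψ.warp t = stdSimplex.vertex j) :
    mk x t ∈ jump q φ ψ (toPiZero G ((vert x i)⁻¹ * vert x j)) := by
  refine mk_mem_conc.2 ⟨vert x i, ?_, ?_⟩
  · rw [hφ, mass_vertex _ _ _ _ (by simp [mem_comp])]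
    norm_num
  · rw [hψ, mass_vertex _ _ _ _ (by rw [mem_comp])]
    norm_num

theorem exists_mem_jump_self [T1Space G] (z : NilClassifying q G) :
    ∃ φ, z ∈ jump q φ φ (1 : ZerothHomotopy G) := by
  obtain ⟨n, x, t, rfl⟩ := exists_mk z
  obtain ⟨i, hi⟩ := exists_pos_coord t
  obtain ⟨φ, hφ, -⟩ := exists_window_aux x t i hi
  have := mk_mem_jump_of_vertex (x := x) hφ hφ
  rw [inv_mul_cancel, map_one] at this
  exact ⟨φ, this⟩

theorem pt_mem_jump (φ ψ : Reparam) : pt q G ∈ jump q φ ψ (1 : ZerothHomotopy G) :=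
  pt_mem_conc (by simp [mem_comp]) (by simp [mem_comp]) (by norm_num)

open Classical in
/-- The difference of the majority components seen by two reparametrizations. -/
noncomputable def jumpValue (φ ψ : Reparam) (z : NilClassifying q G) : ZerothHomotopy G :=
  if h : ∃ a : ZerothHomotopy G, z ∈ jump q φ ψ a then h.choose else 1

theorem jumpValue_eq {φ ψ : Reparam} {a : ZerothHomotopy G} {z : NilClassifying q G}
    (h : z ∈ jump q φ ψ a) : jumpValue φ ψ z = a := by
  have hex : ∃ a : ZerothHomotopy G, z ∈ jump q φ ψ a := ⟨a, h⟩
  rw [jumpValue, dif_pos hex]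
  exact jump_unique hex.choose_spec h

theorem isOpen_comp [LocallyPathConnectedSpace G] (a : ZerothHomotopy G) : IsOpen (comp a) :=
  (isOpen_discrete {a}).preimage ZerothHomotopy.isQuotientMap_mk.continuous

theorem isOpen_jump [LocallyPathConnectedSpace G] (φ ψ : Reparam) (a : ZerothHomotopy G) :
    IsOpen (jump q φ ψ a) :=
  isOpen_conc (isOpen_comp 1) (isOpen_comp a) _ _ _

/-- The bundle of path components over `B(q, G)`. -/
noncomputable def componentBundle (q : ℕ) (G : Type*) [Group G] [TopologicalSpace G]
    [IsTopologicalGroup G] [T1Space G] [LocallyPathConnectedSpace G] :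
    FiberBundleCore Reparam (NilClassifying q G) (ZerothHomotopy G) where
  baseSet φ := jump q φ φ (1 : ZerothHomotopy G)
  isOpen_baseSet φ := isOpen_jump φ φ 1
  indexAt z := (exists_mem_jump_self z).choose
  mem_baseSet_at z := (exists_mem_jump_self z).choose_spec
  -- Right multiplication, so that the cocycle identity is `jump_trans`. The changes are locally
  -- constant because each `jump` set is open.
  coordChange φ ψ z a := a * jumpValue φ ψ z
  coordChange_self φ z hz a := by rw [jumpValue_eq hz, mul_one]
  continuousOn_coordChange φ ψ := by
    rintro ⟨z, a⟩ ⟨hz, -⟩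
    obtain ⟨b, hb⟩ := exists_jump hz.1 hz.2
    refine ContinuousAt.continuousWithinAt ?_
    have hev : ∀ᶠ p : NilClassifying q G × ZerothHomotopy G in 𝓝 (z, a),
        p.2 * jumpValue φ ψ p.1 = p.2 * b := by
      filter_upwards [(continuous_fst.tendsto (z, a)).eventually
        ((isOpen_jump φ ψ b).mem_nhds hb)] with p hp
      rw [jumpValue_eq hp]
    refine ContinuousAt.congr ?_ (hev.mono fun _ h => h.symm)
    exact ((continuous_of_discreteTopology (f := fun c : ZerothHomotopy G => c * b)).comp
      continuous_snd).continuousAt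
  coordChange_comp φ ψ χ z hz a := by
    obtain ⟨b, hb⟩ := exists_jump hz.1.1 hz.1.2
    obtain ⟨c, hc⟩ := exists_jump hz.1.2 hz.2
    rw [jumpValue_eq hb, jumpValue_eq hc, jumpValue_eq (jump_trans hb hc), mul_assoc]

end Cover

end NilClassifying

/-! ### Lifts of edge loops and injectivity. -/

namespace NilClassifying

section Lifts

variable {q : ℕ} {G : Type*} [Group G] [TopologicalSpace G] [IsTopologicalGroup G] [T1Space G]
  [LocallyPathConnectedSpace G]

theorem isCoveringMap_componentBundle : IsCoveringMap (componentBundle q G).proj :=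
  FiberBundle.isCoveringMap (F := ZerothHomotopy G) (E := (componentBundle q G).Fiber)

/-- The point of the bundle of components over `z` with coordinate `a` with respect to `φ`. -/
noncomputable def sheet (φ : Reparam) (p : NilClassifying q G × ZerothHomotopy G) :
    (componentBundle q G).TotalSpace :=
  ((componentBundle q G).localTriv φ).toOpenPartialHomeomorph.symm p

theorem proj_sheet (φ : Reparam) (p : NilClassifying q G × ZerothHomotopy G) :
    (componentBundle q G).proj (sheet φ p) = p.1 := rfl

theorem continuousOn_sheet (φ : Reparam) :
    ContinuousOn (sheet φ) {p : NilClassifying q G × ZerothHomotopy G |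
      p.1 ∈ jump q φ φ (1 : ZerothHomotopy G)} := by
  refine ((componentBundle q G).localTriv φ).toOpenPartialHomeomorph.continuousOn_symm.mono ?_
  intro p hp
  exact ((componentBundle q G).mem_localTriv_target φ p).2 hp

theorem sheet_eq {φ ψ : Reparam} {z : NilClassifying q G}
    (hφ : z ∈ jump q φ φ (1 : ZerothHomotopy G)) (hψ : z ∈ jump q ψ ψ (1 : ZerothHomotopy G))
    {b : ZerothHomotopy G} (hb : z ∈ jump q φ ψ b) (a : ZerothHomotopy G) :
    sheet φ (z, a) = sheet ψ (z, a * b) := by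
  have h := (componentBundle q G).coordChange_comp φ ψ ((componentBundle q G).indexAt z) z
    ⟨⟨hφ, hψ⟩, (componentBundle q G).mem_baseSet_at z⟩ a
  have hab : (componentBundle q G).coordChange φ ψ z a = a * b :=
    congrArg (a * ·) (jumpValue_eq hb)
  rw [hab] at h
  exact congrArg (Bundle.TotalSpace.mk z) h.symm

theorem sheet_injective {φ : Reparam} {z : NilClassifying q G}
    (hφ : z ∈ jump q φ φ (1 : ZerothHomotopy G)) {a b : ZerothHomotopy G}
    (h : sheet φ (z, a) = sheet φ (z, b)) : a = b := by
  have := ((componentBundle q G).localTriv φ).toOpenPartialHomeomorph.symm.injOn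
    (((componentBundle q G).mem_localTriv_target φ (z, a)).2 hφ)
    (((componentBundle q G).mem_localTriv_target φ (z, b)).2 hφ) h
  exact congrArg Prod.snd this

/-- The window of the first half of the interval. -/
noncomputable def leftHalf : Reparam := Reparam.window 0 (1 / 2) le_rfl (by norm_num) (by norm_num)

/-- The window of the second half of the interval. -/
noncomputable def rightHalf : Reparam :=
  Reparam.window (1 / 2) 1 (by norm_num) (by norm_num) le_rfl

theorem cum_mix_vertex (s : I) : (Simp.mix s (stdSimplex.vertex 0) (stdSimplex.vertex 1) :
    Simp 1).cum 1 = 1 - s := by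
  have := Simp.cum_succ (Simp.mix s (stdSimplex.vertex 0) (stdSimplex.vertex 1) : Simp 1) 0
  simp only [Fin.val_zero, zero_add] at this
  rw [this, Simp.cum_zero, Simp.mix_apply]
  simp

theorem leftHalf_warp {s : I} (hs : (s : ℝ) ≤ 1 / 2) :
    leftHalf.warp (Simp.mix s (stdSimplex.vertex 0) (stdSimplex.vertex 1) : Simp 1) =
      stdSimplex.vertex 0 := by
  refine Reparam.warp_window_eq_vertex ?_ ?_
  · exact (Simp.cum_zero _).le
  · have := cum_mix_vertex s
    change _ ≤ Simp.cum _ 1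
    rw [this]
    linarith

theorem rightHalf_warp {s : I} (hs : 1 / 2 ≤ (s : ℝ)) :
    rightHalf.warp (Simp.mix s (stdSimplex.vertex 0) (stdSimplex.vertex 1) : Simp 1) =
      stdSimplex.vertex 1 := by
  refine Reparam.warp_window_eq_vertex ?_ ?_
  · have := cum_mix_vertex s
    change Simp.cum _ 1 ≤ _
    rw [this]
    linarith
  · exact (Simp.cum_of_le _ le_rfl).ge

end Lifts

section EdgeLifts

variable {q : ℕ} {G : Type*} [Group G] [TopologicalSpace G] [IsTopologicalGroup G] (hq : 2 ≤ q)

theorem edgePoint_mem_jump_left (g : G) {s : I} (hs : (s : ℝ) ≤ 1 / 2) :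
    edgePoint hq g s ∈ jump q leftHalf leftHalf (1 : ZerothHomotopy G) := by
  have := mk_mem_jump_of_vertex (x := edge hq g) (leftHalf_warp hs) (leftHalf_warp hs)
  rwa [inv_mul_cancel, map_one] at this

theorem edgePoint_mem_jump_right (g : G) {s : I} (hs : 1 / 2 ≤ (s : ℝ)) :
    edgePoint hq g s ∈ jump q rightHalf rightHalf (1 : ZerothHomotopy G) := by
  have := mk_mem_jump_of_vertex (x := edge hq g) (rightHalf_warp hs) (rightHalf_warp hs)
  rwa [inv_mul_cancel, map_one] at this

variable [T1Space G] [LocallyPathConnectedSpace G]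

/-- The lift of an edge loop to the bundle of components. -/
noncomputable def edgeLift (g : G) (s : I) : (componentBundle q G).TotalSpace :=
  if (s : ℝ) ≤ 1 / 2 then sheet leftHalf (edgePoint hq g s, 1)
  else sheet rightHalf (edgePoint hq g s, toPiZero G g)

theorem continuous_edgeLift (g : G) : Continuous (edgeLift hq g) := by
  have hc : ∀ a : ZerothHomotopy G, Continuous fun s : I => (edgePoint hq g s, a) := fun a =>
    ((continuous_edgePoint hq).comp (by fun_prop : Continuous fun s : I => (g, s))).prodMk
      continuous_const
  refine continuous_if_le (by fun_prop) (by fun_prop) ?_ ?_ ?_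
  · exact (continuousOn_sheet leftHalf).comp (hc _).continuousOn
      fun s hs => edgePoint_mem_jump_left hq g hs
  · exact (continuousOn_sheet rightHalf).comp (hc _).continuousOn
      fun s hs => edgePoint_mem_jump_right hq g hs
  · intro s hs
    -- At the midpoint the left window sees exactly vertex 0 and the right window exactly vertex 1,
    -- so the change of sheets is the component of g.
    have := mk_mem_jump_of_vertex (x := edge hq g) (leftHalf_warp hs.le) (rightHalf_warp hs.ge)
    rw [vert_edge_zero, vert_edge_one, inv_one, one_mul] at this
    rw [sheet_eq (edgePoint_mem_jump_left hq g hs.le) (edgePoint_mem_jump_right hq g hs.ge) this,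
      one_mul]

theorem edgeHom_injective (hcomm : ∀ a b : ZerothHomotopy G, a * b = b * a)
    (s : ZerothHomotopy G →* G) (hs : (toPiZero G).comp s = MonoidHom.id _) :
    Function.Injective (edgeHom hq hcomm s) := by
  intro a b hab
  have hab' : (edgeLoop hq (s a)).Homotopic (edgeLoop hq (s b)) := pathClass_eq_iff.1 hab
  obtain ⟨H⟩ := hab'
  let γ : G → C(I, NilClassifying q G) := fun g =>
    ((edgeLoop hq g).map continuous_subtype_val).toContinuousMap
  have hH : (γ (s a)).HomotopicRel (γ (s b)) {0, 1} := ⟨H.map ⟨Subtype.val, by fun_prop⟩⟩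
  let e : (componentBundle q G).TotalSpace := sheet leftHalf (pt q G, 1)
  have h0 : ∀ g, γ g 0 = (componentBundle q G).proj e := fun g => edgePoint_zero hq g
  -- Monodromy: the lift starting on sheet 1 ends on the sheet of the component of g. Homotopic
  -- loops have lifts with the same end, and the component of s c is c.
  have hlift : ∀ g, isCoveringMap_componentBundle.liftPath (γ g) e (h0 g) 1 =
      sheet rightHalf (pt q G, toPiZero G g) := by
    intro g
    have h1 := (isCoveringMap_componentBundle.eq_liftPath_iff (h0 g)
      (Γ := edgeLift hq g)).2 ⟨continuous_edgeLift hq g, ?_, ?_⟩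
    · rw [← h1, edgeLift, if_neg (by norm_num), edgePoint_one]
    · funext r
      rw [Function.comp_apply, edgeLift]
      split_ifs
      · exact proj_sheet _ _
      · exact proj_sheet _ _
    · rw [edgeLift, if_pos (by norm_num), edgePoint_zero]
  have h2 := isCoveringMap_componentBundle.liftPath_apply_one_eq_of_homotopicRel hH e (h0 _) (h0 _)
  rw [hlift, hlift] at h2
  have h3 := sheet_injective (pt_mem_jump _ _) h2
  have h4 : ∀ c, toPiZero G (s c) = c := fun c => DFunLike.congr_fun hs c
  rwa [h4, h4] at h3

end EdgeLifts

/-! ### Path connectedness and the passage to the whole space. -/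

section PathConnected

variable {q : ℕ} {G : Type*} [Group G] [TopologicalSpace G]

theorem pathConnectedSpace (q : ℕ) (G : Type*) [Group G] [TopologicalSpace G] :
    PathConnectedSpace (NilClassifying q G) := by
  have h : ∀ z, Joined z (pt q G) := by
    intro z
    obtain ⟨n, x, t, rfl⟩ := exists_mk z
    let p : Path (⟨mk x t, mem_univ _⟩ : (univ : Set (NilClassifying q G))) (univPt q G) :=
      segPath x t (stdSimplex.vertex 0) rfl (mk_vertex _ _).symm fun _ => mem_univ _
    exact ⟨p.map continuous_subtype_val⟩
  exact ⟨⟨pt q G⟩, fun z w => (h z).trans (h w).symm⟩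

end PathConnected

/-- Paths were treated inside subsets A so that the same lemmas serve the stages and the whole
space; this removes the subset when it is everything. -/
theorem bijective_map_val {X : Type*} [TopologicalSpace X] (o : (univ : Set X)) :
    Function.Bijective (FundamentalGroup.map (⟨Subtype.val, continuous_subtype_val⟩ :
      C((univ : Set X), X)) o) := by
  have hc : Continuous fun z : X => (⟨z, mem_univ z⟩ : (univ : Set X)) := by fun_prop
  constructor
  · intro c d
    induction c using Quotient.inductionOn with
    | h p =>
    induction d using Quotient.inductionOn with
    | h r =>
    intro h
    have h1 : (p.map continuous_subtype_val).Homotopic (r.map continuous_subtype_val) :=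
      Quotient.exact h
    exact Quotient.sound (h1.map ⟨_, hc⟩)
  · intro c
    induction c using Quotient.inductionOn with
    | h p => exact ⟨pathClass (p.map hc : Path o o), rfl⟩

end NilClassifying

end

theorem lemma4p3 {G : Type*} [Group G] [TopologicalSpace G] [IsTopologicalGroup G]
    [T2Space G] [Topology.CWComplex (Set.univ : Set G)]
    (hcomm : ∀ a b : ZerothHomotopy G, a * b = b * a)
    (hsplit : ∃ s : ZerothHomotopy G →* G, (toPiZero G).comp s = MonoidHom.id _)
    (q : ℕ) (hq : 2 ≤ q) :
    PathConnectedSpace (NilClassifying q G) ∧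
      ∀ b : NilClassifying q G,
        Nonempty (FundamentalGroup (NilClassifying q G) b ≃* ZerothHomotopy G) := by
  have hpc := NilClassifying.pathConnectedSpace q G
  refine ⟨hpc, fun b => ?_⟩
  obtain ⟨s, hs⟩ := hsplit
  have := locallyPathConnectedSpace_of_cwComplex G
  let Ψ := MulEquiv.ofBijective (NilClassifying.edgeHom hq hcomm s)
    ⟨NilClassifying.edgeHom_injective hq hcomm s hs,
      NilClassifying.edgeHom_surjective hq hcomm s hs⟩
  exact ⟨(FundamentalGroup.fundamentalGroupMulEquivOfPathConnected b (NilClassifying.pt q G)).trans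
    ((MulEquiv.ofBijective _
      (NilClassifying.bijective_map_val (NilClassifying.univPt q G))).symm.trans Ψ.symm)⟩
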